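/- **Setting.** Let $(q_k)_{k\ge 0}$ be a probability distribution on $\mathbb N$ with $q_0=0$ and mean $m=\sum_k kq_k\in(1,\infty)$, and let $\nu_{\min}\ge 1$ be the smallest $k$ with $q_k>0$. Let $A$ be a positive random variable with $0<i:=\operatorname{ess\,inf}A\le s:=\operatorname{ess\,sup}A<\infty$, and assume that $\inf_{t\in[0,1]}\mathbf E[A^t]>\frac1m$. Let $\mathbb T$ be a Galton–Watson tree with root $e$ and offspring distribution $(q_k)$. Write $|x|$ for the generation of a vertex $x$, $\nu(x)$ for its number of children and $x_1,\dots,x_{\nu(x)}$ for its children. Given $\mathbb T$, attach to the vertices i.i.d. copies $A(x)$ of $A$. Add to the root a parent $\overleftarrow e$ (of generation $-1$, with the single child $e$), write $\overleftarrow x$ for the parent of $x$, and put $$\omega(x,x_i)=\frac{A(x_i)}{1+\sum_{j=1}^{\nu(x)}A(x_j)},\qquad \omega(x,\overleftarrow x)=\frac{1}{1+\sum_{j=1}^{\nu(x)}A(x_j)},\qquad \omega(\overleftarrow e,e)=1 .$$ Given the environment $\omega$, let $(X_n)_{n\ge0}$ be the Markov chain started from $e$ with transition probabilities $\omega(x,y)$,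 and let $\mathbb Q^e$ be the joint (annealed) law of the environment, including the tree, and the walk. Put $$\tau_n=\inf\{k\ge0: |X_k|=n\},\qquad D(x)=\inf\{k\ge1: X_{k-1}=x,\ X_k=\overleftarrow x\},\qquad \inf\emptyset=\infty,$$ $$\Gamma_1=\inf\{k>0:\ \nu(X_k)\ge2,\ D(X_k)=\infty,\ k=\tau_{|X_k|}\},\qquad \mathbb S^e(\cdot)=\mathbb Q^e(\,\cdot\mid D(e)=\infty).$$ **Proposition 2.2.** Suppose that $i<\nu_{\min}^{-1}$. 1. If $q_1=0$, then there exist $1>\alpha_1>\alpha_2>0$ such that for all $n$ large enough $$e^{-n^{\alpha_1}}<\mathbb S^e(\Gamma_1>n)<e^{-n^{\alpha_2}} .$$ 2. If $s<1$, then there exist $1>\alpha_3>\alpha_4>0$ such that for all $n$ large enough $$e^{-n^{\alpha_3}}<\mathbb S^e(\Gamma_1>n)<e^{-n^{\alpha_4}} .$$ -/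

import Mathlib

open MeasureTheory ProbabilityTheory Filter
open scoped ENNReal NNReal

namespace RWRE

/-! ### Environments on a marked Galton-Watson tree

Vertices are finite words: `[]` is the root `e`, and the children of `x` are the words `i :: x`
with `i < ν(x)` (the most recent letter comes first). The extra vertex `none` is the parent that is
added to the root. -/

/-- The vertices: `some x` for a word `x`, and `none` for the parent of the root. -/
def Vertex : Type := Option (List ℕ)

instance : Countable Vertex := inferInstanceAs (Countable (Option (List ℕ)))
instance : DecidableEq Vertex := inferInstanceAs (DecidableEq (Option (List ℕ)))
instance : Inhabited Vertex := ⟨(none : Option (List ℕ))⟩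
instance : MeasurableSpace Vertex := ⊤
instance : DiscreteMeasurableSpace Vertex := ⟨fun _ => trivial⟩

/-- The vertex given by a word. -/
def word (x : List ℕ) : Vertex := (some x : Option (List ℕ))

/-- The parent added to the root. -/
def rootParent : Vertex := (none : Option (List ℕ))

/-- The root `e`. -/
def root : Vertex := word []

/-- The parent of a word. -/
def wordParent : List ℕ → Vertex
  | [] => rootParent
  | _ :: x => word x

/-- The parent of a vertex (by convention `rootParent` is its own parent). -/
def parent : Vertex → Vertex
  | none => rootParent
  | some x => wordParent x

/-- The generation `|x|`; the root has generation `0` and its added parent `-1`. -/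
def gen : Vertex → ℤ
  | none => -1
  | some x => x.length

/-- An environment: to each word `x` are attached its number of children `ν(x)` and its
mark `A(x) ≥ 0`. The tree consists of the words all of whose letters `i` satisfy
`i < ν(parent)`; the data attached to other words play no role. -/
abbrev Env : Type := List ℕ → ℕ × ℝ≥0

/-- The number of children of a vertex; the added parent of the root has the single child `e`. -/
def numChildren (ω : Env) : Vertex → ℕ
  | none => 1
  | some x => (ω x).1

/-- `1 + ∑ A(xᵢ)`, the sum being over the children of `x`. -/
noncomputable def total (ω : Env) (x : List ℕ) : ℝ≥0 :=
  1 + ∑ i ∈ Finset.range (ω x).1, (ω (i :: x)).2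

/-- The transition probability `ω(x, z)`:
`ω(x, xᵢ) = A(xᵢ) / (1 + ∑ A(xⱼ))`, `ω(x, parent x) = 1 / (1 + ∑ A(xⱼ))`, and the added parent
of the root leads to the root with probability one. -/
noncomputable def transProb (ω : Env) : Vertex → Vertex → ℝ≥0∞
  | none, z => if z = root then 1 else 0
  | some x, z =>
      (if z = wordParent x then ((1 / total ω x : ℝ≥0) : ℝ≥0∞) else 0) +
      ∑ i ∈ Finset.range (ω x).1,
        if z = word (i :: x) then (((ω (i :: x)).2 / total ω x : ℝ≥0) : ℝ≥0∞) else 0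

theorem total_pos (ω : Env) (x : List ℕ) : 0 < total ω x := by
  unfold total; positivity

theorem tsum_transProb (ω : Env) (y : Vertex) : ∑' z, transProb ω y z = 1 := by
  rcases y with _ | x
  · simp only [transProb]
    exact tsum_ite_eq root _
  · simp only [transProb]
    rw [ENNReal.tsum_add, tsum_ite_eq, Summable.tsum_finsetSum (fun _ _ => ENNReal.summable)]
    simp only [tsum_ite_eq]
    rw [← ENNReal.ofNNReal_finsetSum, ← ENNReal.coe_add, ← Finset.sum_div, ← add_div]
    have h : (1 + ∑ i ∈ Finset.range (ω x).1, (ω (i :: x)).2) = total ω x := rfl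
    rw [h, div_self (total_pos ω x).ne', ENNReal.coe_one]

/-- The law of one step of the walk in the environment `ω`, from the vertex `y`. -/
noncomputable def stepLaw (ω : Env) (y : Vertex) : PMF Vertex :=
  ⟨transProb ω y, tsum_transProb ω y ▸ ENNReal.summable.hasSum⟩

/-- The transition kernel of the walk in the environment `ω`. -/
noncomputable def stepKernel (ω : Env) : Kernel Vertex Vertex :=
  Kernel.ofFunOfCountable fun y => (stepLaw ω y).toMeasure

instance (ω : Env) : IsMarkovKernel (stepKernel ω) :=
  ⟨fun y => inferInstanceAs (IsProbabilityMeasure (stepLaw ω y).toMeasure)⟩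

/-- The step to time `n + 1` given the trajectory up to time `n`: it depends on the position at
time `n` only. -/
noncomputable def histKernel (ω : Env) (n : ℕ) :
    Kernel (∀ _ : Finset.Iic n, Vertex) Vertex :=
  (stepKernel ω).comap (fun h => h ⟨n, Finset.mem_Iic.2 le_rfl⟩) (measurable_pi_apply _)

instance (ω : Env) (n : ℕ) : IsMarkovKernel (histKernel ω n) := by
  unfold histKernel; infer_instance

/-- The quenched law `P_ω^y`: the law of the trajectory `(X_n)_{n ≥ 0}` of the Markov chain started
from `y` whose transition probabilities are `ω(x, z)`. -/
noncomputable def quenchedLaw (ω : Env) (y : Vertex) : Measure (ℕ → Vertex) :=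
  Kernel.trajMeasure (X := fun _ => Vertex) (Measure.dirac y) (histKernel ω)

instance (ω : Env) (y : Vertex) : IsProbabilityMeasure (quenchedLaw ω y) := by
  unfold quenchedLaw; infer_instance

/-- The trajectories that start with `a 0, …, a n`. -/
def startsWith (a : ℕ → Vertex) (n : ℕ) : Set (ℕ → Vertex) := {X | ∀ k ≤ n, X k = a k}


theorem measurableSet_startsWith (a : ℕ → Vertex) (n : ℕ) : MeasurableSet (startsWith a n) := by
  have h : startsWith a n = ⋂ k, ⋂ (_ : k ≤ n), (fun X : ℕ → Vertex => X k) ⁻¹' {a k} := by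
    ext X; simp [startsWith]
  rw [h]
  exact MeasurableSet.iInter fun k => MeasurableSet.iInter fun _ =>
    measurable_pi_apply k (measurableSet_singleton _)

/-- `P_ω^y(X_0 = y) = 1`. -/
theorem quenchedLaw_startsWith_zero (ω : Env) (y : Vertex) (a : ℕ → Vertex) :
    quenchedLaw ω y (startsWith a 0) = if a 0 = y then 1 else 0 := by
  have hm : Measurable (Preorder.frestrictLe (π := fun _ : ℕ => Vertex) 0) := by fun_prop
  have h : startsWith a 0 = Preorder.frestrictLe (π := fun _ : ℕ => Vertex) 0 ⁻¹'
      {h | h ⟨0, Finset.mem_Iic.2 le_rfl⟩ = a 0} := by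
    ext X; simp [startsWith]
  have hs : MeasurableSet {h : (∀ _ : Finset.Iic 0, Vertex) |
      h ⟨0, Finset.mem_Iic.2 le_rfl⟩ = a 0} :=
    (measurable_pi_apply (X := fun _ : Finset.Iic 0 => Vertex) _) (measurableSet_singleton (a 0))
  rw [h, ← Measure.map_apply hm hs, quenchedLaw, Kernel.trajMeasure,
    Measure.map_comp _ _ hm, Kernel.traj_map_frestrictLe, Kernel.partialTraj_self,
    Measure.id_comp, Measure.map_dirac' (by fun_prop), Measure.dirac_apply' _ hs]
  simp only [Set.indicator, Set.mem_ofPred_eq, Pi.one_apply]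
  exact if_congr eq_comm rfl rfl

/-- The Markov property `P_ω^y(X_{n+1} = z | X_0, …, X_n) = ω(X_n, z)`, for elementary events. -/
theorem quenchedLaw_startsWith_succ (ω : Env) (y : Vertex) (a : ℕ → Vertex) (n : ℕ) :
    quenchedLaw ω y (startsWith a (n + 1)) =
      quenchedLaw ω y (startsWith a n) * transProb ω (a n) (a (n + 1)) := by
  have hm : Measurable (Preorder.frestrictLe (π := fun _ : ℕ => Vertex) n) := by fun_prop
  have key := Kernel.map_frestrictLe_trajMeasure_compProd_eq_map_trajMeasure
    (X := fun _ => Vertex) (μ₀ := Measure.dirac y) (κ := histKernel ω) (a := n)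
  set H : Set (∀ _ : Finset.Iic n, Vertex) := {Preorder.frestrictLe n a}
  have hH : MeasurableSet H := measurableSet_singleton _
  have h1 : startsWith a n = Preorder.frestrictLe (π := fun _ : ℕ => Vertex) n ⁻¹' H := by
    ext X
    simp only [startsWith, H, Set.mem_ofPred_eq, Set.mem_preimage, Set.mem_singleton_iff,
      funext_iff, Subtype.forall, Finset.mem_Iic, Preorder.frestrictLe_apply]
  have h2 : startsWith a (n + 1) =
      (fun X : ℕ → Vertex => (Preorder.frestrictLe (π := fun _ : ℕ => Vertex) n X, X (n + 1))) ⁻¹'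
        (H ×ˢ {a (n + 1)}) := by
    rw [Set.mk_preimage_prod, ← h1]
    ext X
    simp only [startsWith, Set.mem_ofPred_eq, Set.mem_inter_iff, Set.mem_preimage,
      Set.mem_singleton_iff]
    constructor
    · exact fun h => ⟨fun k hk => h k (by omega), h _ le_rfl⟩
    · rintro ⟨h, h'⟩ k hk
      rcases Nat.lt_or_ge n k with hk' | hk'
      · obtain rfl : k = n + 1 := by omega
        exact h'
      · exact h k hk'
  have hP : MeasurableSet (H ×ˢ ({a (n + 1)} : Set Vertex)) :=
    hH.prod (measurableSet_singleton _)
  have hm' : Measurable fun X : ℕ → Vertex =>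
      (Preorder.frestrictLe (π := fun _ : ℕ => Vertex) n X, X (n + 1)) := by fun_prop
  rw [h2, ← Measure.map_apply hm' hP, quenchedLaw, ← key, Measure.compProd_apply_prod hH (measurableSet_singleton _)]
  simp only [H, lintegral_singleton]
  rw [Measure.map_apply hm hH, ← h1, mul_comm]
  congr 1
  change (stepLaw ω (a n)).toMeasure {a (n + 1)} = _
  rw [PMF.toMeasure_apply_singleton _ _ (measurableSet_singleton _)]
  rfl

theorem measurable_of_numChildren {β : Type*} [MeasurableSpace β] (x : List ℕ) (g : ℕ → Env → β)
    (hg : ∀ m, Measurable (g m)) : Measurable fun ω : Env => g (ω x).1 ω := by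
  have h : Measurable fun p : ℕ × Env => g p.1 p.2 := measurable_from_prod_countable_right hg
  have h' : Measurable fun ω : Env => ((ω x).1, ω) := by fun_prop
  exact h.comp h'

theorem measurable_total (x : List ℕ) : Measurable fun ω : Env => total ω x := by
  refine measurable_of_numChildren x
    (fun m ω => 1 + ∑ i ∈ Finset.range m, (ω (i :: x)).2) fun m => ?_
  refine measurable_const.add (Finset.measurable_sum _ fun i _ => ?_)
  fun_prop

theorem measurable_transProb (y z : Vertex) : Measurable fun ω : Env => transProb ω y z := by
  rcases y with _ | x
  · exact measurable_const
  · have hT := measurable_total x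
    refine measurable_of_numChildren x (fun m ω =>
      (if z = wordParent x then ((1 / total ω x : ℝ≥0) : ℝ≥0∞) else 0) +
      ∑ i ∈ Finset.range m,
        if z = word (i :: x) then (((ω (i :: x)).2 / total ω x : ℝ≥0) : ℝ≥0∞) else 0) fun m => ?_
    refine Measurable.add ?_ (Finset.measurable_sum _ fun i _ => ?_)
    · split_ifs <;> fun_prop
    · split_ifs <;> fun_prop

theorem measurable_quenchedLaw_startsWith (y : Vertex) (a : ℕ → Vertex) (n : ℕ) :
    Measurable fun ω : Env => quenchedLaw ω y (startsWith a n) := by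
  induction n with
  | zero => simp only [quenchedLaw_startsWith_zero]; exact measurable_const
  | succ n ih =>
    simp only [quenchedLaw_startsWith_succ]
    exact ih.mul (measurable_transProb _ _)

theorem measurable_quenchedLaw (y : Vertex) : Measurable fun ω : Env => quenchedLaw ω y := by
  refine Measurable.measure_of_isPiSystem_of_isProbabilityMeasure
    (S := measurableCylinders fun _ : ℕ => Vertex)
    generateFrom_measurableCylinders.symm isPiSystem_measurableCylinders fun t ht => ?_
  obtain ⟨N, S, mS, rfl⟩ : ∃ N S, MeasurableSet S ∧ t = cylinder (Finset.Iic N) S := by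
    simpa [measurableCylinders_nat] using ht
  have hU : (cylinder (Finset.Iic N) S : Set (ℕ → Vertex)) =
      ⋃ h : S, startsWith
        (fun k => if hk : k ≤ N then h.1 ⟨k, Finset.mem_Iic.2 hk⟩ else root) N := by
    ext X
    simp only [cylinder, Set.mem_preimage, Set.mem_iUnion, startsWith, Set.mem_ofPred_eq]
    constructor
    · intro hX
      exact ⟨⟨_, hX⟩, fun k hk => by simp [hk]⟩
    · rintro ⟨⟨h, hS⟩, hX⟩
      convert hS
      ext ⟨k, hk⟩
      have := hX k (Finset.mem_Iic.1 hk)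
      simpa [Finset.mem_Iic.1 hk] using this
  have hd : Pairwise (Function.onFun Disjoint fun h : S => startsWith
        (fun k => if hk : k ≤ N then h.1 ⟨k, Finset.mem_Iic.2 hk⟩ else root) N) := by
    intro h h' hne
    refine Set.disjoint_left.2 fun X hX hX' => hne (Subtype.ext (funext fun k => ?_))
    have hk := Finset.mem_Iic.1 k.2
    have e := (hX k hk).symm.trans (hX' k hk)
    simpa [hk] using e
  simp only [hU, measure_iUnion hd fun h => measurableSet_startsWith _ N]
  exact Measurable.tsum fun h => measurable_quenchedLaw_startsWith _ _ _

/-- `ω ↦ P_ω^y` as a probability kernel. -/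
noncomputable def quenchedKernel (y : Vertex) : Kernel Env (ℕ → Vertex) where
  toFun ω := quenchedLaw ω y
  measurable' := measurable_quenchedLaw y

instance (y : Vertex) : IsMarkovKernel (quenchedKernel y) :=
  ⟨fun ω => inferInstanceAs (IsProbabilityMeasure (quenchedLaw ω y))⟩

/-- The law `𝐐` of the environment: the numbers of children `ν(x)` have law `q`, the marks `A(x)`
have law `ρ`, and all of these are independent. In particular the tree is a Galton-Watson tree with
offspring law `q`, and given the tree the marks are i.i.d. with law `ρ`. -/
noncomputable def envLaw (q : PMF ℕ) (ρ : Measure ℝ≥0) [IsProbabilityMeasure ρ] : Measure Env :=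
  Measure.infinitePi fun _ : List ℕ => q.toMeasure.prod ρ

/-- The annealed law `ℚ^y` of the pair formed by the environment and the trajectory `(X_n)`
started from `y`: the environment has law `𝐐`, and given the environment `ω` the trajectory
has law `P_ω^y`. -/
noncomputable def annealedLaw (q : PMF ℕ) (ρ : Measure ℝ≥0) [IsProbabilityMeasure ρ]
    (y : Vertex) : Measure (Env × (ℕ → Vertex)) :=
  (envLaw q ρ) ⊗ₘ (quenchedKernel y)

/-! ### Regeneration -/

/-- `τ_n`, the first time `k ≥ 0` at which `|X_k| = n` (and `∞` if there is none). -/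
noncomputable def hitGen (X : ℕ → Vertex) (n : ℤ) : ℕ∞ :=
  ⨅ (k : ℕ) (_ : gen (X k) = n), (k : ℕ∞)

/-- `D(x)`, the first time `k ≥ 1` at which the walk steps from `x` to the parent of `x`
(and `∞` if there is none). -/
noncomputable def returnTime (X : ℕ → Vertex) (x : Vertex) : ℕ∞ :=
  ⨅ (k : ℕ) (_ : 1 ≤ k ∧ X (k - 1) = x ∧ X k = parent x), (k : ℕ∞)

/-- `Γ₁`, the first regeneration time (`∞` if there is none). -/
noncomputable def firstRegen (ω : Env) (X : ℕ → Vertex) : ℕ∞ :=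
  ⨅ (k : ℕ) (_ : 0 < k ∧ 2 ≤ numChildren ω (X k) ∧ returnTime X (X k) = ⊤ ∧
    (k : ℕ∞) = hitGen X (gen (X k))), (k : ℕ∞)

/-- `𝕊^e`, the annealed law of the walk started at the root, conditioned on `D(e) = ∞`. -/
noncomputable def condLaw (q : PMF ℕ) (ρ : Measure ℝ≥0) [IsProbabilityMeasure ρ] :
    Measure (Env × (ℕ → Vertex)) :=
  ProbabilityTheory.cond (annealedLaw q ρ root) {p | returnTime p.2 root = ⊤}

/-! ### Parameters of the model -/

/-- `m`, the mean of the offspring law. -/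
noncomputable def offspringMean (q : PMF ℕ) : ℝ≥0∞ := ∑' k : ℕ, (k : ℝ≥0∞) * q k

/-- `ν_min`, the smallest `k` with `q_k > 0`. -/
noncomputable def nuMin (q : PMF ℕ) : ℕ := sInf {k | 0 < q k}

/-- `i = ess inf A`, where `A` has law `ρ`. -/
noncomputable def essInfA (ρ : Measure ℝ≥0) : ℝ≥0∞ := essInf (fun a : ℝ≥0 => (a : ℝ≥0∞)) ρ

/-- `s = ess sup A`, where `A` has law `ρ`. -/
noncomputable def essSupA (ρ : Measure ℝ≥0) : ℝ≥0∞ := essSup (fun a : ℝ≥0 => (a : ℝ≥0∞)) ρ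

/-- `𝐄[A^t]`, where `A` has law `ρ`. -/
noncomputable def momentA (ρ : Measure ℝ≥0) (t : ℝ) : ℝ≥0∞ := ∫⁻ a, (a : ℝ≥0∞) ^ t ∂ρ

end RWRE

/-! Throughout, β(x) = `esc (subEnv x ω)` is the probability that the walk started at x never visits
the parent of x, and S(x) = `escSum (subEnv x ω)` is the sum of A(y)β(y) over the children y of x;
then β = S/(1+S), that is S - β = βS.

Transience. The moment condition makes m^h 𝐄[min(1, A₁⋯A_h)] exceed 1 for some h
(`exists_one_lt_growth`): tilt by A^t, with t the minimizer of 𝐄[A^t] over [0,1]. Iterating blocks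
of h generations with weights min(1, ·) gives flows of mean one and bounded mean energy, so
Thomson's principle and Cauchy-Schwarz bound 𝐄[β] from below (`lintegral_esc_pos`). A fixed-point
argument for the offspring generating function upgrades this to β > 0 almost surely (`ae_esc_pos`).

Upper bound. Cut the tree at the generations M, 2M, …, with M a small power of n. If D(e) = ∞ and Γ₁
> n, then pathwise (`mem_of_lt_firstRegen`) one of three things occurs. (a) The walk stays in the
first M² generations up to time n. (b) After first hitting some level jM it reaches level (j+1)M and
later falls below jM. Such a return multiplies the return probabilities along M generations. The
t-th powers of these products, summed over paths, have exponentially small mean for t large, because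
each branching vertex offers an independent sibling through which to escape
(`exists_deepReturn_bound`). (c) At every level, the first vertex hit has a single child or the walk
falls below it before the next level. The environment below a newly hit vertex is independent of the
past, so the probability is geometric in the number of levels (`lintegral_firstHit_le`,
`lintegral_noRegen_le`). For (a) a Lyapunov function is used: a function u, polynomially bounded in
n, with u(x) + 1 ≤ ∑ A(y)(u(y) - 1) over the children y of x forces the walk out of the slab
(`quenchedLaw_confined_le_of_drift`). Since S - β = βS, a large multiple of β has this property
wherever β is not too small. If q₁ = 0, a small β at x requires small β at two or more independent
children, so the lower tail of β is doubly exponential in the number of generations explored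
(`measure_esc_lt_le_pow`). If s < 1, the vertices most of whose children have small β carry a load
with an exponential tail (`exists_trapLoad_tail`). Subtracting the load from the multiple of β
restores the drift, because marks at most one do not amplify it.

Lower bound. Some k₁ with positive probability satisfies P(k₁A > 1) > 0, because m𝐄[A] > 1; and k₂ =
ν_min satisfies P(k₂A < 1) > 0. Choosing offspring k₁ and large marks down to generation h, then k₂
and small marks down to generation 2h, builds a trap that holds the walk for a time exponential in
h. It costs a number of vertices exponential in h. With h a small multiple of log n both costs are
stretched exponentials. Afterwards the walk climbs back to the root and escapes; the visit to the
root after time n rules out any earlier regeneration (`lt_firstRegen_of_lateReturn`).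

Conditioning on D(e) = ∞ costs only a constant factor (`exists_condLaw_bounds`). -/

namespace RWRE

/-! ### The environment seen from a vertex -/

/-- The environment seen from the vertex `x`. -/
def subEnv (x : List ℕ) (ω : Env) : Env := fun y => ω (y ++ x)

theorem subEnv_subEnv (x y : List ℕ) (ω : Env) :
    subEnv y (subEnv x ω) = subEnv (y ++ x) ω := by
  funext z; simp [subEnv]

@[simp] theorem subEnv_nil (ω : Env) : subEnv [] ω = ω := by
  funext z; simp [subEnv]

theorem subEnv_singleton (i : ℕ) (x : List ℕ) (ω : Env) :
    subEnv [i] (subEnv x ω) = subEnv (i :: x) ω := subEnv_subEnv _ _ _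

theorem measurable_subEnv (x : List ℕ) : Measurable (subEnv x) :=
  measurable_pi_lambda _ fun _ => measurable_pi_apply _

theorem measurable_numChildren_word (x : List ℕ) : Measurable fun ω : Env => (ω x).1 := by
  fun_prop

theorem measurable_mark (x : List ℕ) : Measurable fun ω : Env => (ω x).2 := by
  fun_prop

theorem measurable_ite_numChildren (x : List ℕ) (k : ℕ) :
    Measurable fun ω : Env => (if (ω x).1 = k then 1 else 0 : ℝ≥0∞) :=
  (measurable_of_countable fun m : ℕ => (if m = k then 1 else 0 : ℝ≥0∞)).comp
    (measurable_numChildren_word x)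

instance (q : PMF ℕ) (ρ : Measure ℝ≥0) [IsProbabilityMeasure ρ] :
    IsProbabilityMeasure (envLaw q ρ) := by
  unfold envLaw; infer_instance

section law

variable (q : PMF ℕ) (ρ : Measure ℝ≥0) [IsProbabilityMeasure ρ]

/-- Appending `x` is injective on words, so this only reindexes an i.i.d. family. Since data are
attached to all words, `x` need not belong to the tree. -/
theorem map_subEnv (x : List ℕ) : (envLaw q ρ).map (subEnv x) = envLaw q ρ :=
  Measure.map_infinitePi_infinitePi_of_inj
    (P := fun _ : List ℕ => q.toMeasure.prod ρ) (f := fun y : List ℕ => y ++ x)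
    (List.append_left_injective x)

theorem lintegral_subEnv (x : List ℕ) {f : Env → ℝ≥0∞} (hf : Measurable f) :
    ∫⁻ ω, f (subEnv x ω) ∂envLaw q ρ = ∫⁻ ω, f ω ∂envLaw q ρ := by
  conv_rhs => rw [← map_subEnv q ρ x]
  rw [lintegral_map hf (measurable_subEnv x)]

theorem map_eval (y : List ℕ) : (envLaw q ρ).map (fun ω => ω y) = q.toMeasure.prod ρ :=
  Measure.infinitePi_map_eval (μ := fun _ : List ℕ => q.toMeasure.prod ρ) y

theorem map_numChildren (y : List ℕ) : (envLaw q ρ).map (fun ω => (ω y).1) = q.toMeasure := by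
  have : (fun ω : Env => (ω y).1) = Prod.fst ∘ fun ω : Env => ω y := rfl
  rw [this, ← Measure.map_map measurable_fst (measurable_pi_apply y), map_eval,
    Measure.map_fst_prod]
  simp

theorem map_mark (y : List ℕ) : (envLaw q ρ).map (fun ω => (ω y).2) = ρ := by
  have : (fun ω : Env => (ω y).2) = Prod.snd ∘ fun ω : Env => ω y := rfl
  rw [this, ← Measure.map_map measurable_snd (measurable_pi_apply y), map_eval,
    Measure.map_snd_prod]
  simp

/-! ### Independence of the data attached to disjoint sets of vertices -/

/-- The data at `y`: the number of children for the index `true`, the mark for `false`. -/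
noncomputable def datum (y : List ℕ) (b : Bool) (ω : Env) : ℝ≥0 :=
  if b then ((ω y).1 : ℝ≥0) else (ω y).2

theorem measurable_datum (y : List ℕ) (b : Bool) : Measurable (datum y b) := by
  unfold datum
  cases b
  · simp only [Bool.false_eq_true, if_false]; fun_prop
  · simp only [if_true]
    exact (measurable_of_countable (fun n : ℕ => (n : ℝ≥0))).comp
      (measurable_fst.comp (measurable_pi_apply y))

theorem iIndepFun_datum_vertex (y : List ℕ) : iIndepFun (datum y) (envLaw q ρ) := by
  rw [iIndepFun_iff_measure_inter_preimage_eq_mul]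
  have hind : IndepFun (datum y true) (datum y false) (envLaw q ρ) := by
    have h0 : IndepFun (fun ω : Env => (ω y).1) (fun ω : Env => (ω y).2) (envLaw q ρ) := by
      rw [indepFun_iff_map_prod_eq_prod_map_map (measurable_numChildren_word y).aemeasurable
        (measurable_mark y).aemeasurable, map_numChildren, map_mark]
      exact map_eval q ρ y
    exact h0.comp (φ := fun n : ℕ => (n : ℝ≥0)) (ψ := id) (measurable_of_countable _)
      measurable_id
  intro S sets hsets
  by_cases ht : true ∈ S <;> by_cases hf : false ∈ S
  · have hS : S = {true, false} := by ext b; cases b <;> simp [ht, hf]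
    subst hS
    have hI : (⋂ i ∈ ({true, false} : Finset Bool), datum y i ⁻¹' sets i) =
        datum y true ⁻¹' sets true ∩ datum y false ⁻¹' sets false := by
      ext ω; simp [and_comm]
    rw [hI]
    simpa using hind.measure_inter_preimage_eq_mul _ _
      (hsets true (by simp)) (hsets false (by simp))
  · have hS : S = {true} := by ext b; cases b <;> simp [ht, hf]
    subst hS; simp
  · have hS : S = {false} := by ext b; cases b <;> simp [ht, hf]
    subst hS; simp
  · have hS : S = ∅ := by ext b; cases b <;> simp [ht, hf]
    subst hS; simp

/-- The offspring number and the mark of one vertex get separate indices because a cut at generation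
ℓ passes between them: the steps out of generation ℓ - 1 read the marks of generation ℓ but not its
offspring numbers. -/
theorem iIndepFun_datum :
    iIndepFun (fun (p : List ℕ × Bool) (ω : Env) => datum p.1 p.2 ω) (envLaw q ρ) := by
  refine iIndepFun_uncurry' (X := datum) measurable_datum ?_ (iIndepFun_datum_vertex q ρ)
  have h := iIndepFun_infinitePi (P := fun _ : List ℕ => q.toMeasure.prod ρ)
    (X := fun (_ : List ℕ) (d : ℕ × ℝ≥0) (b : Bool) => if b then (d.1 : ℝ≥0) else d.2)
    (fun i => measurable_pi_lambda _ fun b => by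
      cases b
      · simp only [Bool.false_eq_true, if_false]; fun_prop
      · simp only [if_true]
        exact (measurable_of_countable (fun n : ℕ => (n : ℝ≥0))).comp measurable_fst)
  exact h

/-- The environment in which only the data with index in `S` are kept. -/
noncomputable def reveal (S : Set (List ℕ × Bool)) (ω : Env) : Env := by
  classical
  exact fun y => (if (y, true) ∈ S then (ω y).1 else 0, if (y, false) ∈ S then (ω y).2 else 0)

theorem reveal_fst {S : Set (List ℕ × Bool)} {y : List ℕ} (h : (y, true) ∈ S) (ω : Env) :
    (reveal S ω y).1 = (ω y).1 := by simp [reveal, h]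

theorem reveal_snd {S : Set (List ℕ × Bool)} {y : List ℕ} (h : (y, false) ∈ S) (ω : Env) :
    (reveal S ω y).2 = (ω y).2 := by simp [reveal, h]

/-- The σ-algebra generated by the data with index in `S`. -/
noncomputable abbrev dataSigma (S : Set (List ℕ × Bool)) : MeasurableSpace Env :=
  ⨆ p ∈ S, MeasurableSpace.comap (datum p.1 p.2) inferInstance

theorem measurable_datum_dataSigma {S : Set (List ℕ × Bool)} {y : List ℕ} {b : Bool}
    (h : (y, b) ∈ S) : Measurable[dataSigma S] (datum y b) := by
  rw [measurable_iff_comap_le]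
  exact le_iSup₂_of_le (y, b) h le_rfl

theorem measurable_reveal (S : Set (List ℕ × Bool)) : Measurable[dataSigma S] (reveal S) := by
  refine @measurable_pi_lambda Env (List ℕ) (fun _ => ℕ × ℝ≥0) (dataSigma S) _ _ fun y => ?_
  have : (fun ω => reveal S ω y) = fun ω => ((reveal S ω y).1, (reveal S ω y).2) := rfl
  rw [this]
  refine @Measurable.prodMk Env (dataSigma S) _ _ _ _ _ _ ?_ ?_
  · by_cases h : (y, true) ∈ S
    · simp only [reveal, h, if_true]
      have : (fun ω : Env => (ω y).1) = fun ω => ⌊datum y true ω⌋₊ := by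
        funext ω; simp [datum]
      rw [this]
      exact Nat.measurable_floor.comp (measurable_datum_dataSigma h)
    · simp only [reveal, h, if_false]; exact measurable_const
  · by_cases h : (y, false) ∈ S
    · simp only [reveal, h, if_true]
      exact measurable_datum_dataSigma h
    · simp only [reveal, h, if_false]; exact measurable_const

theorem dataSigma_le (S : Set (List ℕ × Bool)) : dataSigma S ≤ (inferInstance : MeasurableSpace Env) :=
  iSup₂_le fun _ _ => (measurable_datum _ _).comap_le

theorem indep_dataSigma {S T : Set (List ℕ × Bool)} (hST : Disjoint S T) :
    Indep (dataSigma S) (dataSigma T) (envLaw q ρ) :=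
  indep_iSup_of_disjoint (fun _ => (measurable_datum _ _).comap_le) (iIndepFun_datum q ρ) hST

theorem measurable_dataSigma {β : Type*} [MeasurableSpace β] {S : Set (List ℕ × Bool)}
    {f : Env → β} (hf : Measurable f) (h : ∀ ω, f (reveal S ω) = f ω) :
    Measurable[dataSigma S] f := by
  have : f = f ∘ reveal S := by funext ω; exact (h ω).symm
  rw [this]
  exact hf.comp (measurable_reveal S)

/-- This is the form in which independence is used below. That a function depends only on the data
in `S` is expressed by its invariance under `reveal S`, which can be checked by rewriting. -/
theorem lintegral_mul_of_reveal {S T : Set (List ℕ × Bool)} (hST : Disjoint S T)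
    {f g : Env → ℝ≥0∞} (hf : Measurable f) (hg : Measurable g)
    (hfS : ∀ ω, f (reveal S ω) = f ω) (hgT : ∀ ω, g (reveal T ω) = g ω) :
    ∫⁻ ω, f ω * g ω ∂envLaw q ρ = (∫⁻ ω, f ω ∂envLaw q ρ) * ∫⁻ ω, g ω ∂envLaw q ρ :=
  lintegral_mul_eq_lintegral_mul_lintegral_of_independent_measurableSpace
    (dataSigma_le S) (dataSigma_le T) (indep_dataSigma q ρ hST)
    (measurable_dataSigma hf hfS) (measurable_dataSigma hg hgT)

/-- The data attached to the words that extend `x`, the mark of `x` being included if `b`. -/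
def below (x : List ℕ) : Set (List ℕ × Bool) := {p | x <:+ p.1}

theorem subEnv_reveal {S : Set (List ℕ × Bool)} {x : List ℕ} (h : below x ⊆ S) (ω : Env) :
    subEnv x (reveal S ω) = subEnv x ω := by
  funext y
  have h1 : (y ++ x, true) ∈ S := h (List.suffix_append y x)
  have h2 : (y ++ x, false) ∈ S := h (List.suffix_append y x)
  exact Prod.ext (reveal_fst h1 ω) (reveal_snd h2 ω)

theorem disjoint_below {i j : ℕ} (h : i ≠ j) : Disjoint (below [i]) (below [j]) := by
  rw [Set.disjoint_left]
  rintro ⟨p, b⟩ ⟨u, hu⟩ ⟨v, hv⟩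
  rw [← hv] at hu
  exact h (List.append_singleton_inj.1 hu).2

/-- The number of children of the root and the environments seen from its children are
independent, and the latter have the law of the environment itself. -/
theorem lintegral_prod_subEnv (k n : ℕ) {f : ℕ → Env → ℝ≥0∞} (hf : ∀ j, Measurable (f j)) :
    ∫⁻ ω, (if (ω []).1 = k then 1 else 0) * ∏ j ∈ Finset.range n, f j (subEnv [j] ω) ∂envLaw q ρ
      = q k * ∏ j ∈ Finset.range n, ∫⁻ ω, f j ω ∂envLaw q ρ := by
  induction n with
  | zero =>
    simp only [Finset.range_zero, Finset.prod_empty, mul_one]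
    have h1 : Measurable fun m : ℕ => (if m = k then 1 else 0 : ℝ≥0∞) := measurable_of_countable _
    have := lintegral_map (μ := envLaw q ρ) h1 (show Measurable fun ω : Env => (ω []).1 by fun_prop)
    rw [← this, map_numChildren, ← q.toMeasure_apply_singleton k (measurableSet_singleton _),
      ← lintegral_indicator_one (measurableSet_singleton k)]
    refine lintegral_congr fun m => ?_
    simp [Set.indicator_apply]
  | succ n ih =>
    simp only [Finset.prod_range_succ, ← mul_assoc]
    -- Peel off the last child: the offspring number of the root and the subtrees of the children
    -- before `n` use no data below `[n]`.
    rw [lintegral_mul_of_reveal q ρ (S := (below [n])ᶜ) (T := below [n])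
      (Set.disjoint_left.2 fun _ h h' => h h') (f := fun ω => (if (ω []).1 = k then 1 else 0) *
        ∏ j ∈ Finset.range n, f j (subEnv [j] ω))
      ((measurable_ite_numChildren [] k).fun_mul (Finset.measurable_fun_prod _ fun j _ =>
        (hf j).comp (measurable_subEnv _))) (g := fun ω => f n (subEnv [n] ω)) ((hf n).comp (measurable_subEnv _)) ?_ ?_, ih,
      lintegral_subEnv q ρ _ (hf n)]
    · intro ω
      congr 1
      · rw [reveal_fst]
        rintro ⟨u, hu⟩
        simp at hu
      · refine Finset.prod_congr rfl fun j hj => ?_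
        rw [subEnv_reveal]
        exact Set.subset_compl_iff_disjoint_right.2
          (disjoint_below (Finset.mem_range.1 hj).ne)
    · intro ω
      rw [subEnv_reveal le_rfl]

/-- The environment in which the mark of the root is erased. -/
noncomputable def eraseMark (ω : Env) : Env := reveal {([], false)}ᶜ ω

/-- The mark of the root is independent of the other data. -/
theorem lintegral_mark {f : ℝ≥0 → Env → ℝ≥0∞} (hf : Measurable (Function.uncurry f))
    (h : ∀ a ω, f a (eraseMark ω) = f a ω) :
    ∫⁻ ω, f (ω []).2 ω ∂envLaw q ρ = ∫⁻ a, ∫⁻ ω, f a ω ∂envLaw q ρ ∂ρ := by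
  have hr : Measurable (eraseMark) := (measurable_reveal _).mono (dataSigma_le _) le_rfl
  have hind : IndepFun (fun ω : Env => (ω []).2) eraseMark (envLaw q ρ) := by
    refine indep_of_indep_of_le_left (indep_of_indep_of_le_right (indep_dataSigma q ρ
      (S := {([], false)}) (T := {([], false)}ᶜ) (Set.disjoint_left.2 fun _ h h' => h' h)) ?_) ?_
    · exact (measurable_reveal _).comap_le
    · exact Measurable.comap_le (measurable_datum_dataSigma (y := []) (b := false) rfl)
  have hmap := (indepFun_iff_map_prod_eq_prod_map_map (measurable_mark []).aemeasurable hr.aemeasurable).1 hind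
  rw [map_mark] at hmap
  calc ∫⁻ ω, f (ω []).2 ω ∂envLaw q ρ
      = ∫⁻ ω, Function.uncurry f ((ω []).2, eraseMark ω) ∂envLaw q ρ := by
        simp only [Function.uncurry, h]
    _ = ∫⁻ p, Function.uncurry f p ∂(ρ.prod ((envLaw q ρ).map eraseMark)) := by
        rw [← hmap, lintegral_map hf ((measurable_mark []).prodMk hr)]
    _ = ∫⁻ a, ∫⁻ ω, f a ω ∂((envLaw q ρ).map eraseMark) ∂ρ :=
        lintegral_prod _ hf.aemeasurable
    _ = _ := by
        refine lintegral_congr fun a => ?_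
        rw [lintegral_map (hf.of_uncurry_left (x := a)) hr]
        simp only [h]

theorem lintegral_numChildren {f : ℕ → Env → ℝ≥0∞} (hf : ∀ k, Measurable (f k)) :
    ∫⁻ ω, f (ω []).1 ω ∂envLaw q ρ
      = ∑' k, ∫⁻ ω, (if (ω []).1 = k then 1 else 0) * f k ω ∂envLaw q ρ := by
  rw [← lintegral_tsum fun k => ((measurable_ite_numChildren [] k).fun_mul (hf k)).aemeasurable]
  refine lintegral_congr fun ω => ?_
  rw [tsum_eq_single (ω []).1]
  · simp
  · intro k hk; simp [hk.symm]

/-- Expectation of a function of the number of children times a product over the children. -/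
theorem lintegral_prod_children (g : ℕ → ℝ≥0∞) {f : ℕ → ℕ → Env → ℝ≥0∞}
    (hf : ∀ k j, Measurable (f k j)) :
    ∫⁻ ω, g (ω []).1 * ∏ j ∈ Finset.range (ω []).1, f (ω []).1 j (subEnv [j] ω) ∂envLaw q ρ
      = ∑' k, q k * (g k * ∏ j ∈ Finset.range k, ∫⁻ ω, f k j ω ∂envLaw q ρ) := by
  rw [lintegral_numChildren q ρ (f := fun k ω => g k * ∏ j ∈ Finset.range k, f k j (subEnv [j] ω))]
  · refine tsum_congr fun k => ?_
    rw [← mul_assoc, mul_comm (q k), mul_assoc, ← lintegral_prod_subEnv q ρ k k (hf k),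
      ← lintegral_const_mul]
    · refine lintegral_congr fun ω => ?_
      ring
    · exact (measurable_ite_numChildren [] k).fun_mul
        (Finset.measurable_fun_prod _ fun j _ => (hf k j).comp (measurable_subEnv _))
  · exact fun k => measurable_const.fun_mul
      (Finset.measurable_fun_prod _ fun j _ => (hf k j).comp (measurable_subEnv _))

/-- Expectation of a sum over the children. -/
theorem lintegral_sum_children (g : ℕ → ℝ≥0∞) {f : ℕ → Env → ℝ≥0∞}
    (hf : ∀ k, Measurable (f k)) :
    ∫⁻ ω, g (ω []).1 * ∑ j ∈ Finset.range (ω []).1, f (ω []).1 (subEnv [j] ω) ∂envLaw q ρ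
      = ∑' k, q k * (g k * (k * ∫⁻ ω, f k ω ∂envLaw q ρ)) := by
  rw [lintegral_numChildren q ρ (f := fun k ω => g k * ∑ j ∈ Finset.range k, f k (subEnv [j] ω))]
  · refine tsum_congr fun k => ?_
    have hone : ∀ j, ∫⁻ ω, (if (ω []).1 = k then 1 else 0) * f k (subEnv [j] ω) ∂envLaw q ρ
        = q k * ∫⁻ ω, f k ω ∂envLaw q ρ := by
      intro j
      -- A single term of the sum is a product over children with all other factors equal to one.
      have := lintegral_prod_subEnv q ρ k (j + 1)
        (f := fun l => if l = j then f k else fun _ => 1) (fun l => by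
          split_ifs; exacts [hf k, measurable_const])
      rw [Finset.prod_range_succ, Finset.prod_eq_one] at this
      · simp only [if_true, one_mul] at this
        rw [← this]
        refine lintegral_congr fun ω => ?_
        congr 1
        rw [Finset.prod_range_succ, Finset.prod_eq_one, one_mul]
        · simp
        · intro l hl; simp [(Finset.mem_range.1 hl).ne]
      · intro l hl; simp [(Finset.mem_range.1 hl).ne]
    have hmm : ∀ j, Measurable fun ω : Env =>
        (if (ω []).1 = k then 1 else 0 : ℝ≥0∞) * f k (subEnv [j] ω) := fun j =>
      (measurable_ite_numChildren [] k).fun_mul ((hf k).comp (measurable_subEnv _))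
    calc _ = ∫⁻ ω, g k * ∑ j ∈ Finset.range k,
          (if (ω []).1 = k then 1 else 0) * f k (subEnv [j] ω) ∂envLaw q ρ := by
          refine lintegral_congr fun ω => ?_
          rw [← Finset.mul_sum]; ring
      _ = _ := by
          rw [lintegral_const_mul _ (Finset.measurable_fun_sum _ fun j _ => hmm j),
            lintegral_finsetSum _ fun j _ => hmm j]
          simp only [hone, Finset.sum_const, Finset.card_range, nsmul_eq_mul]
          ring
  · exact fun k => measurable_const.fun_mul
      (Finset.measurable_fun_sum _ fun j _ => (hf k).comp (measurable_subEnv _))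

end law

end RWRE

namespace RWRE

/-! ### The Markov property of the walk -/

theorem tsum_transProb_mul (ω : Env) (x : List ℕ) (f : Vertex → ℝ≥0∞) :
    ∑' z, transProb ω (word x) z * f z =
      ((1 / total ω x : ℝ≥0) : ℝ≥0∞) * f (wordParent x) +
        ∑ i ∈ Finset.range (ω x).1,
          (((ω (i :: x)).2 / total ω x : ℝ≥0) : ℝ≥0∞) * f (word (i :: x)) := by
  have h : ∀ z, transProb ω (word x) z * f z =
      (if z = wordParent x then ((1 / total ω x : ℝ≥0) : ℝ≥0∞) * f (wordParent x) else 0) +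
      ∑ i ∈ Finset.range (ω x).1, if z = word (i :: x) then
        (((ω (i :: x)).2 / total ω x : ℝ≥0) : ℝ≥0∞) * f (word (i :: x)) else 0 := by
    intro z
    simp only [word, transProb, add_mul, Finset.sum_mul, ite_mul, zero_mul]
    congr 1
    · split_ifs with hz
      · rw [hz]
      · rfl
    · refine Finset.sum_congr rfl fun i _ => ?_
      by_cases hz : z = word (i :: x)
      · subst hz
        exact (congrArg (· * f (word (i :: x))) (if_pos rfl)).trans (if_pos rfl).symm
      · exact ((congrArg (· * f z) (if_neg hz)).trans (zero_mul _)).trans (if_neg hz).symm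
  simp only [h]
  rw [ENNReal.tsum_add, tsum_ite_eq, Summable.tsum_finsetSum (fun _ _ => ENNReal.summable)]
  simp only [tsum_ite_eq]

/-- A path that is given up to time `m`, continued by the root. -/
def extendPath (m : ℕ) (b : Finset.Iic m → Vertex) (k : ℕ) : Vertex :=
  if hk : k ≤ m then b ⟨k, Finset.mem_Iic.2 hk⟩ else root

/-- The set `F` of paths depends on the path up to time `m` only. -/
def DependsUpTo (m : ℕ) (F : Set (ℕ → Vertex)) : Prop :=
  ∀ X X' : ℕ → Vertex, (∀ k ≤ m, X k = X' k) → X ∈ F → X' ∈ F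

/-- There are countably many paths of length `m`, so events of the past are countable disjoint
unions of elementary events. This lets the Markov property be proved on elementary events and
summed, without conditional expectations. -/
theorem DependsUpTo.eq_iUnion {m : ℕ} {F : Set (ℕ → Vertex)} (hF : DependsUpTo m F) :
    F = ⋃ b : {b : Finset.Iic m → Vertex // extendPath m b ∈ F},
      startsWith (extendPath m b.1) m := by
  ext X
  simp only [Set.mem_iUnion, startsWith, Set.mem_ofPred_eq]
  constructor
  · intro hX
    refine ⟨⟨fun k => X k, hF _ _ (fun k hk => ?_) hX⟩, fun k hk => ?_⟩ <;> simp [extendPath, hk]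
  · rintro ⟨⟨b, hb⟩, h⟩
    exact hF _ _ (fun k hk => (h k hk).symm) hb

theorem disjoint_startsWith_extendPath (m : ℕ) {b b' : Finset.Iic m → Vertex} (h : b ≠ b') :
    Disjoint (startsWith (extendPath m b) m) (startsWith (extendPath m b') m) := by
  refine Set.disjoint_left.2 fun X hX hX' => h (funext fun k => ?_)
  have hk := Finset.mem_Iic.1 k.2
  have e := (hX k hk).symm.trans (hX' k hk)
  simpa [extendPath, hk] using e

theorem DependsUpTo.measurableSet {m : ℕ} {F : Set (ℕ → Vertex)} (hF : DependsUpTo m F) :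
    MeasurableSet F := by
  rw [hF.eq_iUnion]
  exact MeasurableSet.iUnion fun b => measurableSet_startsWith _ _

theorem DependsUpTo.measure_inter {m : ℕ} {F : Set (ℕ → Vertex)} (hF : DependsUpTo m F)
    (μ : Measure (ℕ → Vertex)) {H : Set (ℕ → Vertex)} (hH : MeasurableSet H) :
    μ (F ∩ H) = ∑' b : {b : Finset.Iic m → Vertex // extendPath m b ∈ F},
      μ (startsWith (extendPath m b.1) m ∩ H) := by
  conv_lhs => rw [hF.eq_iUnion, Set.iUnion_inter]
  refine measure_iUnion (fun b b' hne => ?_) fun b => (measurableSet_startsWith _ _).inter hH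
  exact (disjoint_startsWith_extendPath m fun h => hne (Subtype.ext h)).mono
    Set.inter_subset_left Set.inter_subset_left

theorem DependsUpTo.measure_eq {m : ℕ} {F : Set (ℕ → Vertex)} (hF : DependsUpTo m F)
    (μ : Measure (ℕ → Vertex)) :
    μ F = ∑' b : {b : Finset.Iic m → Vertex // extendPath m b ∈ F},
      μ (startsWith (extendPath m b.1) m) := by
  simpa using hF.measure_inter μ MeasurableSet.univ

theorem ext_of_startsWith {μ ν : Measure (ℕ → Vertex)} [IsFiniteMeasure μ]
    (h : ∀ a n, μ (startsWith a n) = ν (startsWith a n)) : μ = ν := by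
  have key : ∀ m F, DependsUpTo m F → μ F = ν F := fun m F hF => by
    rw [hF.measure_eq μ, hF.measure_eq ν]
    simp only [h]
  refine ext_of_generate_finite (measurableCylinders fun _ : ℕ => Vertex)
    generateFrom_measurableCylinders.symm isPiSystem_measurableCylinders (fun t ht => ?_)
    (key 0 _ fun _ _ _ _ => trivial)
  obtain ⟨N, S, mS, rfl⟩ : ∃ N S, MeasurableSet S ∧ t = cylinder (Finset.Iic N) S := by
    simpa [measurableCylinders_nat] using ht
  refine key N _ fun X X' hX hmem => ?_
  have : (Finset.Iic N).restrict X = (Finset.Iic N).restrict X' := by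
    funext k; exact hX k (Finset.mem_Iic.1 k.2)
  simpa [cylinder, ← this] using hmem

/-- The path from time `m` on. -/
def shiftPath (m : ℕ) (X : ℕ → Vertex) : ℕ → Vertex := fun k => X (m + k)

theorem measurable_shiftPath (m : ℕ) : Measurable (shiftPath m) :=
  measurable_pi_lambda _ fun _ => measurable_pi_apply _

/-- As functions of `E` both sides are finite measures, so it suffices to compare them on elementary
events, where both are products of transition probabilities. -/
theorem quenchedLaw_startsWith_inter_shift (ω : Env) (y : Vertex) (a : ℕ → Vertex) (m : ℕ)
    {E : Set (ℕ → Vertex)} (hE : MeasurableSet E) :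
    quenchedLaw ω y (startsWith a m ∩ shiftPath m ⁻¹' E) =
      quenchedLaw ω y (startsWith a m) * quenchedLaw ω (a m) E := by
  have key : ((quenchedLaw ω y).restrict (startsWith a m)).map (shiftPath m) =
      quenchedLaw ω y (startsWith a m) • quenchedLaw ω (a m) := by
    refine ext_of_startsWith fun b n => ?_
    rw [Measure.map_apply (measurable_shiftPath m) (measurableSet_startsWith _ _),
      Measure.restrict_apply (measurable_shiftPath m (measurableSet_startsWith _ _)),
      Measure.smul_apply, smul_eq_mul]
    by_cases hb : b 0 = a m
    -- The concatenation of the two paths; it is consistent at time `m` precisely because `b 0 = a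
    -- m`. If they disagree, both sides vanish.
    · set c : ℕ → Vertex := fun k => if k ≤ m then a k else b (k - m) with hc
      have hcm : ∀ j, c (m + j) = b j := by
        intro j
        rcases Nat.eq_zero_or_pos j with rfl | hj
        · simp [hc, hb]
        · simp [hc, show ¬ (m + j ≤ m) by omega]
      have hset : ∀ j, shiftPath m ⁻¹' startsWith b j ∩ startsWith a m = startsWith c (m + j) := by
        intro j
        ext X
        simp only [startsWith, shiftPath, Set.mem_inter_iff, Set.mem_preimage, Set.mem_ofPred_eq]
        constructor
        · rintro ⟨h1, h2⟩ k hk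
          by_cases hkm : k ≤ m
          · simp [hc, hkm, h2 k hkm]
          · have := h1 (k - m) (by omega)
            rw [show m + (k - m) = k by omega] at this
            simp [hc, hkm, this]
        · intro h
          refine ⟨fun k hk => ?_, fun k hk => ?_⟩
          · rw [h (m + k) (by omega), hcm]
          · rw [h k (by omega)]; simp [hc, hk]
      have h0 : startsWith c m = startsWith a m := by
        ext X
        simp only [startsWith, Set.mem_ofPred_eq]
        refine forall₂_congr fun k hk => ?_
        simp [hc, hk]
      rw [hset]
      induction n with
      | zero => rw [quenchedLaw_startsWith_zero, if_pos hb, mul_one, add_zero, h0]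
      | succ n ih =>
        rw [← add_assoc, quenchedLaw_startsWith_succ, ih, quenchedLaw_startsWith_succ, add_assoc,
          hcm, hcm, mul_assoc]
    · have hempty : shiftPath m ⁻¹' startsWith b n ∩ startsWith a m = ∅ := by
        refine Set.eq_empty_iff_forall_notMem.2 fun X hX => hb ?_
        have h1 := hX.1 0 (Nat.zero_le _)
        have h2 := hX.2 m le_rfl
        simp only [shiftPath, add_zero] at h1
        rw [← h1, h2]
      have hz : quenchedLaw ω (a m) (startsWith b n) = 0 := by
        refine measure_mono_null (t := startsWith b 0) (fun X hX k hk => hX k (by omega)) ?_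
        rw [quenchedLaw_startsWith_zero, if_neg hb]
      rw [hempty, hz]; simp
  have := congrArg (fun μ : Measure (ℕ → Vertex) => μ E) key
  simp only [Measure.smul_apply, smul_eq_mul] at this
  rw [Measure.map_apply (measurable_shiftPath m) hE,
    Measure.restrict_apply (measurable_shiftPath m hE)] at this
  rw [Set.inter_comm, this]

/-- The Markov property at time `m`. -/
theorem quenchedLaw_markov (ω : Env) (y x : Vertex) (m : ℕ) {F E : Set (ℕ → Vertex)}
    (hF : DependsUpTo m F) (hx : ∀ X ∈ F, X m = x) (hE : MeasurableSet E) :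
    quenchedLaw ω y (F ∩ shiftPath m ⁻¹' E) = quenchedLaw ω y F * quenchedLaw ω x E := by
  rw [hF.measure_inter _ (measurable_shiftPath m hE), hF.measure_eq, ← ENNReal.tsum_mul_right]
  refine tsum_congr fun b => ?_
  rw [quenchedLaw_startsWith_inter_shift _ _ _ _ hE, hx _ b.2]

theorem quenchedLaw_start (ω : Env) (y : Vertex) : quenchedLaw ω y {X | X 0 ≠ y} = 0 := by
  have h := quenchedLaw_startsWith_zero ω y fun _ => y
  have hs : {X : ℕ → Vertex | X 0 ≠ y} = (startsWith (fun _ => y) 0)ᶜ := by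
    ext X; simp [startsWith]
  rw [hs, prob_compl_eq_zero_iff (measurableSet_startsWith _ _), h, if_pos rfl]

theorem quenchedLaw_one (ω : Env) (y z : Vertex) :
    quenchedLaw ω y {X | X 0 = y ∧ X 1 = z} = transProb ω y z := by
  have h : {X : ℕ → Vertex | X 0 = y ∧ X 1 = z} =
      startsWith (fun k => if k = 0 then y else z) 1 := by
    ext X
    simp only [startsWith, Set.mem_ofPred_eq]
    constructor
    · rintro ⟨h0, h1⟩ k hk
      interval_cases k <;> simp [h0, h1]
    · intro h
      exact ⟨by simpa using h 0 (by omega), by simpa using h 1 le_rfl⟩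
  rw [h, quenchedLaw_startsWith_succ, quenchedLaw_startsWith_zero]
  simp

/-- The Markov property at time one. -/
theorem quenchedLaw_shift_one (ω : Env) (y : Vertex) {E : Set (ℕ → Vertex)}
    (hE : MeasurableSet E) :
    quenchedLaw ω y (shiftPath 1 ⁻¹' E) = ∑' z, transProb ω y z * quenchedLaw ω z E := by
  have h1 : quenchedLaw ω y (shiftPath 1 ⁻¹' E) =
      quenchedLaw ω y (⋃ z, {X | X 0 = y ∧ X 1 = z} ∩ shiftPath 1 ⁻¹' E) := by
    refine le_antisymm ?_ (measure_mono ?_)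
    · refine (measure_mono (t := {X | X 0 ≠ y} ∪
        ⋃ z, {X | X 0 = y ∧ X 1 = z} ∩ shiftPath 1 ⁻¹' E) fun X hX => ?_).trans
        ((measure_union_le _ _).trans ?_)
      · by_cases h : X 0 = y
        · right
          exact Set.mem_iUnion.2 ⟨X 1, ⟨h, rfl⟩, hX⟩
        · left; exact h
      · rw [quenchedLaw_start, zero_add]
    · exact Set.iUnion_subset fun z => Set.inter_subset_right
  have hd : ∀ z, DependsUpTo 1 {X : ℕ → Vertex | X 0 = y ∧ X 1 = z} := by
    rintro z X X' h ⟨h0, h1⟩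
    exact ⟨by rw [← h 0 (by omega), h0], by rw [← h 1 le_rfl, h1]⟩
  rw [h1, measure_iUnion]
  · refine tsum_congr fun z => ?_
    rw [quenchedLaw_markov ω y z 1 (hd z) (fun X hX => hX.2) hE, quenchedLaw_one]
  · intro z z' hne
    refine Set.disjoint_left.2 fun X hX hX' => hne ?_
    exact hX.1.2.symm.trans hX'.1.2
  · exact fun z => (hd z).measurableSet.inter (measurable_shiftPath 1 hE)

theorem quenchedLaw_le_step (ω : Env) (y : Vertex) {E E' : Set (ℕ → Vertex)}
    (hE' : MeasurableSet E') (h : ∀ X ∈ E, X 0 = y → shiftPath 1 X ∈ E') :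
    quenchedLaw ω y E ≤ ∑' z, transProb ω y z * quenchedLaw ω z E' := by
  rw [← quenchedLaw_shift_one ω y hE']
  refine (measure_mono (t := {X | X 0 ≠ y} ∪ shiftPath 1 ⁻¹' E') fun X hX => ?_).trans
    ((measure_union_le _ _).trans (by rw [quenchedLaw_start, zero_add]))
  by_cases h0 : X 0 = y
  · right; exact h X hX h0
  · left; exact h0

theorem step_le_quenchedLaw (ω : Env) (y : Vertex) {E E' : Set (ℕ → Vertex)}
    (hE' : MeasurableSet E') (h : ∀ X, X 0 = y → shiftPath 1 X ∈ E' → X ∈ E) :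
    ∑' z, transProb ω y z * quenchedLaw ω z E' ≤ quenchedLaw ω y E := by
  rw [← quenchedLaw_shift_one ω y hE']
  refine (measure_mono (t := {X | X 0 ≠ y} ∪ E) fun X hX => ?_).trans
    ((measure_union_le _ _).trans (by rw [quenchedLaw_start, zero_add]))
  by_cases h0 : X 0 = y
  · right; exact h X h0 hX
  · left; exact h0

theorem measurableSet_path (k : ℕ) (p : Vertex → Prop) :
    MeasurableSet {X : ℕ → Vertex | p (X k)} :=
  measurable_pi_apply (X := fun _ : ℕ => Vertex) k (MeasurableSet.of_discrete (s := {v | p v}))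

/-- A function that is superharmonic where it is less than one, and at least one on the target,
bounds the hitting probability. -/
theorem quenchedLaw_hit_le (ω : Env) (p : Vertex → Prop) (u : Vertex → ℝ≥0∞)
    (h1 : ∀ y, p y → 1 ≤ u y)
    (h2 : ∀ y, 1 ≤ u y ∨ ∑' z, transProb ω y z * u z ≤ u y) (y : Vertex) :
    quenchedLaw ω y {X | ∃ k, p (X k)} ≤ u y := by
  -- With a finite horizon the claim is an induction with one step of the walk. Superharmonicity is
  -- needed only where `u < 1`, since elsewhere the bound is trivial.
  have hfin : ∀ N y, quenchedLaw ω y {X | ∃ k ≤ N, p (X k)} ≤ u y := by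
    intro N
    induction N with
    | zero =>
      intro y
      by_cases hy : p y
      · exact prob_le_one.trans (h1 y hy)
      · refine le_of_eq_of_le (measure_mono_null ?_ (quenchedLaw_start ω y)) zero_le
        rintro X ⟨k, hk, hX⟩ h0
        obtain rfl : k = 0 := by omega
        exact hy (h0 ▸ hX)
    | succ N ih =>
      intro y
      rcases h2 y with h | h
      · exact prob_le_one.trans h
      · by_cases hy : p y
        · exact prob_le_one.trans (h1 y hy)
        · refine (quenchedLaw_le_step ω y (E' := {X | ∃ k ≤ N, p (X k)}) ?_ ?_).trans
            ((ENNReal.tsum_le_tsum fun z => mul_le_mul_right (ih z) _).trans h)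
          · have : {X : ℕ → Vertex | ∃ k ≤ N, p (X k)} = ⋃ k, ⋃ (_ : k ≤ N), {X | p (X k)} := by
              ext X; simp
            rw [this]
            exact MeasurableSet.iUnion fun k => MeasurableSet.iUnion fun _ => measurableSet_path k p
          · rintro X ⟨k, hk, hX⟩ h0
            rcases k with _ | k
            · exact absurd (h0 ▸ hX) hy
            · exact ⟨k, by omega, by simpa [shiftPath, add_comm] using hX⟩
  have hU : {X : ℕ → Vertex | ∃ k, p (X k)} = ⋃ N, {X | ∃ k ≤ N, p (X k)} := by
    ext X
    simp only [Set.mem_ofPred_eq, Set.mem_iUnion]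
    exact ⟨fun ⟨k, hk⟩ => ⟨k, k, le_rfl, hk⟩, fun ⟨_, k, _, hk⟩ => ⟨k, hk⟩⟩
  rw [hU, Monotone.measure_iUnion]
  · exact iSup_le fun N => hfin N y
  · rintro N M hNM X ⟨k, hk, hX⟩
    exact ⟨k, hk.trans hNM, hX⟩

/-- Almost surely all steps of the walk have positive probability. -/
theorem quenchedLaw_ae_transProb_ne_zero (ω : Env) (y : Vertex) :
    ∀ᵐ X ∂quenchedLaw ω y, ∀ n, transProb ω (X n) (X (n + 1)) ≠ 0 := by
  rw [ae_all_iff]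
  intro n
  rw [ae_iff]
  have hd : DependsUpTo (n + 1) {X : ℕ → Vertex | ¬ transProb ω (X n) (X (n + 1)) ≠ 0} := by
    intro X X' h hX
    simpa [← h n (by omega), ← h (n + 1) le_rfl] using hX
  rw [hd.measure_eq, ENNReal.tsum_eq_zero]
  rintro ⟨b, hb⟩
  rw [quenchedLaw_startsWith_succ, not_not.1 hb, mul_zero]

theorem transProb_word_ne_zero {ω : Env} {x : List ℕ} {z : Vertex}
    (h : transProb ω (word x) z ≠ 0) :
    z = wordParent x ∨ ∃ i < (ω x).1, z = word (i :: x) := by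
  by_contra hcon
  push Not at hcon
  refine h ?_
  simp only [word, transProb]
  rw [if_neg hcon.1, zero_add]
  refine Finset.sum_eq_zero fun i hi => if_neg ?_
  exact hcon.2 i (Finset.mem_range.1 hi)

end RWRE

namespace RWRE

/-! ### Escape probabilities -/

/-- The probability that the walk started at the root reaches generation `n` before the parent of
the root. -/
noncomputable def escN : ℕ → Env → ℝ≥0
  | 0, _ => 1
  | n + 1, ω => (∑ i ∈ Finset.range (ω []).1, (ω [i]).2 * escN n (subEnv [i] ω)) /
      (1 + ∑ i ∈ Finset.range (ω []).1, (ω [i]).2 * escN n (subEnv [i] ω))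

theorem escN_le_one (n : ℕ) (ω : Env) : escN n ω ≤ 1 := by
  cases n with
  | zero => exact le_rfl
  | succ n => exact div_le_one_of_le₀ (le_add_of_nonneg_left zero_le) zero_le

theorem div_one_add_mono {a b : ℝ≥0} (h : a ≤ b) : a / (1 + a) ≤ b / (1 + b) := by
  rw [div_le_div_iff₀ (by positivity) (by positivity)]
  nlinarith

theorem escN_succ_le (n : ℕ) (ω : Env) : escN (n + 1) ω ≤ escN n ω := by
  induction n generalizing ω with
  | zero => exact escN_le_one _ _
  | succ n ih =>
    rw [escN, escN]
    exact div_one_add_mono (Finset.sum_le_sum fun i _ => mul_le_mul_right (ih _) _)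

theorem escN_antitone (ω : Env) : Antitone fun n => escN n ω :=
  antitone_nat_of_succ_le fun n => escN_succ_le n ω

/-- The probability that the walk started at the root never visits the parent of the root. -/
noncomputable def esc (ω : Env) : ℝ≥0 := ⨅ n, escN n ω

theorem tendsto_escN (ω : Env) : Tendsto (fun n => escN n ω) atTop (nhds (esc ω)) :=
  tendsto_atTop_ciInf (escN_antitone ω) (OrderBot.bddBelow _)

theorem esc_le_escN (n : ℕ) (ω : Env) : esc ω ≤ escN n ω := ciInf_le (OrderBot.bddBelow _) n

theorem esc_le_one (ω : Env) : esc ω ≤ 1 := (esc_le_escN 0 ω).trans (escN_le_one 0 ω)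

/-- The effective conductance between the root and infinity, through the children of the root. -/
noncomputable def escSum (ω : Env) : ℝ≥0 :=
  ∑ i ∈ Finset.range (ω []).1, (ω [i]).2 * esc (subEnv [i] ω)

theorem esc_eq (ω : Env) : esc ω = escSum ω / (1 + escSum ω) := by
  refine tendsto_nhds_unique ((tendsto_add_atTop_iff_nat 1).2 (tendsto_escN ω)) ?_
  have h : Tendsto (fun n => ∑ i ∈ Finset.range (ω []).1, (ω [i]).2 * escN n (subEnv [i] ω))
      atTop (nhds (escSum ω)) :=
    tendsto_finsetSum _ fun i _ => (tendsto_escN _).const_mul _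
  have h' := h.div (h.const_add 1) (by positivity)
  exact h'

/-- The complement of `esc`: the probability to visit the parent of the root. -/
noncomputable def ret (ω : Env) : ℝ≥0 := 1 / (1 + escSum ω)

theorem ret_add_esc (ω : Env) : ret ω + esc ω = 1 := by
  rw [ret, esc_eq, ← add_div, div_self (by positivity)]

theorem ret_le_one (ω : Env) : ret ω ≤ 1 := by
  rw [← ret_add_esc ω]; exact le_self_add

theorem ret_mul (ω : Env) : ret ω * (1 + escSum ω) = 1 := by
  rw [ret, one_div, inv_mul_cancel₀ (by positivity)]

theorem measurable_escN (n : ℕ) : Measurable (escN n) := by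
  induction n with
  | zero => exact measurable_const
  | succ n ih =>
    refine measurable_of_numChildren [] (fun m ω =>
      (∑ i ∈ Finset.range m, (ω [i]).2 * escN n (subEnv [i] ω)) /
      (1 + ∑ i ∈ Finset.range m, (ω [i]).2 * escN n (subEnv [i] ω))) fun m => ?_
    have h : Measurable fun ω : Env =>
        ∑ i ∈ Finset.range m, (ω [i]).2 * escN n (subEnv [i] ω) :=
      Finset.measurable_fun_sum _ fun i _ =>
        (measurable_mark [i]).fun_mul (ih.comp (measurable_subEnv _))
    exact h.fun_div (h.const_add 1)

theorem measurable_esc : Measurable esc := Measurable.iInf measurable_escN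

theorem measurable_escSum : Measurable escSum := by
  refine measurable_of_numChildren [] (fun m ω =>
      ∑ i ∈ Finset.range m, (ω [i]).2 * esc (subEnv [i] ω)) fun m => ?_
  exact Finset.measurable_fun_sum _ fun i _ =>
        (measurable_mark [i]).fun_mul (measurable_esc.comp (measurable_subEnv _))

theorem measurable_ret : Measurable ret :=
  measurable_const.fun_div (measurable_escSum.const_add 1)

/-- The environments `ω` and `ω'` agree except possibly for the mark of the root. -/
def AgreeButMark (ω ω' : Env) : Prop :=
  (ω []).1 = (ω' []).1 ∧ ∀ y, y ≠ [] → ω y = ω' y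

theorem AgreeButMark.subEnv_eq {ω ω' : Env} (h : AgreeButMark ω ω') (i : ℕ) :
    subEnv [i] ω = subEnv [i] ω' := by
  funext y; exact h.2 _ (by simp)

theorem AgreeButMark.escN_eq {ω ω' : Env} (h : AgreeButMark ω ω') (n : ℕ) :
    escN n ω = escN n ω' := by
  cases n with
  | zero => rfl
  | succ n => simp only [escN, h.1, h.subEnv_eq, h.2 [_] (by simp)]

/-- The mark of a vertex enters only the transitions out of its parent, which play no role before
the walk leaves the subtree. -/
theorem AgreeButMark.esc_eq {ω ω' : Env} (h : AgreeButMark ω ω') : esc ω = esc ω' := by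
  simp only [esc, h.escN_eq]

/-- All the data of the environment seen from `x`, except for the mark of `x`. -/
def strictBelow (x : List ℕ) : Set (List ℕ × Bool) := below x \ {(x, false)}

theorem agreeButMark_reveal {S : Set (List ℕ × Bool)} {x : List ℕ} (h : strictBelow x ⊆ S)
    (ω : Env) : AgreeButMark (subEnv x (reveal S ω)) (subEnv x ω) := by
  refine ⟨reveal_fst (h ⟨List.suffix_append [] x, by simp⟩) ω, fun y hy => ?_⟩
  have hy' : y ++ x ≠ x := by simpa using hy
  exact Prod.ext (reveal_fst (h ⟨List.suffix_append y x, by simp⟩) ω)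
    (reveal_snd (h ⟨List.suffix_append y x, by simpa using hy⟩) ω)

theorem agreeButMark_eraseMark (ω : Env) : AgreeButMark (eraseMark ω) ω := by
  have := agreeButMark_reveal (S := {([], false)}ᶜ) (x := []) (fun p hp => hp.2) ω
  rwa [subEnv_nil, subEnv_nil] at this

/-! ### The probability to return from a deep level -/

/-- The product of the return probabilities along the ancestors of `y` of generation at least
`ℓ`, including `y`. -/
noncomputable def retProd (ω : Env) (ℓ : ℕ) : List ℕ → ℝ≥0
  | [] => if ℓ = 0 then ret ω else 1
  | i :: y => if ℓ ≤ y.length + 1 then ret (subEnv (i :: y) ω) * retProd ω ℓ y else 1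

theorem retProd_of_lt {ω : Env} {ℓ : ℕ} {y : List ℕ} (h : y.length < ℓ) : retProd ω ℓ y = 1 := by
  cases y with
  | nil => simp only [List.length_nil] at h; simp [retProd, h.ne']
  | cons i y => simp only [List.length_cons] at h; simp [retProd, not_le.2 h]

/-- `retProd`, extended to all vertices. -/
noncomputable def retFun (ω : Env) (ℓ : ℕ) : Vertex → ℝ≥0
  | none => 1
  | some y => retProd ω ℓ y

theorem retFun_wordParent {ω : Env} {ℓ : ℕ} {y : List ℕ} (h : ℓ ≤ y.length) :
    retProd ω ℓ y = ret (subEnv y ω) * retFun ω ℓ (wordParent y) := by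
  cases y with
  | nil =>
    simp only [List.length_nil, nonpos_iff_eq_zero] at h
    simp [retProd, h, wordParent, retFun, rootParent]
  | cons i y =>
    simp only [List.length_cons] at h
    simp [retProd, h, wordParent, retFun, word]

/-- In generations at least `ℓ` the function is even harmonic. After division by its value at `y`,
this reads `total ω y` = (1 + S(y)) + ∑ A·ret over the children, which follows from `ret * (1 +
escSum) = 1` at `y` and `ret + esc = 1` at each child. -/
theorem retFun_superharmonic (ω : Env) (ℓ : ℕ) (y : Vertex) :
    1 ≤ (retFun ω ℓ y : ℝ≥0∞) ∨ ∑' z, transProb ω y z * (retFun ω ℓ z : ℝ≥0∞) ≤ retFun ω ℓ y := by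
  rcases y with _ | y
  · left; simp [retFun]
  by_cases h : y.length < ℓ
  · left; simp [retFun, retProd_of_lt h]
  right
  rw [not_lt] at h
  refine le_of_eq ((tsum_transProb_mul ω y fun z => (retFun ω ℓ z : ℝ≥0∞)).trans ?_)
  have hc : ∀ i, retFun ω ℓ (word (i :: y)) = ret (subEnv (i :: y) ω) * retProd ω ℓ y := by
    intro i
    simp [retFun, word, retProd, show ℓ ≤ y.length + 1 by omega]
  have hy : retFun ω ℓ (some y) = retProd ω ℓ y := rfl
  rw [hy]
  simp only [hc]
  norm_cast
  set v := retFun ω ℓ (wordParent y)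
  have hv : v = retProd ω ℓ y * (1 + escSum (subEnv y ω)) := by
    rw [retFun_wordParent h, mul_right_comm, ret_mul, one_mul]
  set r := retProd ω ℓ y
  have hS : escSum (subEnv y ω) = ∑ i ∈ Finset.range (ω y).1,
      (ω (i :: y)).2 * esc (subEnv (i :: y) ω) := by
    simp only [escSum, subEnv_singleton]; rfl
  have hT := total_pos ω y
  have : total ω y = (1 + escSum (subEnv y ω)) +
      ∑ i ∈ Finset.range (ω y).1, (ω (i :: y)).2 * ret (subEnv (i :: y) ω) := by
    rw [hS, add_assoc, ← Finset.sum_add_distrib, total]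
    congr 1
    refine Finset.sum_congr rfl fun i _ => ?_
    rw [← mul_add, add_comm (esc _), ret_add_esc, mul_one]
  have h2 : 1 / total ω y * v + ∑ i ∈ Finset.range (ω y).1,
      (ω (i :: y)).2 / total ω y * (ret (subEnv (i :: y) ω) * r) =
      r * (((1 + escSum (subEnv y ω)) +
        ∑ i ∈ Finset.range (ω y).1, (ω (i :: y)).2 * ret (subEnv (i :: y) ω)) / total ω y) := by
    rw [hv, add_div, mul_add r (_ / _), Finset.sum_div, Finset.mul_sum]
    congr 1
    · ring
    · refine Finset.sum_congr rfl fun i _ => ?_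
      ring
  rw [h2, ← this, div_self hT.ne', mul_one]

theorem quenchedLaw_gen_lt_le (ω : Env) (ℓ : ℕ) (y : Vertex) :
    quenchedLaw ω y {X | ∃ k, gen (X k) < ℓ} ≤ retFun ω ℓ y := by
  refine quenchedLaw_hit_le ω (fun v => gen v < ℓ) (fun v => (retFun ω ℓ v : ℝ≥0∞)) ?_
    (retFun_superharmonic ω ℓ) y
  intro y hy
  rcases y with _ | y
  · simp [retFun]
  · have : y.length < ℓ := by simpa [gen] using hy
    simp [retFun, retProd_of_lt this]

theorem quenchedLaw_gen_lt_length_le (ω : Env) (x : List ℕ) :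
    quenchedLaw ω (word x) {X | ∃ k, gen (X k) < x.length} ≤ ret (subEnv x ω) := by
  refine (quenchedLaw_gen_lt_le ω x.length (word x)).trans ?_
  have h : retFun ω x.length (word x) = retProd ω x.length x := rfl
  rw [h, retFun_wordParent le_rfl]
  have h1 : retFun ω x.length (wordParent x) = 1 := by
    cases x with
    | nil => rfl
    | cons i x => exact retProd_of_lt (by simp)
  rw [h1, mul_one]

theorem esc_le_quenchedLaw (ω : Env) (x : List ℕ) :
    (esc (subEnv x ω) : ℝ≥0∞) ≤
      quenchedLaw ω (word x) {X | ∀ k, (x.length : ℤ) ≤ gen (X k)} := by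
  have hset : {X : ℕ → Vertex | ∀ k, (x.length : ℤ) ≤ gen (X k)} =
      {X | ∃ k, gen (X k) < x.length}ᶜ := by
    ext X; simp
  have hm : MeasurableSet {X : ℕ → Vertex | ∃ k, gen (X k) < x.length} := by
    rw [Set.ofPred_exists]
    exact MeasurableSet.iUnion fun k => measurableSet_path k fun v => gen v < x.length
  rw [hset, prob_compl_eq_one_sub hm]
  refine (ENNReal.le_sub_of_add_le_left (ne_top_of_le_ne_top ENNReal.coe_ne_top
    (quenchedLaw_gen_lt_length_le ω x)) ?_)
  refine (add_le_add_left (quenchedLaw_gen_lt_length_le ω x) _).trans ?_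
  norm_cast
  rw [ret_add_esc]

/-- The word `x` is a vertex of the Galton-Watson tree. -/
def IsVertex (ω : Env) : List ℕ → Prop
  | [] => True
  | i :: y => IsVertex ω y ∧ i < (ω y).1

/-- The product of the return probabilities along `w`. -/
noncomputable def retBelow (ω : Env) : List ℕ → ℝ≥0
  | [] => ret ω
  | i :: w => ret (subEnv (i :: w) ω) * retBelow ω w

theorem retProd_append (ω : Env) (x w : List ℕ) :
    retProd ω x.length (w ++ x) = retBelow (subEnv x ω) w := by
  induction w with
  | nil =>
    rw [List.nil_append, retFun_wordParent le_rfl, retBelow]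
    have h1 : retFun ω x.length (wordParent x) = 1 := by
      cases x with
      | nil => rfl
      | cons i x => exact retProd_of_lt (by simp)
    rw [h1, mul_one]
  | cons i w ih =>
    rw [List.cons_append, retProd, if_pos (by simp; omega), ih, retBelow, subEnv_subEnv]
    rfl

/-- The walk reaches generation `ℓ + M` while staying in generations `≥ ℓ`, and then visits
generations `< ℓ`. -/
def deepReturn (ℓ M : ℕ) : Set (ℕ → Vertex) :=
  {X | ∃ m t, m ≤ t ∧ (∀ j ≤ m, (ℓ : ℤ) ≤ gen (X j)) ∧ gen (X m) = ℓ + M ∧ gen (X t) < ℓ}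

/-- Stop the walk when it first reaches depth `M` below `x`. It has not left the subtree of `x` by
then, so it sits at some `w ++ x` with `w` of length `M`, and from there the probability to fall
below `x` is at most the product of the return probabilities along `w`. The horizon in `A N` turns
this into an induction over single steps. -/
theorem quenchedLaw_deepReturn_le (ω : Env) (x : List ℕ) (M : ℕ) (R : ℝ≥0∞)
    (hR : ∀ w, w.length = M → IsVertex (subEnv x ω) w → (retBelow (subEnv x ω) w : ℝ≥0∞) ≤ R) :
    quenchedLaw ω (word x) (deepReturn x.length M) ≤ R := by
  set ℓ := x.length with hℓ
  let A : ℕ → Set (ℕ → Vertex) := fun N =>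
    {X | ∃ m t, t ≤ N ∧ m ≤ t ∧ (∀ j ≤ m, (ℓ : ℤ) ≤ gen (X j)) ∧ gen (X m) = ℓ + M ∧
      gen (X t) < ℓ}
  have hdep : ∀ N, DependsUpTo N (A N) := by
    rintro N X X' h ⟨m, t, htN, hmt, h1, h2, h3⟩
    refine ⟨m, t, htN, hmt, fun j hj => ?_, ?_, ?_⟩
    · rw [← h j (by omega)]; exact h1 j hj
    · rw [← h m (by omega)]; exact h2
    · rw [← h t htN]; exact h3
  have key : ∀ N w, w.length ≤ M → IsVertex (subEnv x ω) w →
      quenchedLaw ω (word (w ++ x)) (A N) ≤ R := by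
    intro N
    induction N with
    | zero =>
      intro w hw hv
      refine le_of_eq_of_le (measure_mono_null (t := ∅) ?_ measure_empty) zero_le
      rintro X ⟨m, t, ht, hmt, h1, h2, h3⟩
      obtain rfl : t = 0 := by omega
      exact absurd (h1 0 (by omega)) (not_le.2 h3)
    | succ N ih =>
      intro w hw hv
      rcases hw.eq_or_lt with hw | hw
      · refine (measure_mono ?_).trans ((quenchedLaw_gen_lt_le ω ℓ (word (w ++ x))).trans ?_)
        · rintro X ⟨m, t, -, -, -, -, h3⟩
          exact ⟨t, h3⟩
        · have : retFun ω ℓ (word (w ++ x)) = retProd ω x.length (w ++ x) := rfl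
          rw [this, retProd_append]
          exact hR w hw hv
      · refine (quenchedLaw_le_step ω _ (E' := A N) (hdep N).measurableSet ?_).trans ?_
        · rintro X ⟨m, t, ht, hmt, h1, h2, h3⟩ h0
          rcases m with _ | m
          · rw [h0] at h2
            simp only [gen, word, List.length_append] at h2
            omega
          · rcases t with _ | t
            · omega
            · refine ⟨m, t, by omega, by omega, fun j hj => ?_, ?_, ?_⟩
              · simpa [shiftPath, add_comm] using h1 (j + 1) (by omega)
              · simpa [shiftPath, add_comm] using h2
              · simpa [shiftPath, add_comm] using h3
        · have hb : ∀ z, transProb ω (word (w ++ x)) z * quenchedLaw ω z (A N) ≤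
              transProb ω (word (w ++ x)) z * R := by
            intro z
            by_cases hz : transProb ω (word (w ++ x)) z = 0
            · rw [hz, zero_mul, zero_mul]
            refine mul_le_mul_right ?_ _
            rcases transProb_word_ne_zero hz with rfl | ⟨i, hi, rfl⟩
            -- For `w = []` the step leads out of the subtree of `x`, to generation `ℓ - 1`, where
            -- the event fails at once.
            · cases w with
              | nil =>
                refine le_of_eq_of_le (measure_mono_null ?_ (quenchedLaw_start ω _)) zero_le
                rintro X ⟨m, t, -, -, h1, -, -⟩ h0
                have := h1 0 (by omega)
                rw [h0, hℓ] at this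
                cases x with
                | nil => simp [wordParent, rootParent, gen] at this
                | cons i x =>
                  simp [wordParent, word, gen] at this
              | cons i w => exact ih w (by simp at hw; omega) hv.1
            · exact ih (i :: w) (by simpa using hw) ⟨hv, hi⟩
          refine (ENNReal.tsum_le_tsum hb).trans ?_
          rw [ENNReal.tsum_mul_right, tsum_transProb, one_mul]
  have hU : deepReturn ℓ M = ⋃ N, A N := by
    ext X
    simp only [deepReturn, A, Set.mem_ofPred_eq, Set.mem_iUnion]
    exact ⟨fun ⟨m, t, h⟩ => ⟨t, m, t, le_rfl, h⟩, fun ⟨_, m, t, _, h⟩ => ⟨m, t, h⟩⟩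
  rw [hU, Monotone.measure_iUnion]
  · exact iSup_le fun N => key N [] (by simp) trivial
  · rintro N N' h X ⟨m, t, ht, h'⟩
    exact ⟨m, t, ht.trans h, h'⟩

theorem measurableSet_deepReturn (ℓ M : ℕ) : MeasurableSet (deepReturn ℓ M) := by
  have : deepReturn ℓ M = ⋃ m, ⋃ t, {X | m ≤ t ∧ (∀ j ≤ m, (ℓ : ℤ) ≤ gen (X j)) ∧
      gen (X m) = ℓ + M ∧ gen (X t) < ℓ} := by
    ext X; simp [deepReturn]
  rw [this]
  refine MeasurableSet.iUnion fun m => MeasurableSet.iUnion fun t => ?_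
  refine DependsUpTo.measurableSet (m := max m t) ?_
  rintro X X' h ⟨h0, h1, h2, h3⟩
  refine ⟨h0, fun j hj => ?_, ?_, ?_⟩
  · rw [← h j (hj.trans (le_max_left _ _))]; exact h1 j hj
  · rw [← h m (le_max_left _ _)]; exact h2
  · rw [← h t (le_max_right _ _)]; exact h3

end RWRE

namespace RWRE

/-! ### Transience: the growth of the truncated weights of paths -/

section growth

variable {ρ : Measure ℝ≥0} [IsProbabilityMeasure ρ]

theorem measurable_log_coe : Measurable fun a : ℝ≥0 => Real.log a :=
  Real.measurable_log.comp measurable_coe_nnreal_real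

theorem integrable_comp_log {i s : ℝ≥0} (hi : 0 < i) (hρ : ∀ᵐ a ∂ρ, i ≤ a ∧ a ≤ s)
    {φ : ℝ → ℝ} (hφ : Continuous φ) : Integrable (fun a : ℝ≥0 => φ (Real.log a)) ρ := by
  obtain ⟨C, hC⟩ := (isCompact_Icc (a := Real.log i) (b := Real.log s)).exists_bound_of_continuousOn
    hφ.continuousOn
  refine Integrable.of_bound (hφ.measurable.comp measurable_log_coe).aestronglyMeasurable C ?_
  filter_upwards [hρ] with a ha
  have hi' : (0 : ℝ) < i := hi
  have h1 : (i : ℝ) ≤ a := ha.1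
  have h2 : (a : ℝ) ≤ s := ha.2
  exact hC _ ⟨Real.log_le_log hi' h1, Real.log_le_log (hi'.trans_le h1) h2⟩

/-- The minimizer of `t ↦ 𝐄[A^t]` over `[0, 1]` and the sign of the derivative there. -/
theorem exists_min_moment {i s : ℝ≥0} (hi : 0 < i) (hρ : ∀ᵐ a ∂ρ, i ≤ a ∧ a ≤ s) :
    ∃ t ∈ Set.Icc (0 : ℝ) 1,
      0 ≤ (1 - t) * ∫ a : ℝ≥0, Real.log a * Real.exp (t * Real.log a) ∂ρ ∧
      t * ∫ a : ℝ≥0, Real.log a * Real.exp (t * Real.log a) ∂ρ ≤ 0 := by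
  set X : ℝ≥0 → ℝ := fun a => Real.log a with hX
  have hint : integrableExpSet X ρ = Set.univ := by
    refine Set.eq_univ_of_forall fun t => ?_
    exact integrable_comp_log hi hρ (φ := fun x => Real.exp (t * x)) (by fun_prop)
  have hd : ∀ t, HasDerivAt (mgf X ρ) (∫ a, X a * Real.exp (t * X a) ∂ρ) t := fun t =>
    hasDerivAt_mgf (by simp [hint])
  have hcont : Continuous (mgf X ρ) :=
    continuous_iff_continuousAt.2 fun t => (hd t).continuousAt
  obtain ⟨t, ht, hmin⟩ := (isCompact_Icc (a := (0 : ℝ)) (b := 1)).exists_isMinOn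
    (Set.nonempty_Icc.2 zero_le_one) hcont.continuousOn
  -- First-order condition at a minimum over an interval: the derivative is nonnegative in every
  -- direction `b - t` pointing into it. The two claims are the cases `b = 1` and `b = 0`, so
  -- endpoint minima need no separate treatment.
  have key : ∀ b ∈ Set.Icc (0 : ℝ) 1, 0 ≤ (b - t) * ∫ a, X a * Real.exp (t * X a) ∂ρ := by
    intro b hb
    have h := hmin.localize.hasFDerivWithinAt_nonneg (hd t).hasFDerivAt.hasFDerivWithinAt
      (y := b - t) (sub_mem_posTangentConeAt_of_segment_subset
        ((convex_Icc (0 : ℝ) 1).segment_subset ht hb))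
    simpa using h
  refine ⟨t, ht, key 1 (by simp), ?_⟩
  have := key 0 (by simp)
  simp only [zero_sub, neg_mul] at this
  linarith

/-- `m^j 𝐄[min (1, c A₁ ⋯ A_j)]`. -/
noncomputable def growth (ρ : Measure ℝ≥0) (m : ℝ≥0∞) : ℕ → ℝ≥0 → ℝ≥0∞
  | 0, c => ((min 1 c : ℝ≥0) : ℝ≥0∞)
  | j + 1, c => m * ∫⁻ a, growth ρ m j (c * a) ∂ρ

theorem growth_le (m : ℝ≥0∞) (j : ℕ) (c : ℝ≥0) : growth ρ m j c ≤ m ^ j := by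
  induction j generalizing c with
  | zero => simp [growth]
  | succ j ih =>
    rw [growth, pow_succ, mul_comm (m ^ j)]
    refine mul_le_mul_right ?_ _
    refine (lintegral_mono fun a => ih _).trans ?_
    simp

theorem measurable_growth (m : ℝ≥0∞) (j : ℕ) : Measurable (growth ρ m j) := by
  induction j with
  | zero => exact (measurable_const.min measurable_id).coe_nnreal_ennreal
  | succ j ih =>
    have h : Measurable (Function.uncurry fun c a : ℝ≥0 => growth ρ m j (c * a)) :=
      ih.comp (measurable_fst.mul measurable_snd)
    exact h.lintegral_prod_right'.const_mul m

/-- The tangent to exp(-·) at `v` lies below the graph. Integrated with `v` equal to the mean of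
`u`, this is Jensen's inequality. -/
theorem exp_tangent (u v : ℝ) : Real.exp (-v) * (1 + v - u) ≤ Real.exp (-u) := by
  have h := Real.add_one_le_exp (v - u)
  have : Real.exp (-u) = Real.exp (-v) * Real.exp (v - u) := by rw [← Real.exp_add]; congr 1; ring
  rw [this]
  exact mul_le_mul_of_nonneg_left (by linarith) (Real.exp_pos _).le

/-- A Gaussian lower bound for `growth`, obtained by tilting and Jensen's inequality. -/
theorem le_growth {i s : ℝ≥0} (hi : 0 < i) (hρ : ∀ᵐ a ∂ρ, i ≤ a ∧ a ≤ s) {m : ℝ≥0}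
    {t μ σ f : ℝ} (ht : t ∈ Set.Icc (0 : ℝ) 1)
    (hf : ∫ a : ℝ≥0, Real.exp (t * Real.log a) ∂ρ = f)
    (hμ : ∫ a : ℝ≥0, Real.log a * Real.exp (t * Real.log a) ∂ρ = μ * f)
    (hσ : ∫ a : ℝ≥0, Real.log a ^ 2 * Real.exp (t * Real.log a) ∂ρ = (σ + μ ^ 2) * f)
    (hf0 : 0 < f) (h1 : 0 ≤ (1 - t) * μ) (h2 : t * μ ≤ 0) {α : ℝ} (hα : 0 < α) (h : ℕ)
    (j : ℕ) {c : ℝ≥0} (hc : 0 < c) :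
    ENNReal.ofReal ((m * f) ^ j * Real.exp (t * Real.log c -
      (α * ((Real.log c + j * μ - h * μ) ^ 2 + j * σ) + 1 / (4 * α)))) ≤ growth ρ m j c := by
  induction j generalizing c with
  | zero =>
    have hc' : (0 : ℝ) < c := hc
    rw [growth, ENNReal.ofReal, ENNReal.coe_le_coe, ← NNReal.coe_le_coe,
      Real.coe_toNNReal _ (by positivity)]
    simp only [pow_zero, one_mul, Nat.cast_zero, zero_mul, add_zero]
    set x := Real.log c with hx
    have hxc : (c : ℝ) = Real.exp x := (Real.exp_log hc').symm
    have hsq : ∀ y : ℝ, y ≤ α * (x - h * μ) ^ 2 + 1 / (4 * α) ↔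
        4 * α * y ≤ (2 * α * (x - h * μ)) ^ 2 + 1 := by
      intro y
      rw [← mul_le_mul_iff_right₀ (show (0 : ℝ) < 4 * α by positivity)]
      have : 4 * α * (α * (x - h * μ) ^ 2 + 1 / (4 * α)) = (2 * α * (x - h * μ)) ^ 2 + 1 := by
        field_simp; ring
      rw [this]
    have hh : (0 : ℝ) ≤ h := Nat.cast_nonneg h
    -- The arithmetic-geometric mean inequality; it is the reason for the constant `1 / (4 * α)`.
    -- The value `h * μ` is where `h` steps of the tilted random walk started at 0 typically end.
    have habs : |x - h * μ| ≤ α * (x - h * μ) ^ 2 + 1 / (4 * α) := by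
      rw [hsq]
      have e := sq_nonneg (2 * α * |x - h * μ| - 1)
      have e' : (2 * α * |x - h * μ|) ^ 2 = (2 * α * (x - h * μ)) ^ 2 := by
        rw [mul_pow, sq_abs, ← mul_pow]
      linarith
    have ha1 := le_abs_self (x - h * μ)
    have ha2 := neg_abs_le (x - h * μ)
    have ha0 := abs_nonneg (x - h * μ)
    -- The signs of `t * μ` and `(1 - t) * μ` at the minimizer let `x` be recentred at `h * μ`; this
    -- inequality handles the bound by 1 and the next one the bound by `c`.
    have e1 : t * x ≤ |x - h * μ| := by
      have : t * x = t * (x - h * μ) + h * (t * μ) := by ring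
      nlinarith [ht.1, ht.2, mul_nonneg hh (neg_nonneg.2 h2)]
    have e2 : -((1 - t) * x) ≤ |x - h * μ| := by
      have : -((1 - t) * x) = -((1 - t) * (x - h * μ)) - h * ((1 - t) * μ) := by ring
      nlinarith [ht.1, ht.2, mul_nonneg hh h1]
    have hmin : ((min 1 c : ℝ≥0) : ℝ) = min 1 (Real.exp x) := by rw [← hxc]; simp
    rw [hmin]
    refine le_min ?_ ?_
    · exact Real.exp_le_one_iff.2 (by linarith)
    · exact Real.exp_le_exp.2 (by nlinarith)
  | succ j ih =>
    have hc' : (0 : ℝ) < c := hc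
    set x := Real.log c with hx
    set v : ℝ → ℝ := fun y => α * ((y + j * μ - h * μ) ^ 2 + j * σ) + 1 / (4 * α) with hv
    -- `Q` is the mean of `v (x + log A)` under the law tilted by A^t, with mean `μ` and variance
    -- `σ` for log A: the linear term shifts the centre by `μ` and the quadratic one adds `α * σ`.
    -- This is `hI`, and it makes the tangent at `Q` integrate to exp(-Q).
    set Q : ℝ := α * ((x + (j + 1 : ℕ) * μ - h * μ) ^ 2 + (j + 1 : ℕ) * σ) + 1 / (4 * α) with hQ
    set lam : ℝ := m * f
    have hlam : 0 ≤ lam := mul_nonneg m.2 hf0.le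
    have hint := fun {φ : ℝ → ℝ} (hφ : Continuous φ) => integrable_comp_log hi hρ hφ
    have hi0 := hint (φ := fun y => Real.exp (t * y)) (by fun_prop)
    have hi1 := hint (φ := fun y => y * Real.exp (t * y)) (by fun_prop)
    have hi2 := hint (φ := fun y => y ^ 2 * Real.exp (t * y)) (by fun_prop)
    have hexp : ∀ y : ℝ, Real.exp (t * y) * (1 + Q - v (x + y)) =
        (1 + Q - v x) * Real.exp (t * y) - 2 * α * (x + j * μ - h * μ) * (y * Real.exp (t * y))
          - α * (y ^ 2 * Real.exp (t * y)) := by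
      intro y; simp only [hv]; ring
    have hI : ∫ a : ℝ≥0, Real.exp (t * Real.log a) * (1 + Q - v (x + Real.log a)) ∂ρ = f := by
      simp only [hexp]
      rw [integral_sub (hint (φ := fun y => (1 + Q - v x) * Real.exp (t * y) -
          2 * α * (x + j * μ - h * μ) * (y * Real.exp (t * y))) (by fun_prop)) (hi2.const_mul _),
        integral_sub (hi0.const_mul _) (hi1.const_mul _), integral_const_mul, integral_const_mul,
        integral_const_mul, hf, hμ, hσ]
      simp only [hv, hQ]
      push_cast
      ring
    have hlow : f * Real.exp (-Q) ≤
        ∫ a : ℝ≥0, Real.exp (t * Real.log a - v (x + Real.log a)) ∂ρ := by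
      rw [← hI, ← integral_mul_const]
      refine integral_mono (hint (φ := fun y => Real.exp (t * y) * (1 + Q - v (x + y)) *
          Real.exp (-Q)) (by fun_prop)) (hint (φ := fun y => Real.exp (t * y - v (x + y)))
          (by fun_prop)) fun a => ?_
      have := exp_tangent (v (x + Real.log a)) Q
      simp only
      rw [sub_eq_add_neg (t * _), Real.exp_add, mul_assoc, mul_comm _ (Real.exp (-Q))]
      exact mul_le_mul_of_nonneg_left this (Real.exp_pos _).le
    have hstep : ∀ᵐ a : ℝ≥0 ∂ρ, ENNReal.ofReal (lam ^ j * Real.exp (t * x) *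
        Real.exp (t * Real.log a - v (x + Real.log a))) ≤ growth ρ m j (c * a) := by
      filter_upwards [hρ] with a ha
      have ha0 : 0 < a := hi.trans_le ha.1
      have ha0' : (0 : ℝ) < a := ha0
      refine le_trans (le_of_eq ?_) (ih (mul_pos hc ha0))
      rw [NNReal.coe_mul, Real.log_mul hc'.ne' ha0'.ne', ← hx, mul_assoc, ← Real.exp_add]
      congr 3
      simp only [hv]
      ring
    rw [growth]
    refine le_trans ?_ (mul_le_mul_right (lintegral_mono_ae hstep) _)
    rw [← ofReal_integral_eq_lintegral_ofReal
      (hint (φ := fun y => lam ^ j * Real.exp (t * x) * Real.exp (t * y - v (x + y)))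
        (by fun_prop)) (ae_of_all _ fun a => by positivity), integral_const_mul,
      ← ENNReal.ofReal_coe_nnreal, ← ENNReal.ofReal_mul NNReal.zero_le_coe]
    refine ENNReal.ofReal_le_ofReal ?_
    calc lam ^ (j + 1) * Real.exp (t * x - Q)
        = m * (lam ^ j * Real.exp (t * x) * (f * Real.exp (-Q))) := by
          rw [sub_eq_add_neg, Real.exp_add, pow_succ]; simp only [lam]; ring
      _ ≤ _ := by
          refine mul_le_mul_of_nonneg_left ?_ m.2
          exact mul_le_mul_of_nonneg_left hlow (by positivity)

theorem momentA_eq {i s : ℝ≥0} (hi : 0 < i) (hρ : ∀ᵐ a ∂ρ, i ≤ a ∧ a ≤ s) (t : ℝ) :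
    momentA ρ t = ENNReal.ofReal (∫ a : ℝ≥0, Real.exp (t * Real.log a) ∂ρ) := by
  rw [ofReal_integral_eq_lintegral_ofReal (integrable_comp_log hi hρ
    (φ := fun y => Real.exp (t * y)) (by fun_prop)) (ae_of_all _ fun a => (Real.exp_pos _).le)]
  refine lintegral_congr_ae ?_
  filter_upwards [hρ] with a ha
  have ha0 : 0 < a := hi.trans_le ha.1
  have ha0' : (0 : ℝ) < a := ha0
  rw [← ENNReal.coe_rpow_of_ne_zero ha0.ne', ← ENNReal.ofReal_coe_nnreal, NNReal.coe_rpow,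
    Real.rpow_def_of_pos ha0', mul_comm]

/-- At the minimizer t the Gaussian bound grows at rate log(m𝐄[A^t]) > 0 per generation, while the
penalty costs α times the tilted variance per generation plus a constant. A small α and then a large
number of generations leave a positive exponent. -/
theorem exists_one_lt_growth {i s : ℝ≥0} (hi : 0 < i) (hρ : ∀ᵐ a ∂ρ, i ≤ a ∧ a ≤ s) {m : ℝ≥0}
    (hm : ∀ t ∈ Set.Icc (0 : ℝ) 1, 1 < m * momentA ρ t) : ∃ h, 1 < growth ρ m h 1 := by
  obtain ⟨t, ht, h1, h2⟩ := exists_min_moment hi hρ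
  set f := ∫ a : ℝ≥0, Real.exp (t * Real.log a) ∂ρ with hf
  have hmf : 1 < (m : ℝ) * f := by
    have := hm t ht
    rw [momentA_eq hi hρ, ← ENNReal.ofReal_coe_nnreal, ← ENNReal.ofReal_mul NNReal.zero_le_coe]
      at this
    rwa [← ENNReal.ofReal_one, ENNReal.ofReal_lt_ofReal_iff_of_nonneg zero_le_one] at this
  have hf0 : 0 < f := by
    by_contra hcon
    push Not at hcon
    have := mul_nonpos_of_nonneg_of_nonpos m.2 hcon
    have h : (m : ℝ) * f ≤ 0 := this
    linarith
  set I1 := ∫ a : ℝ≥0, Real.log a * Real.exp (t * Real.log a) ∂ρ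
  set I2 := ∫ a : ℝ≥0, Real.log a ^ 2 * Real.exp (t * Real.log a) ∂ρ
  set μ := I1 / f with hμ
  set σ := I2 / f - μ ^ 2 with hσ
  have e1 : 0 ≤ (1 - t) * μ := by
    rw [hμ, ← mul_div_assoc]; exact div_nonneg h1 hf0.le
  have e2 : t * μ ≤ 0 := by
    rw [hμ, ← mul_div_assoc]; exact div_nonpos_of_nonpos_of_nonneg h2 hf0.le
  set L := Real.log (m * f)
  have hL : 0 < L := Real.log_pos hmf
  -- The penalty then uses at most half of the growth rate `L` per generation; the other half, over
  -- `h` generations, pays for `1 / (4 * α)`.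
  set α := L / (2 * (|σ| + 1)) with hα
  have hα0 : 0 < α := by positivity
  have hασ : α * |σ| ≤ L / 2 := by
    rw [hα, div_mul_eq_mul_div, div_le_div_iff₀ (by positivity) (by positivity)]
    nlinarith [abs_nonneg σ]
  obtain ⟨h, hh⟩ := exists_nat_gt (1 / (4 * α) / (L / 2))
  refine ⟨h, lt_of_lt_of_le ?_ (le_growth hi hρ (c := 1) ht hf.symm
    (μ := μ) (σ := σ) (div_mul_cancel₀ I1 hf0.ne').symm
    (by rw [hσ, sub_add_cancel]; exact (div_mul_cancel₀ I2 hf0.ne').symm) hf0 e1 e2 hα0 h h one_pos)⟩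
  rw [← ENNReal.ofReal_one]
  refine (ENNReal.ofReal_lt_ofReal_iff (by positivity)).2 ?_
  have hmf0 : 0 < (m : ℝ) * f := by linarith
  have hpow : ((m : ℝ) * f) ^ h = Real.exp (h * L) := by
    rw [Real.exp_nat_mul, Real.exp_log hmf0]
  rw [hpow, ← Real.exp_add, Real.one_lt_exp_iff]
  simp only [NNReal.coe_one, Real.log_one, mul_zero, zero_add, sub_self, zero_sub]
  rw [div_lt_iff₀ (by positivity)] at hh
  have hσ' : α * (h * σ) ≤ h * (L / 2) := by
    calc α * (h * σ) = h * (α * σ) := by ring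
      _ ≤ h * (α * |σ|) := by
        refine mul_le_mul_of_nonneg_left ?_ (Nat.cast_nonneg h)
        exact mul_le_mul_of_nonneg_left (le_abs_self σ) hα0.le
      _ ≤ _ := mul_le_mul_of_nonneg_left hασ (Nat.cast_nonneg h)
  have : α * ((0 : ℝ) ^ 2 + h * σ) = α * (h * σ) := by ring
  rw [this]
  linarith

end growth

/-- The mean of the offspring law, truncated at `K`. -/
noncomputable def truncMean (q : PMF ℕ) (K : ℕ) : ℝ≥0∞ :=
  ∑' k : ℕ, q k * ((if k ≤ K then 1 else 0) * k)

theorem truncMean_eq_sum (q : PMF ℕ) (K : ℕ) :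
    truncMean q K = ∑ k ∈ Finset.range (K + 1), (k : ℝ≥0∞) * q k := by
  rw [truncMean, tsum_eq_sum (s := Finset.range (K + 1))]
  · refine Finset.sum_congr rfl fun k hk => ?_
    rw [if_pos (Nat.lt_succ_iff.1 (Finset.mem_range.1 hk)), one_mul, mul_comm]
  · intro k hk
    rw [if_neg (fun h => hk (Finset.mem_range.2 (Nat.lt_succ_iff.2 h)))]; simp

theorem truncMean_ne_top (q : PMF ℕ) (K : ℕ) : truncMean q K ≠ ⊤ := by
  rw [truncMean_eq_sum]
  exact ENNReal.sum_ne_top.2 fun k _ => ENNReal.mul_ne_top (by simp) (q.apply_ne_top k)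

/-- The offspring law may have infinite variance, so the second-moment argument uses only vertices
with at most `K` children. The strict inequality in the hypothesis survives truncation at a large
`K`. -/
theorem exists_truncMean {q : PMF ℕ} {I : ℝ≥0∞} (h : (offspringMean q)⁻¹ < I) :
    ∃ K, ∀ J, I ≤ J → 1 < truncMean q K * J := by
  have h1 : I⁻¹ < offspringMean q := by rwa [ENNReal.inv_lt_iff_inv_lt]
  have h2 : Tendsto (fun K => truncMean q K) atTop (nhds (offspringMean q)) := by
    simp only [truncMean_eq_sum]
    exact (tendsto_add_atTop_iff_nat 1).2 (ENNReal.tendsto_nat_tsum _)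
  obtain ⟨K, hK⟩ := (h2.eventually_const_lt h1).exists
  refine ⟨K, fun J hJ => ?_⟩
  have hI0 : I ≠ 0 := (zero_le.trans_lt h).ne'
  by_cases hJt : J = ⊤
  · rw [hJt, ENNReal.mul_top (zero_le.trans_lt hK).ne']; exact ENNReal.one_lt_top
  have : J⁻¹ < truncMean q K := (ENNReal.inv_le_inv.2 hJ).trans_lt hK
  have hJ0 : J ≠ 0 := (hI0.bot_lt.trans_le hJ).ne'
  calc 1 = J⁻¹ * J := (ENNReal.inv_mul_cancel hJ0 hJt).symm
    _ < _ := ENNReal.mul_lt_mul_left hJ0 hJt this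

end RWRE

namespace RWRE

/-! ### Transience: flows of finite energy -/

theorem measurable_comp_numChildren {α β : Type*} [MeasurableSpace α] [MeasurableSpace β]
    {N : α → ℕ} (hN : Measurable N) (g : ℕ → α → β) (hg : ∀ m, Measurable (g m)) :
    Measurable fun a => g (N a) a := by
  have h : Measurable fun p : ℕ × α => g p.1 p.2 := measurable_from_prod_countable_right hg
  exact h.comp (hN.prodMk measurable_id)

/-- The number of children of the root, if it is at most `K`. -/
def usedChildren (K : ℕ) (ω : Env) : ℕ := if (ω []).1 ≤ K then (ω []).1 else 0

theorem usedChildren_le (K : ℕ) (ω : Env) : usedChildren K ω ≤ (ω []).1 := by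
  unfold usedChildren; split_ifs <;> simp

theorem measurable_usedChildren (K : ℕ) : Measurable (usedChildren K) :=
  (measurable_of_countable fun k : ℕ => if k ≤ K then k else 0).comp
    (measurable_numChildren_word [])

theorem sum_usedChildren (K : ℕ) (ω : Env) (F : ℕ → ℝ≥0∞) :
    ∑ i ∈ Finset.range (usedChildren K ω), F i =
      (if (ω []).1 ≤ K then 1 else 0) * ∑ i ∈ Finset.range (ω []).1, F i := by
  unfold usedChildren; split_ifs <;> simp

section expectations

variable (q : PMF ℕ) (ρ : Measure ℝ≥0) [IsProbabilityMeasure ρ]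

theorem lintegral_sum_used (K : ℕ) {f : Env → ℝ≥0∞} (hf : Measurable f) :
    ∫⁻ ω, ∑ i ∈ Finset.range (usedChildren K ω), f (subEnv [i] ω) ∂envLaw q ρ =
      truncMean q K * ∫⁻ ω, f ω ∂envLaw q ρ := by
  simp only [sum_usedChildren]
  rw [lintegral_sum_children q ρ (fun k => if k ≤ K then 1 else 0) (f := fun _ => f) fun _ => hf,
    truncMean, ← ENNReal.tsum_mul_right]
  refine tsum_congr fun k => ?_
  ring

theorem lintegral_pair (k : ℕ) {i l : ℕ} {f : Env → ℝ≥0∞} (hf : Measurable f) (hil : i ≠ l) :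
    ∫⁻ ω, (if (ω []).1 = k then 1 else 0) * (f (subEnv [i] ω) * f (subEnv [l] ω)) ∂envLaw q ρ =
      q k * (∫⁻ ω, f ω ∂envLaw q ρ) ^ 2 := by
  have h := lintegral_prod_subEnv q ρ k (max i l + 1)
    (f := fun j => if j ∈ ({i, l} : Finset ℕ) then f else fun _ => 1)
    (fun j => by split_ifs; exacts [hf, measurable_const])
  have hI : ∀ j, ∫⁻ ω, (if j ∈ ({i, l} : Finset ℕ) then f else fun _ => 1) ω ∂envLaw q ρ =
      if j ∈ ({i, l} : Finset ℕ) then ∫⁻ ω, f ω ∂envLaw q ρ else 1 := by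
    intro j; split_ifs <;> simp
  have hinter : Finset.range (max i l + 1) ∩ {i, l} = {i, l} := by
    refine Finset.inter_eq_right.2 fun j hj => ?_
    simp only [Finset.mem_insert, Finset.mem_singleton] at hj
    rw [Finset.mem_range]; omega
  have hg : ∀ (g : ℕ → ℝ≥0∞), ∏ j ∈ Finset.range (max i l + 1),
      (if j ∈ ({i, l} : Finset ℕ) then g j else 1) = g i * g l := by
    intro g
    rw [Finset.prod_ite_mem, hinter, Finset.prod_pair hil]
  simp only [hI] at h
  rw [hg fun _ => ∫⁻ ω, f ω ∂envLaw q ρ, ← sq] at h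
  rw [← h]
  refine lintegral_congr fun ω => ?_
  rw [← hg fun j => f (subEnv [j] ω)]
  congr 1
  refine Finset.prod_congr rfl fun j _ => ?_
  split_ifs <;> rfl

theorem lintegral_single (k i : ℕ) {f : Env → ℝ≥0∞} (hf : Measurable f) :
    ∫⁻ ω, (if (ω []).1 = k then 1 else 0) * f (subEnv [i] ω) ∂envLaw q ρ =
      q k * ∫⁻ ω, f ω ∂envLaw q ρ := by
  have h := lintegral_prod_subEnv q ρ k (i + 1)
    (f := fun j => if j ∈ ({i} : Finset ℕ) then f else fun _ => 1)
    (fun j => by split_ifs; exacts [hf, measurable_const])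
  have hI : ∀ j, ∫⁻ ω, (if j ∈ ({i} : Finset ℕ) then f else fun _ => 1) ω ∂envLaw q ρ =
      if j ∈ ({i} : Finset ℕ) then ∫⁻ ω, f ω ∂envLaw q ρ else 1 := by
    intro j; split_ifs <;> simp
  have hinter : Finset.range (i + 1) ∩ {i} = {i} := by simp
  have hg : ∀ (g : ℕ → ℝ≥0∞), ∏ j ∈ Finset.range (i + 1),
      (if j ∈ ({i} : Finset ℕ) then g j else 1) = g i := by
    intro g
    rw [Finset.prod_ite_mem, hinter, Finset.prod_singleton]
  simp only [hI] at h
  rw [hg fun _ => ∫⁻ ω, f ω ∂envLaw q ρ] at h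
  rw [← h]
  refine lintegral_congr fun ω => ?_
  rw [← hg fun j => f (subEnv [j] ω)]
  congr 1
  refine Finset.prod_congr rfl fun j _ => ?_
  split_ifs <;> rfl

/-- Expand the square: the diagonal gives the second moment, while distinct children are independent
and there are at most `K ^ 2` pairs of them. -/
theorem lintegral_sq_sum_used (K : ℕ) {f : Env → ℝ≥0∞} (hf : Measurable f) :
    ∫⁻ ω, (∑ i ∈ Finset.range (usedChildren K ω), f (subEnv [i] ω)) ^ 2 ∂envLaw q ρ ≤
      truncMean q K * ∫⁻ ω, f ω ^ 2 ∂envLaw q ρ + K ^ 2 * (∫⁻ ω, f ω ∂envLaw q ρ) ^ 2 := by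
  set a := ∫⁻ ω, f ω ^ 2 ∂envLaw q ρ
  set b := (∫⁻ ω, f ω ∂envLaw q ρ) ^ 2 with hb
  have hfm : ∀ i, Measurable fun ω => f (subEnv [i] ω) := fun i => hf.comp (measurable_subEnv _)
  simp only [sum_usedChildren]
  rw [lintegral_numChildren q ρ (f := fun k ω => ((if k ≤ K then 1 else 0) *
    ∑ i ∈ Finset.range k, f (subEnv [i] ω)) ^ 2) fun k =>
      ((Finset.measurable_fun_sum _ fun i _ => hfm i).const_mul _).pow_const 2]
  have hk : ∀ k : ℕ, ∫⁻ ω, (if (ω []).1 = k then 1 else 0) * ((if k ≤ K then 1 else 0) *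
      ∑ i ∈ Finset.range k, f (subEnv [i] ω)) ^ 2 ∂envLaw q ρ ≤
      q k * ((if k ≤ K then 1 else 0) * k) * a + q k * (K ^ 2 * b) := by
    intro k
    by_cases hkK : k ≤ K
    · have e : ∀ ω : Env, (if (ω []).1 = k then 1 else 0 : ℝ≥0∞) * ((if k ≤ K then 1 else 0) *
          ∑ i ∈ Finset.range k, f (subEnv [i] ω)) ^ 2 =
          ∑ i ∈ Finset.range k, ∑ l ∈ Finset.range k, (if (ω []).1 = k then 1 else 0) *
            (f (subEnv [i] ω) * f (subEnv [l] ω)) := by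
        intro ω
        rw [if_pos hkK, one_mul, sq, Finset.sum_mul_sum, Finset.mul_sum]
        simp only [Finset.mul_sum]
      simp only [e]
      have hmm : ∀ i l, Measurable fun ω : Env => (if (ω []).1 = k then 1 else 0 : ℝ≥0∞) *
          (f (subEnv [i] ω) * f (subEnv [l] ω)) := fun i l =>
        (measurable_ite_numChildren [] k).fun_mul ((hfm i).fun_mul (hfm l))
      rw [lintegral_finsetSum _ fun i _ => Finset.measurable_fun_sum _ fun l _ => hmm i l]
      have e2 : ∀ i ∈ Finset.range k, ∫⁻ ω, ∑ l ∈ Finset.range k, (if (ω []).1 = k then 1 else 0) *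
            (f (subEnv [i] ω) * f (subEnv [l] ω)) ∂envLaw q ρ ≤ q k * a + k * (q k * b) := by
        intro i hi
        rw [lintegral_finsetSum _ fun l _ => hmm i l, ← Finset.add_sum_erase _ _ hi]
        refine add_le_add (le_of_eq ?_) ?_
        · have := lintegral_single q ρ k i (hf.pow_const 2)
          rw [← this]
          refine lintegral_congr fun ω => ?_
          rw [sq]
        · refine (Finset.sum_le_card_nsmul _ _ (q k * b) fun l hl => ?_).trans ?_
          · exact (lintegral_pair q ρ k hf (Finset.ne_of_mem_erase hl).symm).le
          · rw [nsmul_eq_mul]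
            refine mul_le_mul_left ?_ _
            exact_mod_cast (Finset.card_erase_le).trans (by simp)
      refine (Finset.sum_le_card_nsmul _ _ _ e2).trans ?_
      rw [Finset.card_range, nsmul_eq_mul, if_pos hkK, one_mul, mul_add]
      refine add_le_add (le_of_eq (by ring)) ?_
      have : (k : ℝ≥0∞) ≤ K := by exact_mod_cast hkK
      calc (k : ℝ≥0∞) * (k * (q k * b)) = q k * (k ^ 2 * b) := by ring
        _ ≤ _ := by gcongr
    · simp [hkK]
  refine (ENNReal.tsum_le_tsum hk).trans (le_of_eq ?_)
  rw [ENNReal.tsum_add, ENNReal.tsum_mul_right, ENNReal.tsum_mul_right, q.tsum_coe, one_mul,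
    truncMean]

end expectations

/-- The flow through the root over a block of `j` generations. -/
noncomputable def blockFlow (K : ℕ) (W : Env → ℝ≥0) : ℕ → ℝ≥0 → Env → ℝ≥0
  | 0, c, ω => min 1 c * W ω
  | j + 1, c, ω => ∑ i ∈ Finset.range (usedChildren K ω),
      blockFlow K W j (c * (ω [i]).2) (subEnv [i] ω)

/-- The energy of `blockFlow`. -/
noncomputable def blockEnergy (K : ℕ) (W E : Env → ℝ≥0) : ℕ → ℝ≥0 → Env → ℝ≥0
  | 0, c, ω => min 1 c ^ 2 * E ω
  | j + 1, c, ω => blockFlow K W (j + 1) c ω ^ 2 + ∑ i ∈ Finset.range (usedChildren K ω),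
      blockEnergy K W E j (c * (ω [i]).2) (subEnv [i] ω) / (ω [i]).2

theorem usedChildren_congr (K : ℕ) {ω ω' : Env} (h : AgreeButMark ω ω') :
    usedChildren K ω = usedChildren K ω' := by simp [usedChildren, h.1]

theorem blockFlow_congr (K : ℕ) {W : Env → ℝ≥0} (hW : ∀ ω ω', AgreeButMark ω ω' → W ω = W ω')
    (j : ℕ) (c : ℝ≥0) {ω ω' : Env} (h : AgreeButMark ω ω') :
    blockFlow K W j c ω = blockFlow K W j c ω' := by
  cases j with
  | zero => simp only [blockFlow, hW _ _ h]
  | succ j => simp only [blockFlow, usedChildren_congr K h, h.2 [_] (by simp), h.subEnv_eq]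

theorem blockEnergy_congr (K : ℕ) {W E : Env → ℝ≥0} (hW : ∀ ω ω', AgreeButMark ω ω' → W ω = W ω')
    (hE : ∀ ω ω', AgreeButMark ω ω' → E ω = E ω')
    (j : ℕ) (c : ℝ≥0) {ω ω' : Env} (h : AgreeButMark ω ω') :
    blockEnergy K W E j c ω = blockEnergy K W E j c ω' := by
  cases j with
  | zero => simp only [blockEnergy, hE _ _ h]
  | succ j => simp only [blockEnergy, usedChildren_congr K h, h.2 [_] (by simp), h.subEnv_eq,
      blockFlow_congr K hW _ _ h]

theorem measurable_blockFlow (K : ℕ) {W : Env → ℝ≥0} (hW : Measurable W) (j : ℕ) :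
    Measurable fun p : ℝ≥0 × Env => blockFlow K W j p.1 p.2 := by
  induction j with
  | zero =>
    exact (measurable_const.min measurable_fst).mul (hW.comp measurable_snd)
  | succ j ih =>
    refine measurable_comp_numChildren (N := fun p : ℝ≥0 × Env => usedChildren K p.2)
      ((measurable_usedChildren K).comp measurable_snd) (fun m p => ∑ i ∈ Finset.range m,
      blockFlow K W j (p.1 * (p.2 [i]).2) (subEnv [i] p.2)) fun m => ?_
    refine Finset.measurable_fun_sum _ fun i _ => ?_
    exact ih.comp ((measurable_fst.fun_mul ((measurable_mark [i]).comp measurable_snd)).prodMk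
      ((measurable_subEnv [i]).comp measurable_snd))

theorem measurable_blockEnergy (K : ℕ) {W E : Env → ℝ≥0} (hW : Measurable W) (hE : Measurable E)
    (j : ℕ) : Measurable fun p : ℝ≥0 × Env => blockEnergy K W E j p.1 p.2 := by
  induction j with
  | zero =>
    exact ((measurable_const.min measurable_fst).pow_const 2).mul (hE.comp measurable_snd)
  | succ j ih =>
    refine ((measurable_blockFlow K hW (j + 1)).pow_const 2).add ?_
    refine measurable_comp_numChildren (N := fun p : ℝ≥0 × Env => usedChildren K p.2)
      ((measurable_usedChildren K).comp measurable_snd) (fun m p => ∑ i ∈ Finset.range m,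
      blockEnergy K W E j (p.1 * (p.2 [i]).2) (subEnv [i] p.2) / (p.2 [i]).2) fun m => ?_
    refine Finset.measurable_fun_sum _ fun i _ => ?_
    exact (ih.comp ((measurable_fst.fun_mul ((measurable_mark [i]).comp measurable_snd)).prodMk
      ((measurable_subEnv [i]).comp measurable_snd))).fun_div
      ((measurable_mark [i]).comp measurable_snd)

theorem measurable_blockFlow_const (K : ℕ) {W : Env → ℝ≥0} (hW : Measurable W) (j : ℕ)
    (c : ℝ≥0) : Measurable fun ω => (blockFlow K W j c ω : ℝ≥0∞) :=
  ((measurable_blockFlow K hW j).comp (measurable_const.prodMk measurable_id)).coe_nnreal_ennreal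

theorem measurable_blockEnergy_const (K : ℕ) {W E : Env → ℝ≥0} (hW : Measurable W)
    (hE : Measurable E) (j : ℕ) (c : ℝ≥0) :
    Measurable fun ω => (blockEnergy K W E j c ω : ℝ≥0∞) :=
  ((measurable_blockEnergy K hW hE j).comp
    (measurable_const.prodMk measurable_id)).coe_nnreal_ennreal

/-- All marks lie between `i` and `s`. -/
def MarksIn (i s : ℝ≥0) (ω : Env) : Prop := ∀ x, i ≤ (ω x).2 ∧ (ω x).2 ≤ s

theorem MarksIn.subEnv {i s : ℝ≥0} {ω : Env} (h : MarksIn i s ω) (x : List ℕ) :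
    MarksIn i s (subEnv x ω) := fun _ => h _

theorem ae_marksIn (q : PMF ℕ) {ρ : Measure ℝ≥0} [IsProbabilityMeasure ρ] {i s : ℝ≥0}
    (hρ : ∀ᵐ a ∂ρ, i ≤ a ∧ a ≤ s) : ∀ᵐ ω ∂envLaw q ρ, MarksIn i s ω := by
  unfold MarksIn
  rw [ae_all_iff]
  intro x
  rw [← map_mark q ρ x] at hρ
  exact ae_of_ae_map (measurable_mark x).aemeasurable hρ

/-- Thomson's principle, in one step: the conductance is at least the square of the flow divided
by its energy. -/
theorem blockFlow_sq_le {i s : ℝ≥0} (hi : 0 < i) (K : ℕ) {W E : Env → ℝ≥0} {n : ℕ}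
    (h : ∀ ω, MarksIn i s ω → W ω ^ 2 ≤ escN n ω * E ω) (j : ℕ) (c : ℝ≥0) {ω : Env}
    (hω : MarksIn i s ω) :
    blockFlow K W j c ω ^ 2 ≤ escN (n + j) ω * blockEnergy K W E j c ω := by
  induction j generalizing c ω with
  | zero =>
    simp only [blockFlow, blockEnergy, add_zero, mul_pow]
    calc min 1 c ^ 2 * W ω ^ 2 ≤ min 1 c ^ 2 * (escN n ω * E ω) := mul_le_mul_right (h ω hω) _
      _ = _ := by ring
  | succ j ih =>
    set N := usedChildren K ω
    set w : ℕ → ℝ≥0 := fun i => blockFlow K W j (c * (ω [i]).2) (subEnv [i] ω) with hw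
    set e : ℕ → ℝ≥0 := fun i => blockEnergy K W E j (c * (ω [i]).2) (subEnv [i] ω) / (ω [i]).2
      with he
    set S := ∑ i ∈ Finset.range (ω []).1, (ω [i]).2 * escN (n + j) (subEnv [i] ω) with hS
    have hB : blockFlow K W (j + 1) c ω = ∑ i ∈ Finset.range N, w i := rfl
    have hE : blockEnergy K W E (j + 1) c ω =
      (∑ i ∈ Finset.range N, w i) ^ 2 + ∑ i ∈ Finset.range N, e i := rfl
    have hesc : escN (n + (j + 1)) ω = S / (1 + S) := rfl
    -- Cauchy-Schwarz, with the flow through each child split as the square root of conductance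
    -- times energy. The division by the mark in `e` is the resistance of the edge and cancels the
    -- mark in the conductance.
    have hCS : (∑ i ∈ Finset.range N, w i) ^ 2 ≤
        (∑ i ∈ Finset.range N, (ω [i]).2 * escN (n + j) (subEnv [i] ω)) *
          ∑ i ∈ Finset.range N, e i := by
      have hle : ∑ i ∈ Finset.range N, w i ≤ ∑ i ∈ Finset.range N,
          NNReal.sqrt ((ω [i]).2 * escN (n + j) (subEnv [i] ω)) * NNReal.sqrt (e i) := by
        refine Finset.sum_le_sum fun l _ => ?_
        have hA : 0 < (ω [l]).2 := hi.trans_le (hω [l]).1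
        rw [← NNReal.sqrt_mul, NNReal.le_sqrt_iff_sq_le]
        refine (ih (c * (ω [l]).2) (hω.subEnv [l])).trans (le_of_eq ?_)
        simp only [he]
        field_simp
      calc (∑ i ∈ Finset.range N, w i) ^ 2 ≤ _ := pow_le_pow_left₀ zero_le hle 2
        _ ≤ _ := Finset.sum_mul_sq_le_sq_mul_sq _ _ _
        _ = _ := by simp only [NNReal.sq_sqrt]
    have hSle : ∑ i ∈ Finset.range N, (ω [i]).2 * escN (n + j) (subEnv [i] ω) ≤ S :=
      Finset.sum_le_sum_of_subset (Finset.range_mono (usedChildren_le K ω))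
    -- The unit resistance of the edge to the parent is put in series: adding the squared flow to
    -- the energy matches passing from `S` to `S / (1 + S)`.
    rw [hB, hE, hesc, div_mul_eq_mul_div, le_div_iff₀ (by positivity)]
    have := hCS.trans (mul_le_mul_left hSle _)
    calc (∑ i ∈ Finset.range N, w i) ^ 2 * (1 + S)
        = (∑ i ∈ Finset.range N, w i) ^ 2 + S * (∑ i ∈ Finset.range N, w i) ^ 2 := by ring
      _ ≤ S * ∑ i ∈ Finset.range N, e i + S * (∑ i ∈ Finset.range N, w i) ^ 2 :=
          add_le_add_left this _
      _ = _ := by ring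

/-! ### Moments of the flow and of its energy -/

section bounds

variable (q : PMF ℕ) (ρ : Measure ℝ≥0) [IsProbabilityMeasure ρ]

theorem lintegral_mark_mul {f : ℝ≥0 → Env → ℝ≥0} (hf : Measurable fun p : ℝ≥0 × Env => f p.1 p.2)
    (hc : ∀ c ω ω', AgreeButMark ω ω' → f c ω = f c ω') (c : ℝ≥0) (n : ℕ) :
    ∫⁻ ω, (f (c * (ω []).2) ω : ℝ≥0∞) ^ n ∂envLaw q ρ =
      ∫⁻ a, ∫⁻ ω, (f (c * a) ω : ℝ≥0∞) ^ n ∂envLaw q ρ ∂ρ := by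
  refine lintegral_mark q ρ (f := fun a ω => (f (c * a) ω : ℝ≥0∞) ^ n) ?_ fun a ω => ?_
  · exact (hf.comp ((measurable_fst.const_mul c).prodMk measurable_snd)).coe_nnreal_ennreal.pow_const
      n
  · rw [hc _ _ _ (agreeButMark_eraseMark ω)]

theorem lintegral_blockFlow {K : ℕ} {W : Env → ℝ≥0} (hW : Measurable W)
    (hWc : ∀ ω ω', AgreeButMark ω ω' → W ω = W ω')
    (hW1 : ∫⁻ ω, (W ω : ℝ≥0∞) ∂envLaw q ρ = 1) (j : ℕ) (c : ℝ≥0) :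
    ∫⁻ ω, (blockFlow K W j c ω : ℝ≥0∞) ∂envLaw q ρ = growth ρ (truncMean q K) j c := by
  induction j generalizing c with
  | zero =>
    simp only [blockFlow, growth, ENNReal.coe_mul]
    rw [lintegral_const_mul _ hW.coe_nnreal_ennreal, hW1, mul_one]
  | succ j ih =>
    have hm := measurable_blockFlow K hW j
    have hmm : Measurable fun ω : Env => (blockFlow K W j (c * (ω []).2) ω : ℝ≥0∞) :=
      (hm.comp (((measurable_mark []).const_mul c).prodMk measurable_id)).coe_nnreal_ennreal
    have h1 : ∀ ω, (blockFlow K W (j + 1) c ω : ℝ≥0∞) =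
        ∑ i ∈ Finset.range (usedChildren K ω),
          (fun ω' => (blockFlow K W j (c * (ω' []).2) ω' : ℝ≥0∞)) (subEnv [i] ω) := by
      intro ω
      rw [blockFlow]; push_cast; rfl
    rw [lintegral_congr h1, lintegral_sum_used q ρ K hmm, growth]
    congr 1
    have := lintegral_mark_mul q ρ hm (fun c _ _ => blockFlow_congr K hWc j c) c 1
    simp only [pow_one] at this
    rw [this]
    exact lintegral_congr fun a => ih _

/-- Because min(1,c)² ≤ min(1,c), the second moment of `W` enters with coefficient `growth` only,
and the remainder depends on neither `c` nor `W`. Normalizing the flow by its mean then produces a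
contraction. -/
theorem lintegral_blockFlow_sq_le {K : ℕ} {W : Env → ℝ≥0} (hW : Measurable W)
    (hWc : ∀ ω ω', AgreeButMark ω ω' → W ω = W ω')
    (hW1 : ∫⁻ ω, (W ω : ℝ≥0∞) ∂envLaw q ρ = 1) (j : ℕ) (c : ℝ≥0) :
    ∫⁻ ω, (blockFlow K W j c ω : ℝ≥0∞) ^ 2 ∂envLaw q ρ ≤
      (∫⁻ ω, (W ω : ℝ≥0∞) ^ 2 ∂envLaw q ρ) * growth ρ (truncMean q K) j c +
        j * (1 + truncMean q K) ^ (2 * j) * K ^ 2 := by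
  set V := ∫⁻ ω, (W ω : ℝ≥0∞) ^ 2 ∂envLaw q ρ
  set m := truncMean q K
  induction j generalizing c with
  | zero =>
    simp only [blockFlow, growth, ENNReal.coe_mul, mul_pow]
    rw [lintegral_const_mul _ (hW.coe_nnreal_ennreal.pow_const 2), mul_comm]
    refine (mul_le_mul_right ?_ _).trans le_self_add
    rw [sq]
    refine mul_le_of_le_one_left zero_le ?_
    exact_mod_cast min_le_left _ _
  | succ j ih =>
    have hm := measurable_blockFlow K hW j
    set f : Env → ℝ≥0∞ := fun ω => (blockFlow K W j (c * (ω []).2) ω : ℝ≥0∞) with hf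
    have hmm : Measurable f :=
      (hm.comp (((measurable_mark []).const_mul c).prodMk measurable_id)).coe_nnreal_ennreal
    have h1 : ∀ ω, (blockFlow K W (j + 1) c ω : ℝ≥0∞) ^ 2 =
        (∑ i ∈ Finset.range (usedChildren K ω), f (subEnv [i] ω)) ^ 2 := by
      intro ω
      rw [blockFlow]; push_cast; rfl
    have hI := fun n => lintegral_mark_mul q ρ hm (fun c _ _ => blockFlow_congr K hWc j c) c n
    have hf1 : ∫⁻ ω, f ω ∂envLaw q ρ ≤ m ^ j := by
      have := hI 1
      simp only [pow_one] at this
      rw [hf, this]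
      refine (lintegral_mono (g := fun _ => m ^ j) fun a => ?_).trans (le_of_eq (by simp))
      rw [lintegral_blockFlow q ρ hW hWc hW1]
      exact growth_le _ _ _
    rw [lintegral_congr h1]
    refine (lintegral_sq_sum_used q ρ K hmm).trans ?_
    have hmg : Measurable fun a : ℝ≥0 => growth ρ m j (c * a) :=
      (measurable_growth m j).comp (measurable_id.const_mul c)
    have hf2 : ∫⁻ ω, f ω ^ 2 ∂envLaw q ρ ≤
        V * ∫⁻ a, growth ρ m j (c * a) ∂ρ + j * (1 + m) ^ (2 * j) * K ^ 2 := by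
      simp only [hf]
      rw [hI 2]
      refine (lintegral_mono fun a => ih (c * a)).trans ?_
      rw [lintegral_add_left (hmg.const_mul V), lintegral_const_mul _ hmg]
      simp
    have hmm1 : m ≤ (1 + m) ^ 2 := by
      calc m ≤ 1 + m := le_add_self
        _ = (1 + m) ^ 1 := (pow_one _).symm
        _ ≤ (1 + m) ^ 2 := pow_le_pow_right₀ le_self_add (by norm_num)
    have hmm2 : (m ^ j) ^ 2 ≤ (1 + m) ^ (2 * (j + 1)) := by
      calc (m ^ j) ^ 2 ≤ ((1 + m) ^ j) ^ 2 := by gcongr; exact le_add_self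
        _ = (1 + m) ^ (2 * j) := by rw [← pow_mul]; ring_nf
        _ ≤ _ := pow_le_pow_right₀ le_self_add (by omega)
    calc m * ∫⁻ ω, f ω ^ 2 ∂envLaw q ρ + K ^ 2 * (∫⁻ ω, f ω ∂envLaw q ρ) ^ 2
        ≤ m * (V * ∫⁻ a, growth ρ m j (c * a) ∂ρ + j * (1 + m) ^ (2 * j) * K ^ 2) +
            K ^ 2 * (1 + m) ^ (2 * (j + 1)) := by
          exact add_le_add (mul_le_mul_right hf2 _)
            (mul_le_mul_right ((pow_le_pow_left₀ zero_le hf1 2).trans hmm2) _)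
      _ = V * (m * ∫⁻ a, growth ρ m j (c * a) ∂ρ) + (m * (j * (1 + m) ^ (2 * j) * K ^ 2) +
            K ^ 2 * (1 + m) ^ (2 * (j + 1))) := by ring
      _ ≤ V * (m * ∫⁻ a, growth ρ m j (c * a) ∂ρ) + ((1 + m) ^ 2 * (j * (1 + m) ^ (2 * j) * K ^ 2) +
            K ^ 2 * (1 + m) ^ (2 * (j + 1))) := by gcongr
      _ = _ := by rw [growth]; push_cast; ring

/-- Here min(1,c)² ≤ c·min(1,c) is used. Each mark that multiplies `c` on the way down is divided
out again as a resistance, so the mean of `E` enters with coefficient `c * growth`, which at c = 1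
is again the growth factor. -/
theorem lintegral_blockEnergy_le {i s : ℝ≥0} (hi : 0 < i) (hρ : ∀ᵐ a ∂ρ, i ≤ a ∧ a ≤ s)
    {K : ℕ} {W E : Env → ℝ≥0} (hW : Measurable W)
    (hWc : ∀ ω ω', AgreeButMark ω ω' → W ω = W ω') (hE : Measurable E)
    (hEc : ∀ ω ω', AgreeButMark ω ω' → E ω = E ω') {Q : ℝ≥0∞} (h : ℕ)
    (hQ : ∀ j ≤ h, ∀ c, ∫⁻ ω, (blockFlow K W j c ω : ℝ≥0∞) ^ 2 ∂envLaw q ρ ≤ Q)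
    (j : ℕ) (hj : j ≤ h) (c : ℝ≥0) :
    ∫⁻ ω, (blockEnergy K W E j c ω : ℝ≥0∞) ∂envLaw q ρ ≤
      (∫⁻ ω, (E ω : ℝ≥0∞) ∂envLaw q ρ) * (c * growth ρ (truncMean q K) j c) +
        j * (1 + truncMean q K * (i : ℝ≥0∞)⁻¹) ^ j * Q := by
  set V := ∫⁻ ω, (E ω : ℝ≥0∞) ∂envLaw q ρ
  set m := truncMean q K
  set r : ℝ≥0∞ := 1 + m * (i : ℝ≥0∞)⁻¹ with hr
  induction j generalizing c with
  | zero =>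
    simp only [blockEnergy, growth, ENNReal.coe_mul]
    rw [lintegral_const_mul _ hE.coe_nnreal_ennreal, mul_comm]
    refine (mul_le_mul_right ?_ _).trans le_self_add
    rw [sq]
    norm_cast
    exact mul_le_mul_left (min_le_right _ _) _
  | succ j ih =>
    have hm := measurable_blockEnergy K hW hE j
    set g : ℝ≥0 → Env → ℝ≥0∞ := fun a ω => (blockEnergy K W E j (c * a) ω : ℝ≥0∞) / a with hg
    have hgm : Measurable (Function.uncurry g) :=
      (hm.comp ((measurable_fst.const_mul c).prodMk measurable_snd)).coe_nnreal_ennreal.div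
        measurable_fst.coe_nnreal_ennreal
    have hgm' : Measurable fun ω : Env => g (ω []).2 ω :=
      hgm.comp ((measurable_mark []).prodMk measurable_id)
    have h1 : ∀ᵐ ω ∂envLaw q ρ, (blockEnergy K W E (j + 1) c ω : ℝ≥0∞) =
        (blockFlow K W (j + 1) c ω : ℝ≥0∞) ^ 2 +
        ∑ i ∈ Finset.range (usedChildren K ω), (fun ω' => g (ω' []).2 ω') (subEnv [i] ω) := by
      filter_upwards [ae_marksIn q hρ] with ω hω
      rw [blockEnergy]
      push_cast
      congr 1
      refine Finset.sum_congr rfl fun l _ => ?_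
      rw [ENNReal.coe_div (hi.trans_le (hω [l]).1).ne']
      rfl
    have hfm : Measurable fun ω : Env => (blockFlow K W (j + 1) c ω : ℝ≥0∞) ^ 2 :=
      ((measurable_blockFlow K hW (j + 1)).comp
        (measurable_const.prodMk measurable_id)).coe_nnreal_ennreal.pow_const 2
    rw [lintegral_congr_ae h1, lintegral_add_left hfm, lintegral_sum_used q ρ K hgm']
    rw [lintegral_mark q ρ hgm fun a ω => by
      simp only [hg, blockEnergy_congr K hWc hEc _ _ (agreeButMark_eraseMark ω)]]
    have hmg : Measurable fun a : ℝ≥0 => growth ρ m j (c * a) :=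
      (measurable_growth m j).comp (measurable_id.const_mul c)
    have h2 : ∫⁻ a, ∫⁻ ω, g a ω ∂envLaw q ρ ∂ρ ≤
        V * c * ∫⁻ a, growth ρ m j (c * a) ∂ρ + j * r ^ j * Q * (i : ℝ≥0∞)⁻¹ := by
      have h3 : ∀ᵐ a ∂ρ, ∫⁻ ω, g a ω ∂envLaw q ρ ≤
          V * c * growth ρ m j (c * a) + j * r ^ j * Q * (i : ℝ≥0∞)⁻¹ := by
        filter_upwards [hρ] with a ha
        have ha0 : (a : ℝ≥0∞) ≠ 0 := by exact_mod_cast (hi.trans_le ha.1).ne'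
        simp only [hg, div_eq_mul_inv]
        rw [lintegral_mul_const _ (measurable_blockEnergy_const K hW hE j _)]
        refine (mul_le_mul_left (ih (by omega) (c * a)) _).trans ?_
        rw [add_mul]
        refine add_le_add (le_of_eq ?_) ?_
        · rw [ENNReal.coe_mul]
          calc V * (c * a * growth ρ m j (c * a)) * (a : ℝ≥0∞)⁻¹
              = V * c * growth ρ m j (c * a) * (a * (a : ℝ≥0∞)⁻¹) := by ring
            _ = _ := by rw [ENNReal.mul_inv_cancel ha0 ENNReal.coe_ne_top, mul_one]
        · refine mul_le_mul_right (ENNReal.inv_le_inv.2 ?_) _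
          exact_mod_cast ha.1
      refine (lintegral_mono_ae h3).trans ?_
      rw [lintegral_add_left (hmg.const_mul _), lintegral_const_mul _ hmg]
      simp
    calc _ ≤ Q + m * (V * c * ∫⁻ a, growth ρ m j (c * a) ∂ρ + j * r ^ j * Q * (i : ℝ≥0∞)⁻¹) :=
          add_le_add (hQ (j + 1) hj c) (mul_le_mul_right h2 _)
      _ = V * (c * (m * ∫⁻ a, growth ρ m j (c * a) ∂ρ)) +
          (1 * Q + (m * (i : ℝ≥0∞)⁻¹) * (j * r ^ j) * Q) := by ring
      _ ≤ V * (c * (m * ∫⁻ a, growth ρ m j (c * a) ∂ρ)) +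
          (r ^ (j + 1) * Q + r * (j * r ^ j) * Q) := by
          gcongr
          · exact one_le_pow₀ le_self_add
          · exact le_add_self
      _ = _ := by rw [growth]; push_cast; ring

/-- The flow over `N` blocks of `h` generations, normalized to have mean one. -/
noncomputable def flow (K h : ℕ) (μ : ℝ≥0) : ℕ → Env → ℝ≥0
  | 0, _ => 1
  | N + 1, ω => μ⁻¹ * blockFlow K (flow K h μ N) h 1 ω

/-- The energy of `flow`. -/
noncomputable def energy (K h : ℕ) (μ : ℝ≥0) : ℕ → Env → ℝ≥0
  | 0, _ => 1
  | N + 1, ω => μ⁻¹ ^ 2 * blockEnergy K (flow K h μ N) (energy K h μ N) h 1 ω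

theorem measurable_flow (K h : ℕ) (μ : ℝ≥0) (N : ℕ) : Measurable (flow K h μ N) := by
  induction N with
  | zero => exact measurable_const
  | succ N ih =>
    exact ((measurable_blockFlow K ih h).comp (measurable_const.prodMk measurable_id)).const_mul _

theorem measurable_energy (K h : ℕ) (μ : ℝ≥0) (N : ℕ) : Measurable (energy K h μ N) := by
  induction N with
  | zero => exact measurable_const
  | succ N ih =>
    exact ((measurable_blockEnergy K (measurable_flow K h μ N) ih h).comp
      (measurable_const.prodMk measurable_id)).const_mul _

theorem flow_congr (K h : ℕ) (μ : ℝ≥0) (N : ℕ) (ω ω' : Env) (hω : AgreeButMark ω ω') :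
    flow K h μ N ω = flow K h μ N ω' := by
  induction N generalizing ω ω' with
  | zero => rfl
  | succ N ih => simp only [flow, blockFlow_congr K ih h 1 hω]

theorem energy_congr (K h : ℕ) (μ : ℝ≥0) (N : ℕ) (ω ω' : Env) (hω : AgreeButMark ω ω') :
    energy K h μ N ω = energy K h μ N ω' := by
  induction N generalizing ω ω' with
  | zero => rfl
  | succ N ih => simp only [energy, blockEnergy_congr K (flow_congr K h μ N) ih h 1 hω]

theorem flow_sq_le {i s : ℝ≥0} (hi : 0 < i) (K h : ℕ) (μ : ℝ≥0) (N : ℕ) {ω : Env}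
    (hω : MarksIn i s ω) : flow K h μ N ω ^ 2 ≤ escN (N * h) ω * energy K h μ N ω := by
  induction N generalizing ω with
  | zero => simp [flow, energy, escN]
  | succ N ih =>
    have := blockFlow_sq_le hi K (fun ω hω => ih (ω := ω) hω) h 1 hω
    rw [flow, energy, mul_pow, add_mul, one_mul]
    calc μ⁻¹ ^ 2 * blockFlow K (flow K h μ N) h 1 ω ^ 2 ≤ _ := mul_le_mul_right this _
      _ = _ := by ring

/-- A linear recursion with slope less than one is bounded. -/
theorem bounded_of_linear_recursion {r : ℝ≥0} (hr : r < 1) {C : ℝ≥0∞} (hC : C ≠ ⊤)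
    {v : ℕ → ℝ≥0∞} (h0 : v 0 ≤ 1) (hv : ∀ n, v (n + 1) ≤ v n * r + C) :
    ∃ B : ℝ≥0, ∀ n, v n ≤ B := by
  lift C to ℝ≥0 using hC
  have hr' : 0 < 1 - r := tsub_pos_of_lt hr
  set B := (1 + C) / (1 - r) with hB
  have hB' : B * (1 - r) = 1 + C := div_mul_cancel₀ _ hr'.ne'
  refine ⟨B, fun n => ?_⟩
  induction n with
  | zero =>
    refine h0.trans ?_
    norm_cast
    rw [hB, le_div_iff₀ hr', one_mul]
    exact tsub_le_self.trans le_self_add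
  | succ n ih =>
    refine (hv n).trans ((add_le_add_left (mul_le_mul_left ih _) _).trans ?_)
    norm_cast
    calc B * r + C ≤ B * r + (1 + C) := by gcongr; exact le_add_self
      _ = B * (r + (1 - r)) := by rw [← hB', mul_add]
      _ = B := by rw [add_tsub_cancel_of_le hr.le, mul_one]

theorem lintegral_flow {K h : ℕ} {μ : ℝ≥0} (hμ : growth ρ (truncMean q K) h 1 = μ) (hμ1 : 1 < μ)
    (N : ℕ) : ∫⁻ ω, (flow K h μ N ω : ℝ≥0∞) ∂envLaw q ρ = 1 := by
  induction N with
  | zero => simp [flow]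
  | succ N ih =>
    simp only [flow, ENNReal.coe_mul]
    rw [lintegral_const_mul _ (measurable_blockFlow_const K (measurable_flow K h μ N) h 1),
      lintegral_blockFlow q ρ (measurable_flow K h μ N) (flow_congr K h μ N) ih, hμ]
    norm_cast
    exact inv_mul_cancel₀ (zero_lt_one.trans hμ1).ne'

/-- One block multiplies both the second moment and the mean energy by at most `μ`, up to an
additive constant, while the normalization multiplies by `μ⁻¹ ^ 2`. Both satisfy linear recursions
with slope `μ⁻¹ < 1`; the second moment comes first, since it feeds the additive constant of the
energy. -/
theorem exists_lintegral_energy_le {i s : ℝ≥0} (hi : 0 < i) (hρ : ∀ᵐ a ∂ρ, i ≤ a ∧ a ≤ s)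
    {K h : ℕ} {μ : ℝ≥0} (hμ : growth ρ (truncMean q K) h 1 = μ) (hμ1 : 1 < μ) :
    ∃ B : ℝ≥0, ∀ N, ∫⁻ ω, (energy K h μ N ω : ℝ≥0∞) ∂envLaw q ρ ≤ B := by
  have hμ0 : 0 < μ := zero_lt_one.trans hμ1
  have hinv : μ⁻¹ < 1 := inv_lt_one_of_one_lt₀ hμ1
  have hm := truncMean_ne_top q K
  have hsq : ∀ v C : ℝ≥0∞, ((μ⁻¹ : ℝ≥0) : ℝ≥0∞) ^ 2 * (v * μ + C) ≤
      v * ((μ⁻¹ : ℝ≥0) : ℝ≥0∞) + C := by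
    intro v C
    have e : ((μ⁻¹ : ℝ≥0) : ℝ≥0∞) * μ = 1 := by
      norm_cast; exact inv_mul_cancel₀ hμ0.ne'
    have e' : ((μ⁻¹ : ℝ≥0) : ℝ≥0∞) ^ 2 ≤ 1 := pow_le_one₀ zero_le (by exact_mod_cast hinv.le)
    calc ((μ⁻¹ : ℝ≥0) : ℝ≥0∞) ^ 2 * (v * μ + C)
        = v * ((μ⁻¹ : ℝ≥0) : ℝ≥0∞) * (((μ⁻¹ : ℝ≥0) : ℝ≥0∞) * μ) +
          ((μ⁻¹ : ℝ≥0) : ℝ≥0∞) ^ 2 * C := by ring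
      _ ≤ _ := by
          rw [e, mul_one]
          gcongr
          exact mul_le_of_le_one_left zero_le e'
  obtain ⟨B, hB⟩ := bounded_of_linear_recursion hinv
    (C := h * (1 + truncMean q K) ^ (2 * h) * K ^ 2) (by finiteness)
    (v := fun N => ∫⁻ ω, (flow K h μ N ω : ℝ≥0∞) ^ 2 ∂envLaw q ρ) (by simp [flow]) (by
      intro N
      have := lintegral_blockFlow_sq_le q ρ (K := K) (measurable_flow K h μ N)
        (flow_congr K h μ N) (lintegral_flow q ρ hμ hμ1 N) h 1
      rw [hμ] at this
      refine le_trans (le_of_eq ?_) ((mul_le_mul_right this _).trans (hsq _ _))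
      simp only [flow, ENNReal.coe_mul, mul_pow]
      rw [lintegral_const_mul _
        ((measurable_blockFlow_const K (measurable_flow K h μ N) h 1).pow_const 2)])
  set m := truncMean q K
  set Q : ℝ≥0∞ := B * (1 + m) ^ h + h * (1 + m) ^ (2 * h) * K ^ 2 with hQ
  have hQN : ∀ N, ∀ j ≤ h, ∀ c,
      ∫⁻ ω, (blockFlow K (flow K h μ N) j c ω : ℝ≥0∞) ^ 2 ∂envLaw q ρ ≤ Q := by
    intro N j hj c
    refine (lintegral_blockFlow_sq_le q ρ (K := K) (measurable_flow K h μ N)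
        (flow_congr K h μ N) (lintegral_flow q ρ hμ hμ1 N) j c).trans ?_
    have h1 : growth ρ m j c ≤ (1 + m) ^ h :=
      (growth_le _ _ _).trans ((pow_le_pow_left₀ zero_le le_add_self j).trans
        (pow_le_pow_right₀ le_self_add hj))
    have h2 : (1 + m) ^ (2 * j) ≤ (1 + m) ^ (2 * h) := pow_le_pow_right₀ le_self_add (by omega)
    have h3 : (j : ℝ≥0∞) ≤ h := by exact_mod_cast hj
    rw [hQ]
    gcongr
    exact hB N
  have hi0 : (i : ℝ≥0∞)⁻¹ ≠ ⊤ := ENNReal.inv_ne_top.2 (by exact_mod_cast hi.ne')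
  refine bounded_of_linear_recursion hinv
    (C := h * (1 + m * (i : ℝ≥0∞)⁻¹) ^ h * Q) (by rw [hQ]; finiteness)
    (v := fun N => ∫⁻ ω, (energy K h μ N ω : ℝ≥0∞) ∂envLaw q ρ) (by simp [energy]) ?_
  intro N
  have := lintegral_blockEnergy_le q ρ hi hρ (measurable_flow K h μ N) (flow_congr K h μ N)
    (measurable_energy K h μ N) (energy_congr K h μ N) h (hQN N) h le_rfl 1
  rw [hμ, ENNReal.coe_one, one_mul] at this
  refine le_trans (le_of_eq ?_) ((mul_le_mul_right this _).trans (hsq _ _))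
  simp only [energy, ENNReal.coe_mul, ENNReal.coe_pow]
  rw [lintegral_const_mul _ (measurable_blockEnergy_const K (measurable_flow K h μ N)
    (measurable_energy K h μ N) h 1)]

/-- Transience: the walk escapes with positive probability. -/
theorem lintegral_esc_pos {i s : ℝ≥0} (hi : 0 < i) (hρ : ∀ᵐ a ∂ρ, i ≤ a ∧ a ≤ s)
    (htr : (offspringMean q)⁻¹ < ⨅ t ∈ Set.Icc (0 : ℝ) 1, momentA ρ t) :
    0 < ∫⁻ ω, (esc ω : ℝ≥0∞) ∂envLaw q ρ := by
  obtain ⟨K, hK⟩ := exists_truncMean htr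
  obtain ⟨m, hm⟩ : ∃ m : ℝ≥0, (m : ℝ≥0∞) = truncMean q K :=
    ⟨_, ENNReal.coe_toNNReal (truncMean_ne_top q K)⟩
  obtain ⟨h, hh⟩ := exists_one_lt_growth hi hρ (m := m) fun t ht => by
    rw [hm]; exact hK _ (iInf₂_le t ht)
  rw [hm] at hh
  have hgt : growth ρ (truncMean q K) h 1 ≠ ⊤ :=
    ne_top_of_le_ne_top (ENNReal.pow_ne_top (truncMean_ne_top q K)) (growth_le _ _ _)
  obtain ⟨μ, hμ⟩ : ∃ μ : ℝ≥0, (μ : ℝ≥0∞) = growth ρ (truncMean q K) h 1 :=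
    ⟨_, ENNReal.coe_toNNReal hgt⟩
  have hμ1 : 1 < μ := by rw [← hμ] at hh; exact_mod_cast hh
  obtain ⟨B, hB⟩ := exists_lintegral_energy_le q ρ hi hρ hμ.symm hμ1
  -- At `h = 0` the growth is min(1,1) = 1, not more. Hence `N * h` is at least `N`, and bounding
  -- the escape to those levels suffices.
  have hh0 : 1 ≤ h := by
    rcases Nat.eq_zero_or_pos h with rfl | h0
    · simp [growth] at hh
    · exact h0
  have hle : ∀ n, (B : ℝ≥0∞)⁻¹ ≤ ∫⁻ ω, (escN n ω : ℝ≥0∞) ∂envLaw q ρ := by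
    intro n
    set x := ∫⁻ ω, (escN (n * h) ω : ℝ≥0∞) ∂envLaw q ρ with hx
    have h1 : 1 ≤ x * B := by
      have hpt : ∀ᵐ ω ∂envLaw q ρ, (flow K h μ n ω : ℝ≥0∞) ≤
          (fun ω => (escN (n * h) ω : ℝ≥0∞) ^ (1 / 2 : ℝ)) ω *
          (fun ω => (energy K h μ n ω : ℝ≥0∞) ^ (1 / 2 : ℝ)) ω := by
        filter_upwards [ae_marksIn q hρ] with ω hω
        have := flow_sq_le hi K h μ n hω
        rw [← ENNReal.mul_rpow_of_nonneg _ _ (by norm_num : (0 : ℝ) ≤ 1 / 2), ← ENNReal.coe_mul]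
        calc (flow K h μ n ω : ℝ≥0∞) = ((flow K h μ n ω : ℝ≥0∞) ^ (2 : ℝ)) ^ (1 / 2 : ℝ) := by
              rw [← ENNReal.rpow_mul]; norm_num
          _ ≤ _ := by
              refine ENNReal.rpow_le_rpow ?_ (by norm_num)
              rw [ENNReal.rpow_two]
              exact_mod_cast this
      -- Cauchy-Schwarz: the mean of the flow is 1, and it is at most the geometric mean of
      -- 𝐄[`escN`] and the mean energy, the latter bounded by `B`.
      have hH := ENNReal.lintegral_mul_le_Lp_mul_Lq (envLaw q ρ) (p := 2) (q := 2)
        (Real.holderConjugate_iff.2 ⟨by norm_num, by norm_num⟩)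
        (f := fun ω => (escN (n * h) ω : ℝ≥0∞) ^ (1 / 2 : ℝ))
        (g := fun ω => (energy K h μ n ω : ℝ≥0∞) ^ (1 / 2 : ℝ))
        ((measurable_escN _).coe_nnreal_ennreal.pow_const _).aemeasurable
        ((measurable_energy K h μ n).coe_nnreal_ennreal.pow_const _).aemeasurable
      have h2 := (lintegral_mono_ae hpt).trans hH
      rw [lintegral_flow q ρ hμ.symm hμ1] at h2
      simp only [← ENNReal.rpow_mul] at h2
      norm_num at h2
      rw [← ENNReal.mul_rpow_of_nonneg _ _ (by norm_num : (0 : ℝ) ≤ 1 / 2)] at h2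
      refine le_trans ?_ (mul_le_mul_right (hB n) x)
      by_contra hlt
      exact absurd h2 (not_le.2 (ENNReal.rpow_lt_one (not_le.1 hlt) (by norm_num)))
    have h3 : (B : ℝ≥0∞)⁻¹ ≤ x := by
      have hB0 : (B : ℝ≥0∞) ≠ 0 := by
        intro h0; rw [h0, mul_zero] at h1; exact absurd h1 (by simp)
      calc (B : ℝ≥0∞)⁻¹ = 1 * (B : ℝ≥0∞)⁻¹ := (one_mul _).symm
        _ ≤ x * B * (B : ℝ≥0∞)⁻¹ := mul_le_mul_left h1 _
        _ = x := by rw [mul_assoc, ENNReal.mul_inv_cancel hB0 ENNReal.coe_ne_top, mul_one]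
    refine h3.trans (lintegral_mono fun ω => ?_)
    exact ENNReal.coe_le_coe.2 (escN_antitone ω (Nat.le_mul_of_pos_right n hh0))
  have hI : ∫⁻ ω, (esc ω : ℝ≥0∞) ∂envLaw q ρ =
      ⨅ n, ∫⁻ ω, (escN n ω : ℝ≥0∞) ∂envLaw q ρ := by
    rw [← lintegral_iInf (fun n => (measurable_escN n).coe_nnreal_ennreal)]
    · refine lintegral_congr fun ω => ?_
      rw [esc, ENNReal.coe_iInf]
    · intro n n' hn ω
      exact ENNReal.coe_le_coe.2 (escN_antitone ω hn)
    · exact ne_top_of_le_ne_top ENNReal.one_ne_top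
        ((lintegral_mono fun ω => ENNReal.coe_le_coe.2 (escN_le_one 0 ω)).trans (by simp))
  rw [hI]
  exact lt_of_lt_of_le (ENNReal.inv_pos.2 ENNReal.coe_ne_top) (le_iInf hle)

end bounds

end RWRE

namespace RWRE

/-! ### The escape probability is almost surely positive -/

/-- Splitting off the value 1 should leave (1 - q₁)b; adding `q 1 * b` to both sides avoids
truncated subtraction. -/
theorem tsum_pmf_ite (q : PMF ℕ) (a b : ℝ≥0∞) :
    ∑' k, q k * (if k = 1 then a else b) + q 1 * b = q 1 * a + b := by
  have hb : ∑' k, q k * (if k = 1 then 0 else b) + q 1 * b = b := by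
    have h1 : ∑' k, (if k = 1 then q 1 * b else 0) = q 1 * b := tsum_ite_eq 1 fun _ => q 1 * b
    rw [← h1, ← ENNReal.tsum_add]
    calc _ = ∑' k, q k * b := tsum_congr fun k => by
          by_cases hk : k = 1
          · subst hk; simp
          · simp [hk]
      _ = b := by rw [ENNReal.tsum_mul_right, q.tsum_coe, one_mul]
  have ha : ∑' k, q k * (if k = 1 then a else b) =
      q 1 * a + ∑' k, q k * (if k = 1 then 0 else b) := by
    have h1 : ∑' k, (if k = 1 then q 1 * a else 0) = q 1 * a := tsum_ite_eq 1 fun _ => q 1 * a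
    rw [← h1, ← ENNReal.tsum_add]
    exact tsum_congr fun k => by
      by_cases hk : k = 1
      · subst hk; simp
      · simp [hk]
  rw [ha, add_assoc, hb]

section

variable (q : PMF ℕ) (ρ : Measure ℝ≥0) [IsProbabilityMeasure ρ]

theorem esc_eq_zero_iff {i s : ℝ≥0} (hi : 0 < i) {ω : Env} (h : MarksIn i s ω) :
    esc ω = 0 ↔ ∀ j < (ω []).1, esc (subEnv [j] ω) = 0 := by
  rw [esc_eq, div_eq_zero_iff, or_iff_left (by positivity), escSum, Finset.sum_eq_zero_iff]
  simp only [Finset.mem_range, mul_eq_zero]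
  exact forall₂_congr fun j _ => or_iff_right (hi.trans_le (h [j]).1).ne'

/-- The probability θ that the escape probability vanishes is a fixed point of the offspring
generating function, which for q₀ = 0 and q₁ < 1 has no fixed point strictly between 0 and 1. The
value 1 is excluded by the positive mean. -/
theorem ae_esc_pos {i s : ℝ≥0} (hi : 0 < i) (hρ : ∀ᵐ a ∂ρ, i ≤ a ∧ a ≤ s) (h0 : q 0 = 0)
    (h1 : q 1 < 1) (hpos : 0 < ∫⁻ ω, (esc ω : ℝ≥0∞) ∂envLaw q ρ) :
    ∀ᵐ ω ∂envLaw q ρ, 0 < esc ω := by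
  set f : Env → ℝ≥0∞ := fun ω => if esc ω = 0 then 1 else 0 with hf
  have hfm : Measurable f :=
    Measurable.ite (measurable_esc (measurableSet_singleton 0)) measurable_const measurable_const
  set θ := ∫⁻ ω, f ω ∂envLaw q ρ with hθ
  have hθm : θ = envLaw q ρ {ω | esc ω = 0} := by
    have hms : MeasurableSet {ω | esc ω = 0} := measurable_esc (measurableSet_singleton 0)
    rw [hθ, ← lintegral_indicator_one hms]
    refine lintegral_congr fun ω => ?_
    simp only [hf, Set.indicator, Set.mem_ofPred_eq, Pi.one_apply]
  have hθ1 : θ ≤ 1 := by rw [hθm]; exact prob_le_one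
  have hrec : θ = ∑' k, q k * θ ^ k := by
    have := lintegral_prod_children q ρ (fun _ => 1) (f := fun _ _ => f) fun _ _ => hfm
    simp only [one_mul, Finset.prod_const, Finset.card_range] at this
    rw [← this]
    refine lintegral_congr_ae ?_
    filter_upwards [ae_marksIn q hρ] with ω hω
    simp only [hf, esc_eq_zero_iff hi hω]
    rw [Finset.prod_ite_zero]
    simp
  -- This is θ ≤ q₁θ + (1 - q₁)θ² in additive form: every exponent k ≥ 2 is replaced by 2. It
  -- amounts to (1 - q₁)θ(1 - θ) ≤ 0.
  have hle : θ + q 1 * θ ^ 2 ≤ q 1 * θ + θ ^ 2 := by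
    rw [← tsum_pmf_ite]
    refine add_le_add_left (hrec.le.trans (ENNReal.tsum_le_tsum fun k => ?_)) _
    rcases k with _ | _ | k
    · simp [h0]
    · simp
    · exact mul_le_mul_right (pow_le_pow_right_of_le_one' hθ1 (by omega)) _
  have hne : θ ≠ 1 := by
    intro h
    rw [hθm] at h
    have hms : MeasurableSet {ω | esc ω = 0} := measurable_esc (measurableSet_singleton 0)
    have hae : ∀ᵐ ω ∂envLaw q ρ, esc ω = 0 := (prob_compl_eq_zero_iff hms).2 h
    refine hpos.ne' ?_
    rw [lintegral_congr_ae (g := fun _ => 0) (by filter_upwards [hae] with ω h; simp [h])]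
    simp
  have hθ0 : θ = 0 := by
    obtain ⟨x, hx⟩ : ∃ x : ℝ≥0, (x : ℝ≥0∞) = θ :=
      ⟨_, ENNReal.coe_toNNReal (ne_top_of_le_ne_top ENNReal.one_ne_top hθ1)⟩
    obtain ⟨p, hp⟩ : ∃ p : ℝ≥0, (p : ℝ≥0∞) = q 1 :=
      ⟨_, ENNReal.coe_toNNReal (q.apply_ne_top 1)⟩
    rw [← hx, ← hp] at hle
    rw [← hx] at hne hθ1
    rw [← hp] at h1
    norm_cast at hle hne hθ1 h1
    rw [← hx]
    norm_cast
    by_contra hx0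
    have hx1 : x < 1 := lt_of_le_of_ne hθ1 hne
    have hxp : 0 < x := pos_iff_ne_zero.2 hx0
    rw [← NNReal.coe_lt_coe] at hx1 hxp h1
    rw [← NNReal.coe_le_coe] at hle
    push_cast at hle hx1 hxp h1
    nlinarith [mul_pos hxp (mul_pos (sub_pos.2 hx1) (sub_pos.2 h1))]
  rw [hθm] at hθ0
  rw [ae_iff]
  simpa using hθ0

/-- The escape probability is unlikely to be small. -/
theorem exists_measure_esc_lt_le (hpos : ∀ᵐ ω ∂envLaw q ρ, 0 < esc ω) {η : ℝ≥0∞} (hη : 0 < η) :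
    ∃ b : ℝ≥0, 0 < b ∧ envLaw q ρ {ω | esc ω < b} ≤ η := by
  set B : ℕ → Set Env := fun n => {ω | esc ω < ((n : ℝ≥0) + 1)⁻¹}
  have hB : ∀ n, MeasurableSet (B n) := fun n => measurable_esc measurableSet_Iio
  have hanti : Antitone B := by
    intro n n' h ω hω
    refine lt_of_lt_of_le (show esc ω < ((n' : ℝ≥0) + 1)⁻¹ from hω) ?_
    have : (n : ℝ≥0) ≤ n' := by exact_mod_cast h
    gcongr
  have ht := tendsto_measure_iInter_atTop (μ := envLaw q ρ) (fun n => (hB n).nullMeasurableSet)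
    hanti ⟨0, measure_ne_top _ _⟩
  have h0 : envLaw q ρ (⋂ n, B n) = 0 := by
    refine measure_mono_null (fun ω hω => ?_) (ae_iff.1 hpos)
    simp only [Set.mem_iInter, B, Set.mem_ofPred_eq] at hω ⊢
    intro h
    obtain ⟨n, hn⟩ := exists_nat_one_div_lt (NNReal.coe_pos.2 h)
    refine absurd (hω n) (not_lt.2 ?_)
    rw [← NNReal.coe_le_coe]
    push_cast
    rw [← one_div]
    exact hn.le
  rw [h0] at ht
  obtain ⟨n, hn⟩ := (ht.eventually (gt_mem_nhds hη)).exists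
  exact ⟨((n : ℝ≥0) + 1)⁻¹, by positivity, hn.le⟩

end

/-! ### The probability to return from a deep level is small -/

theorem isVertex_append_singleton {ω : Env} {j : ℕ} {w : List ℕ} :
    IsVertex ω (w ++ [j]) ↔ j < (ω []).1 ∧ IsVertex (subEnv [j] ω) w := by
  induction w with
  | nil => simp [IsVertex]
  | cons i w ih =>
    rw [List.cons_append, IsVertex, ih, IsVertex, and_assoc]
    rfl

theorem retBelow_append_singleton (ω : Env) (j : ℕ) (w : List ℕ) :
    retBelow ω (w ++ [j]) = ret ω * retBelow (subEnv [j] ω) w := by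
  induction w with
  | nil => simp [retBelow, mul_comm]
  | cons i w ih =>
    rw [List.cons_append, retBelow, ih, retBelow, subEnv_subEnv, mul_left_comm]
    rfl

theorem retBelow_le_one (ω : Env) (w : List ℕ) : retBelow ω w ≤ 1 := by
  induction w with
  | nil => exact ret_le_one ω
  | cons i w ih => exact mul_le_one' (ret_le_one _) ih

/-- A bound for the `t`-th power of the return probability in terms of the escape probability
of a child. -/
noncomputable def escWeight (i : ℝ≥0) (t : ℕ) (ω : Env) : ℝ≥0 := (1 / (1 + i * esc ω)) ^ t

theorem measurable_escWeight (i : ℝ≥0) (t : ℕ) : Measurable (escWeight i t) :=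
  (measurable_const.fun_div ((measurable_esc.const_mul i).const_add 1)).pow_const t

theorem ret_pow_le {i s : ℝ≥0} (t : ℕ) {ω : Env} (h : MarksIn i s ω) {l : ℕ}
    (hl : l < (ω []).1) : ret ω ^ t ≤ escWeight i t (subEnv [l] ω) := by
  refine pow_le_pow_left₀ zero_le ?_ t
  rw [ret]
  have : i * esc (subEnv [l] ω) ≤ escSum ω :=
    (mul_le_mul_left (h [l]).1 _).trans (Finset.single_le_sum
      (f := fun l => (ω [l]).2 * esc (subEnv [l] ω)) (fun _ _ => zero_le) (Finset.mem_range.2 hl))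
  gcongr

/-- The label of a sibling of the child `j`. -/
def sibling (j : ℕ) : ℕ := if j = 0 then 1 else 0

theorem sibling_ne (j : ℕ) : j ≠ sibling j := by unfold sibling; split_ifs <;> omega

/-- An upper bound for the sum of the `t`-th powers of the products of the return probabilities
along the paths of length `M`. -/
noncomputable def retMass (i : ℝ≥0) (t : ℕ) : ℕ → Env → ℝ≥0∞
  | 0, _ => 1
  | M + 1, ω => ∑ j ∈ Finset.range (ω []).1,
      (if (ω []).1 = 1 then 1 else (escWeight i t (subEnv [sibling j] ω) : ℝ≥0∞)) *
        retMass i t M (subEnv [j] ω)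

theorem measurable_retMass (i : ℝ≥0) (t M : ℕ) : Measurable (retMass i t M) := by
  induction M with
  | zero => exact measurable_const
  | succ M ih =>
    refine measurable_of_numChildren [] (fun k ω => ∑ j ∈ Finset.range k,
      (if k = 1 then 1 else (escWeight i t (subEnv [sibling j] ω) : ℝ≥0∞)) *
        retMass i t M (subEnv [j] ω)) fun k => ?_
    refine Finset.measurable_fun_sum _ fun j _ => Measurable.fun_mul ?_
      (ih.comp (measurable_subEnv _))
    split_ifs
    · exact measurable_const
    · exact ((measurable_escWeight i t).comp (measurable_subEnv _)).coe_nnreal_ennreal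

theorem AgreeButMark.retMass_eq {ω ω' : Env} (h : AgreeButMark ω ω') (i : ℝ≥0) (t M : ℕ) :
    retMass i t M ω = retMass i t M ω' := by
  cases M with
  | zero => rfl
  | succ M => simp only [retMass, h.1, h.subEnv_eq]

/-- At a branching vertex the return probability is bounded through a child off the path. That
factor is then independent of everything further along the path, which a bound through the child on
the path would not give. At a vertex with one child the factor is bounded by 1. -/
theorem retBelow_pow_le {i s : ℝ≥0} (t M : ℕ) {ω : Env} (h : MarksIn i s ω) {w : List ℕ}
    (hw : w.length = M) (hv : IsVertex ω w) : ((retBelow ω w ^ t : ℝ≥0) : ℝ≥0∞) ≤ retMass i t M ω := by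
  induction M generalizing ω w with
  | zero =>
    rw [retMass]
    exact_mod_cast pow_le_one' (retBelow_le_one _ _) t
  | succ M ih =>
    obtain ⟨w, j, rfl⟩ : ∃ w' j, w = w' ++ [j] := by
      rcases List.eq_nil_or_concat w with rfl | ⟨w', j, rfl⟩
      · simp at hw
      · exact ⟨w', j, List.concat_eq_append⟩
    rw [isVertex_append_singleton] at hv
    rw [retBelow_append_singleton, mul_pow, ENNReal.coe_mul, retMass]
    refine le_trans ?_ (Finset.single_le_sum (f := fun j =>
      (if (ω []).1 = 1 then 1 else (escWeight i t (subEnv [sibling j] ω) : ℝ≥0∞)) *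
        retMass i t M (subEnv [j] ω)) (fun _ _ => zero_le) (Finset.mem_range.2 hv.1))
    refine mul_le_mul' ?_ (ih (h.subEnv [j]) (by simpa using hw) hv.2)
    split_ifs with h1
    · exact_mod_cast pow_le_one' (ret_le_one _) t
    · have : sibling j < (ω []).1 := by unfold sibling; split_ifs <;> omega
      exact_mod_cast ret_pow_le t h this

section

variable (q : PMF ℕ) (ρ : Measure ℝ≥0) [IsProbabilityMeasure ρ]

theorem lintegral_mul_subEnv (k : ℕ) {i l : ℕ} {f g : Env → ℝ≥0∞} (hf : Measurable f)
    (hg : Measurable g) (hil : i ≠ l) :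
    ∫⁻ ω, (if (ω []).1 = k then 1 else 0) * (f (subEnv [i] ω) * g (subEnv [l] ω)) ∂envLaw q ρ =
      q k * ((∫⁻ ω, f ω ∂envLaw q ρ) * ∫⁻ ω, g ω ∂envLaw q ρ) := by
  have hprod : ∀ (a b : ℕ → ℝ≥0∞), ∏ j ∈ Finset.range (max i l + 1),
      (if j = i then a j else if j = l then b j else 1) = a i * b l := by
    intro a b
    have : ∀ j, (if j = i then a j else if j = l then b j else 1) =
        (if j = i then a j else 1) * (if j = l then b j else 1) := by
      intro j
      by_cases h : j = i
      · subst h; simp [hil]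
      · simp [h]
    simp only [this]
    rw [Finset.prod_mul_distrib, Finset.prod_ite_eq', Finset.prod_ite_eq', if_pos, if_pos]
    · rw [Finset.mem_range]; omega
    · rw [Finset.mem_range]; omega
  have h := lintegral_prod_subEnv q ρ k (max i l + 1)
    (f := fun j ω => if j = i then f ω else if j = l then g ω else 1)
    (fun j => by split_ifs; exacts [hf, hg, measurable_const])
  have hI : ∀ j, ∫⁻ ω, (if j = i then f ω else if j = l then g ω else 1) ∂envLaw q ρ =
      if j = i then ∫⁻ ω, f ω ∂envLaw q ρ else if j = l then ∫⁻ ω, g ω ∂envLaw q ρ else 1 := by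
    intro j; split_ifs <;> simp
  simp only [hI] at h
  rw [hprod] at h
  rw [← h]
  refine lintegral_congr fun ω => ?_
  rw [hprod (fun j => f (subEnv [j] ω)) fun j => g (subEnv [j] ω)]

/-- Per generation, a vertex with one child contributes q₁; otherwise each child contributes the
mean of the sibling's weight times the mean of the remaining mass, by independence of the two
subtrees. -/
theorem lintegral_retMass_le (i : ℝ≥0) (t M : ℕ) :
    ∫⁻ ω, retMass i t M ω ∂envLaw q ρ ≤
      (q 1 + offspringMean q * ∫⁻ ω, (escWeight i t ω : ℝ≥0∞) ∂envLaw q ρ) ^ M := by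
  induction M with
  | zero => simp [retMass]
  | succ M ih =>
    set ε := ∫⁻ ω, (escWeight i t ω : ℝ≥0∞) ∂envLaw q ρ with hε
    set Y := ∫⁻ ω, retMass i t M ω ∂envLaw q ρ
    have hw : Measurable fun ω => (escWeight i t ω : ℝ≥0∞) :=
      (measurable_escWeight i t).coe_nnreal_ennreal
    have hY := measurable_retMass i t M
    have hw' : ∀ j, Measurable fun ω => (escWeight i t (subEnv [j] ω) : ℝ≥0∞) :=
      fun j => hw.comp (measurable_subEnv _)
    have hY' : ∀ j, Measurable fun ω => retMass i t M (subEnv [j] ω) :=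
      fun j => hY.comp (measurable_subEnv _)
    have hterm : ∀ (k j : ℕ), Measurable fun ω => (if k = 1 then 1 else
        (escWeight i t (subEnv [sibling j] ω) : ℝ≥0∞)) * retMass i t M (subEnv [j] ω) := by
      intro k j
      refine Measurable.fun_mul ?_ (hY' j)
      split_ifs
      exacts [measurable_const, hw' _]
    have hkey : ∫⁻ ω, retMass i t (M + 1) ω ∂envLaw q ρ =
        ∑' k, q k * (k * ((if k = 1 then 1 else ε) * Y)) := by
      simp only [retMass]
      rw [lintegral_numChildren q ρ (f := fun k ω => ∑ j ∈ Finset.range k,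
        (if k = 1 then 1 else (escWeight i t (subEnv [sibling j] ω) : ℝ≥0∞)) *
          retMass i t M (subEnv [j] ω)) fun k => Finset.measurable_fun_sum _ fun j _ => hterm k j]
      refine tsum_congr fun k => ?_
      simp only [Finset.mul_sum]
      rw [lintegral_finsetSum _ fun j _ => (measurable_ite_numChildren [] k).fun_mul (hterm k j)]
      have : ∀ j, ∫⁻ ω, (if (ω []).1 = k then 1 else 0) * ((if k = 1 then 1 else
          (escWeight i t (subEnv [sibling j] ω) : ℝ≥0∞)) * retMass i t M (subEnv [j] ω)) ∂envLaw q ρ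
          = q k * ((if k = 1 then 1 else ε) * Y) := by
        intro j
        by_cases hk : k = 1
        · simp only [hk, if_true, one_mul]
          exact lintegral_single q ρ 1 j hY
        · simp only [hk, if_false]
          exact lintegral_mul_subEnv q ρ k hw hY (sibling_ne j).symm
      simp only [this, Finset.sum_const, Finset.card_range, nsmul_eq_mul]
      ring
    rw [hkey, pow_succ']
    refine le_trans ?_ (mul_le_mul_right ih _)
    have h1 : ∑' k : ℕ, (if k = 1 then q 1 * Y else 0) = q 1 * Y := tsum_ite_eq 1 fun _ => q 1 * Y
    rw [add_mul, ← h1, offspringMean, mul_assoc, ← ENNReal.tsum_mul_right, ← ENNReal.tsum_add]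
    refine ENNReal.tsum_le_tsum fun k => ?_
    by_cases hk : k = 1
    · subst hk; simp
    · simp only [hk, if_false, zero_add]
      exact le_of_eq (by ring)

/-- The base of the power is almost surely less than 1, and uniformly so outside an event of small
probability. The requirement `2 ≤ t` makes `t` a Hölder exponent greater than 1. -/
theorem exists_escWeight_small (hesc : ∀ᵐ ω ∂envLaw q ρ, 0 < esc ω) {i : ℝ≥0} (hi : 0 < i)
    {δ : ℝ≥0∞} (hδ : 0 < δ) :
    ∃ t : ℕ, 2 ≤ t ∧ ∫⁻ ω, (escWeight i t ω : ℝ≥0∞) ∂envLaw q ρ ≤ δ := by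
  obtain ⟨b, hb, hbP⟩ := exists_measure_esc_lt_le q ρ hesc (ENNReal.half_pos hδ.ne')
  have hlt : (1 / (1 + i * b) : ℝ≥0) < 1 := by
    rw [div_lt_one (by positivity)]
    exact lt_add_of_pos_right _ (by positivity)
  have htend : Tendsto (fun t : ℕ => (((1 / (1 + i * b) : ℝ≥0) : ℝ≥0∞)) ^ t) atTop (nhds 0) :=
    ENNReal.tendsto_pow_atTop_nhds_zero_of_lt_one (by exact_mod_cast hlt)
  obtain ⟨t, ht2, ht⟩ := ((eventually_ge_atTop 2).and
    (htend.eventually (gt_mem_nhds (ENNReal.half_pos hδ.ne')))).exists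
  refine ⟨t, ht2, ?_⟩
  have hle : ∀ ω, (escWeight i t ω : ℝ≥0∞) ≤ {ω | esc ω < b}.indicator 1 ω +
      (((1 / (1 + i * b) : ℝ≥0) : ℝ≥0∞)) ^ t := by
    intro ω
    by_cases h : esc ω < b
    · refine le_add_of_le_left ?_
      rw [Set.indicator_of_mem (show ω ∈ {ω | esc ω < b} from h), Pi.one_apply]
      refine ENNReal.coe_le_one_iff.2 (pow_le_one' ?_ t)
      exact div_le_one_of_le₀ le_self_add zero_le
    · refine le_add_of_le_right ?_
      rw [not_lt] at h
      rw [← ENNReal.coe_pow]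
      refine ENNReal.coe_le_coe.2 (pow_le_pow_left₀ zero_le ?_ t)
      gcongr
  have hms : MeasurableSet {ω | esc ω < b} := measurable_esc measurableSet_Iio
  refine (lintegral_mono hle).trans ?_
  rw [lintegral_add_right _ measurable_const, lintegral_indicator_one hms, lintegral_const, measure_univ,
    mul_one]
  exact (add_le_add hbP ht.le).trans (ENNReal.add_halves δ).le

/-- The return probabilities from depth `M` are bounded by a random variable whose mean decays
exponentially fast in `M`. -/
theorem exists_deepReturn_bound {i s : ℝ≥0} (hi : 0 < i) (hρ : ∀ᵐ a ∂ρ, i ≤ a ∧ a ≤ s)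
    (h1 : q 1 < 1) (hm : offspringMean q < ⊤) (hesc : ∀ᵐ ω ∂envLaw q ρ, 0 < esc ω) :
    ∃ (κ : ℝ≥0∞) (R : ℕ → Env → ℝ≥0∞), κ < 1 ∧ (∀ M, Measurable (R M)) ∧
      (∀ M ω ω', AgreeButMark ω ω' → R M ω = R M ω') ∧
      (∀ M, ∫⁻ ω, R M ω ∂envLaw q ρ ≤ κ ^ M) ∧
      ∀ᵐ ω ∂envLaw q ρ, ∀ M x, quenchedLaw ω (word x) (deepReturn x.length M) ≤
        R M (subEnv x ω) := by
  obtain ⟨δ, hδ, hδ1⟩ : ∃ δ : ℝ≥0∞, 0 < δ ∧ q 1 + offspringMean q * δ < 1 := by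
    have ht : Tendsto (fun δ : ℝ≥0∞ => q 1 + offspringMean q * δ) (nhdsWithin 0 (Set.Ioi 0))
        (nhds (q 1 + offspringMean q * 0)) :=
      (((ENNReal.continuous_const_mul hm.ne).const_add _).tendsto 0).mono_left inf_le_left
    rw [mul_zero, add_zero] at ht
    obtain ⟨δ, h, h'⟩ := ((ht.eventually (gt_mem_nhds h1)).and self_mem_nhdsWithin).exists
    exact ⟨δ, h', h⟩
  obtain ⟨t, ht2, ht⟩ := exists_escWeight_small q ρ hesc hi hδ
  set κ := q 1 + offspringMean q * ∫⁻ ω, (escWeight i t ω : ℝ≥0∞) ∂envLaw q ρ with hκ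
  have hκ1 : κ < 1 := lt_of_le_of_lt (add_le_add_right (mul_le_mul_right ht _) _) hδ1
  have ht0 : (0 : ℝ) < 1 / t := by positivity
  have ht1 : (1 : ℝ) < t := by exact_mod_cast ht2
  -- The maximum over paths is at most the t-th root of the sum of the t-th powers; Hölder against
  -- the constant 1 then moves the root outside the expectation.
  refine ⟨κ ^ (1 / t : ℝ), fun M ω => retMass i t M ω ^ (1 / t : ℝ),
    ENNReal.rpow_lt_one hκ1 ht0, fun M => (measurable_retMass i t M).pow_const _,
    fun M ω ω' h => by simp only [h.retMass_eq], fun M => ?_, ?_⟩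
  · have hH := ENNReal.lintegral_mul_le_Lp_mul_Lq (envLaw q ρ) (p := t) (q := Real.conjExponent t)
      (Real.HolderConjugate.conjExponent ht1)
      (f := fun ω => retMass i t M ω ^ (1 / t : ℝ)) (g := fun _ => 1)
      ((measurable_retMass i t M).pow_const _).aemeasurable aemeasurable_const
    simp only [Pi.mul_apply, mul_one, ENNReal.one_rpow, lintegral_const, measure_univ] at hH
    refine hH.trans ?_
    rw [← ENNReal.rpow_natCast, ← ENNReal.rpow_mul, mul_comm, ENNReal.rpow_mul,
      ENNReal.rpow_natCast]
    refine ENNReal.rpow_le_rpow ?_ ht0.le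
    refine le_trans (le_of_eq (lintegral_congr fun ω => ?_)) (lintegral_retMass_le q ρ i t M)
    rw [← ENNReal.rpow_mul, one_div, inv_mul_cancel₀ (by positivity), ENNReal.rpow_one]
  · filter_upwards [ae_marksIn q hρ] with ω hω M x
    by_cases hx : retMass i t M (subEnv x ω) = ⊤
    · rw [hx, ENNReal.top_rpow_of_pos ht0]; exact le_top
    obtain ⟨y, hy⟩ : ∃ y : ℝ≥0, (y : ℝ≥0∞) = retMass i t M (subEnv x ω) :=
      ⟨_, ENNReal.coe_toNNReal hx⟩
    rw [← hy, ← ENNReal.coe_rpow_of_nonneg _ ht0.le]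
    refine quenchedLaw_deepReturn_le ω x M _ fun w hw hv => ?_
    have := retBelow_pow_le t M (hω.subEnv x) hw hv
    rw [← hy, ENNReal.coe_le_coe] at this
    refine ENNReal.coe_le_coe.2 ?_
    calc retBelow (subEnv x ω) w = (retBelow (subEnv x ω) w ^ t) ^ (1 / t : ℝ) := by
          rw [← NNReal.rpow_natCast, ← NNReal.rpow_mul, mul_one_div_cancel (by positivity),
            NNReal.rpow_one]
      _ ≤ _ := NNReal.rpow_le_rpow this ht0.le

end

end RWRE

namespace RWRE

/-! ### The walk does not stay long in a slab -/

/-- The walk stays in generations `0, …, L - 1` up to time `n`. -/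
def confined (n L : ℕ) : Set (ℕ → Vertex) := {X | ∀ k ≤ n, 0 ≤ gen (X k) ∧ gen (X k) < L}

theorem dependsUpTo_confined (n L : ℕ) : DependsUpTo n (confined n L) := by
  intro X X' h hX k hk
  rw [← h k hk]; exact hX k hk

/-- As long as the walk stays in the slab, `G` decreases in mean by the factor `c` at each step, and
it is at least 1 there. -/
theorem quenchedLaw_confined_le (ω : Env) (L : ℕ) (G : Vertex → ℝ≥0) (c : ℝ≥0)
    (hG : ∀ x, IsVertex ω x → x.length < L → 1 ≤ G (word x) ∧
      ∑' z, transProb ω (word x) z * G z ≤ c * G (word x)) (n : ℕ) (x : List ℕ)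
    (hx : IsVertex ω x) : quenchedLaw ω (word x) (confined n L) ≤ c ^ n * G (word x) := by
  have hout : ∀ n z, ¬ (0 ≤ gen z ∧ gen z < L) → quenchedLaw ω z (confined n L) = 0 := by
    intro n z hz
    refine measure_mono_null ?_ (quenchedLaw_start ω z)
    intro X hX h0
    exact hz (h0 ▸ hX 0 (Nat.zero_le _))
  induction n generalizing x with
  | zero =>
    by_cases hL : x.length < L
    · rw [pow_zero, one_mul]
      exact prob_le_one.trans (by exact_mod_cast (hG x hx hL).1)
    · rw [hout]
      · exact zero_le
      · simpa [gen, word] using hL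
  | succ n ih =>
    by_cases hL : x.length < L
    · refine (quenchedLaw_le_step ω _ (E := confined (n + 1) L) (E' := confined n L)
        (dependsUpTo_confined n L).measurableSet
        (fun X hX _ k hk => hX (1 + k) (by omega))).trans ?_
      calc ∑' z, transProb ω (word x) z * quenchedLaw ω z (confined n L)
          ≤ ∑' z, c ^ n * (transProb ω (word x) z * G z) := by
            refine ENNReal.tsum_le_tsum fun z => ?_
            by_cases hz : transProb ω (word x) z = 0
            · simp [hz]
            rw [mul_left_comm]
            refine mul_le_mul_right ?_ _
            rcases transProb_word_ne_zero hz with rfl | ⟨i, hi, rfl⟩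
            · cases x with
              | nil => rw [hout]; exacts [zero_le, by simp [wordParent, rootParent, gen]]
              | cons i x => exact ih x hx.1
            · exact ih (i :: x) ⟨hx, hi⟩
        _ ≤ _ := by
            rw [ENNReal.tsum_mul_left, pow_succ, mul_assoc]
            exact mul_le_mul_right (hG x hx hL).2 _
    · rw [hout]
      · exact zero_le
      · simpa [gen, word] using hL

/-- The sum of `u` along the ancestors of a word, including the word itself. -/
def pathSum (u : List ℕ → ℝ) : List ℕ → ℝ
  | [] => u []
  | i :: y => u (i :: y) + pathSum u y

/-- `pathSum`, extended to all vertices. -/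
def pathSumVertex (u : List ℕ → ℝ) : Vertex → ℝ
  | none => 0
  | some y => pathSum u y

theorem abs_pathSum_le {ω : Env} {u : List ℕ → ℝ} {U : ℝ} {L : ℕ}
    (hu : ∀ x, IsVertex ω x → x.length ≤ L → |u x| ≤ U) {x : List ℕ} (hx : IsVertex ω x)
    (hL : x.length ≤ L) : |pathSum u x| ≤ (x.length + 1) * U := by
  induction x with
  | nil => simpa [pathSum] using hu [] hx hL
  | cons i x ih =>
    simp only [List.length_cons] at hL
    refine (abs_add_le _ _).trans ((add_le_add (hu _ hx (by simpa using hL))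
      (ih hx.1 (by omega))).trans (le_of_eq ?_))
    push_cast [List.length_cons]; ring

/-- A drift condition bounds the time spent in a slab. -/
theorem quenchedLaw_confined_le_of_drift (ω : Env) {L : ℕ} {U : ℝ} (hU : 1 ≤ U)
    (u : List ℕ → ℝ) (hu : ∀ x, IsVertex ω x → x.length ≤ L → |u x| ≤ U)
    (hdrift : ∀ x, IsVertex ω x → x.length < L →
      u x + 1 ≤ ∑ j ∈ Finset.range (ω x).1, ((ω (j :: x)).2 : ℝ) * (u (j :: x) - 1)) (n : ℕ) :
    quenchedLaw ω root (confined n L) ≤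
      ENNReal.ofReal (2 * ((L + 1) * U) * Real.exp (-(n / (2 * ((L + 1) * U))))) := by
  set B : ℝ := (L + 1) * U with hB
  have hB1 : 1 ≤ B := by
    rw [hB]
    nlinarith [(Nat.cast_nonneg L : (0 : ℝ) ≤ L)]
  have habs : ∀ x, IsVertex ω x → x.length ≤ L → |pathSum u x| ≤ B := by
    intro x hx hL
    refine (abs_pathSum_le hu hx hL).trans ?_
    have : (x.length : ℝ) ≤ L := by exact_mod_cast hL
    rw [hB]; gcongr
  -- A step up from `x` adds `u x` to `G`, a step down to a child subtracts the value of `u` at the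
  -- child, so the drift condition says that `G` loses at least 1 in mean. As `G ≤ 2 * B`, this is a
  -- loss by the factor `1 - 1 / (2 * B)`. The value `B` at the parent of the root makes this hold
  -- at the root too.
  set G : Vertex → ℝ≥0 := fun z => (B - pathSumVertex u z).toNNReal with hGdef
  have hGx : ∀ x, IsVertex ω x → x.length ≤ L → (G (word x) : ℝ) = B - pathSum u x := by
    intro x hx hL
    have := abs_le.1 (habs x hx hL)
    exact Real.coe_toNNReal _ (by simp only [pathSumVertex, word]; linarith)
  have hGp : ∀ x, IsVertex ω x → x.length ≤ L →
      (G (wordParent x) : ℝ) = B - pathSum u x + u x := by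
    intro x hx hL
    cases x with
    | nil =>
      have : (G (wordParent []) : ℝ) = B - 0 := Real.coe_toNNReal _ (by
        simp only [pathSumVertex, wordParent, rootParent]; linarith)
      rw [this, pathSum]; ring
    | cons i x =>
      simp only [List.length_cons] at hL
      rw [wordParent, hGx x hx.1 (by omega), pathSum]; ring
  set c : ℝ≥0 := (1 - 1 / (2 * B)).toNNReal with hc
  have hcr : (c : ℝ) = 1 - 1 / (2 * B) := by
    refine Real.coe_toNNReal _ ?_
    rw [sub_nonneg, div_le_one (by positivity)]; linarith
  have hmain : ∀ x, IsVertex ω x → x.length < L → 1 ≤ G (word x) ∧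
      ∑' z, transProb ω (word x) z * G z ≤ c * G (word x) := by
    intro x hx hL
    have hT := total_pos ω x
    have hsum : ∑' z, transProb ω (word x) z * G z =
        ((1 / total ω x * G (wordParent x) + ∑ i ∈ Finset.range (ω x).1,
          (ω (i :: x)).2 / total ω x * G (word (i :: x)) : ℝ≥0) : ℝ≥0∞) := by
      rw [tsum_transProb_mul ω x fun z => (G z : ℝ≥0∞)]
      push_cast
      rfl
    have hreal : ((1 / total ω x * G (wordParent x) + ∑ i ∈ Finset.range (ω x).1,
          (ω (i :: x)).2 / total ω x * G (word (i :: x)) : ℝ≥0) : ℝ) ≤ B - pathSum u x - 1 := by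
      push_cast
      rw [hGp x hx hL.le]
      have e : ∑ i ∈ Finset.range (ω x).1, ((ω (i :: x)).2 : ℝ) / total ω x * G (word (i :: x)) =
          (∑ i ∈ Finset.range (ω x).1, ((ω (i :: x)).2 : ℝ) *
            ((B - pathSum u x - 1) - (u (i :: x) - 1))) / total ω x := by
        rw [Finset.sum_div]
        refine Finset.sum_congr rfl fun i hi => ?_
        rw [hGx (i :: x) ⟨hx, Finset.mem_range.1 hi⟩ (by simpa using hL), pathSum]
        ring
      rw [e]
      simp only [mul_sub _ (B - pathSum u x - 1)]
      rw [Finset.sum_sub_distrib, ← Finset.sum_mul]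
      have hTr : (total ω x : ℝ) = 1 + ∑ i ∈ Finset.range (ω x).1, ((ω (i :: x)).2 : ℝ) := by
        simp [total]
      have hT' : (0 : ℝ) < total ω x := hT
      rw [one_div_mul_eq_div, ← add_div, div_le_iff₀ hT', hTr]
      linarith [hdrift x hx hL]
    have hGr := hGx x hx hL.le
    have hab := abs_le.1 (habs x hx hL.le)
    refine ⟨?_, ?_⟩
    · rw [← NNReal.coe_le_coe, hGr]
      -- The mean of `G` after one step is nonnegative and at most `G - 1`, hence `G ≥ 1`.
      have h0 := (NNReal.coe_nonneg _).trans hreal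
      push_cast; linarith
    · rw [hsum, ← ENNReal.coe_mul, ENNReal.coe_le_coe, ← NNReal.coe_le_coe]
      refine hreal.trans ?_
      rw [NNReal.coe_mul, hGr, hcr, sub_mul, one_mul]
      have : 1 / (2 * B) * (B - pathSum u x) ≤ 1 := by
        rw [one_div_mul_eq_div, div_le_one (by positivity)]; linarith
      linarith
  refine (quenchedLaw_confined_le ω L G c hmain n [] trivial).trans ?_
  rw [← ENNReal.coe_pow, ← ENNReal.coe_mul, ← ENNReal.ofReal_coe_nnreal]
  refine ENNReal.ofReal_le_ofReal ?_
  rw [NNReal.coe_mul, NNReal.coe_pow, hGx [] trivial (Nat.zero_le _), hcr, mul_comm]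
  have hab := abs_le.1 (habs [] trivial (Nat.zero_le _))
  refine mul_le_mul (by linarith) ?_ (by rw [← hcr]; positivity) (by positivity)
  have : (1 - 1 / (2 * B)) ≤ Real.exp (-(1 / (2 * B))) := by
    linarith [Real.add_one_le_exp (-(1 / (2 * B)))]
  refine (pow_le_pow_left₀ (by rw [← hcr]; positivity) this n).trans (le_of_eq ?_)
  rw [← Real.exp_nat_mul]; congr 1; ring

/-! ### From a drift off a bad event to the time spent in a slab -/

/-- The number of vertices of generation `ℓ` at which the environment is in `B`. -/
noncomputable def countAt (B : Set Env) : ℕ → Env → ℝ≥0∞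
  | 0, ω => B.indicator 1 ω
  | ℓ + 1, ω => ∑ j ∈ Finset.range (ω []).1, countAt B ℓ (subEnv [j] ω)

theorem measurable_countAt {B : Set Env} (hB : MeasurableSet B) (ℓ : ℕ) :
    Measurable (countAt B ℓ) := by
  induction ℓ with
  | zero => exact measurable_one.indicator hB
  | succ ℓ ih =>
    exact measurable_of_numChildren [] (fun k ω => ∑ j ∈ Finset.range k,
      countAt B ℓ (subEnv [j] ω)) fun k =>
        Finset.measurable_fun_sum _ fun j _ => ih.comp (measurable_subEnv _)

theorem one_le_countAt {B : Set Env} {ω : Env} {x : List ℕ} (hx : IsVertex ω x)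
    (h : subEnv x ω ∈ B) : 1 ≤ countAt B x.length ω := by
  obtain ⟨ℓ, hℓ⟩ : ∃ ℓ, x.length = ℓ := ⟨_, rfl⟩
  rw [hℓ]
  induction ℓ generalizing ω x with
  | zero =>
    obtain rfl := List.length_eq_zero_iff.1 hℓ
    rw [subEnv_nil] at h
    simp [countAt, h]
  | succ ℓ ih =>
    rcases List.eq_nil_or_concat x with rfl | ⟨w, j, rfl⟩
    · simp at hℓ
    rw [List.concat_eq_append] at *
    rw [isVertex_append_singleton] at hx
    rw [← subEnv_subEnv] at h
    refine (ih hx.2 h (by simpa using hℓ)).trans ?_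
    exact Finset.single_le_sum (f := fun j => countAt B ℓ (subEnv [j] ω)) (fun _ _ => zero_le)
      (Finset.mem_range.2 hx.1)

section

variable (q : PMF ℕ) (ρ : Measure ℝ≥0) [IsProbabilityMeasure ρ]

theorem lintegral_countAt {B : Set Env} (hB : MeasurableSet B) (ℓ : ℕ) :
    ∫⁻ ω, countAt B ℓ ω ∂envLaw q ρ = offspringMean q ^ ℓ * envLaw q ρ B := by
  induction ℓ with
  | zero => simp [countAt, lintegral_indicator_one hB]
  | succ ℓ ih =>
    have := lintegral_sum_children q ρ (fun _ => 1) (f := fun _ => countAt B ℓ)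
      fun _ => measurable_countAt hB ℓ
    simp only [one_mul] at this
    simp only [countAt]
    rw [this, ih, pow_succ', mul_assoc, offspringMean, ← ENNReal.tsum_mul_right]
    exact tsum_congr fun k => by ring

/-- `u` is bounded by `U` up to generation `L` and satisfies the drift condition in generations
less than `L`. -/
def IsDrift (ω : Env) (L : ℕ) (U : ℝ) (u : List ℕ → ℝ) : Prop :=
  (∀ x, IsVertex ω x → x.length ≤ L → |u x| ≤ U) ∧
    ∀ x, IsVertex ω x → x.length < L →
      u x + 1 ≤ ∑ j ∈ Finset.range (ω x).1, ((ω (j :: x)).2 : ℝ) * (u (j :: x) - 1)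

/-- Either some vertex of the first generations is bad, which costs at most the expected number of
such vertices, or the drift bound applies. -/
theorem lintegral_confined_le {B : Set Env} (hB : MeasurableSet B) {U : ℝ} (hU : 1 ≤ U) (L n : ℕ)
    (h : ∀ᵐ ω ∂envLaw q ρ, (∀ x, IsVertex ω x → x.length ≤ L → subEnv x ω ∉ B) →
      ∃ u, IsDrift ω L U u) :
    ∫⁻ ω, quenchedLaw ω root (confined n L) ∂envLaw q ρ ≤
      (∑ ℓ ∈ Finset.range (L + 1), offspringMean q ^ ℓ) * envLaw q ρ B +
      ENNReal.ofReal (2 * ((L + 1) * U) * Real.exp (-(n / (2 * ((L + 1) * U))))) := by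
  set b := ENNReal.ofReal (2 * ((L + 1) * U) * Real.exp (-(n / (2 * ((L + 1) * U)))))
  have hle : ∀ᵐ ω ∂envLaw q ρ, quenchedLaw ω root (confined n L) ≤
      ∑ ℓ ∈ Finset.range (L + 1), countAt B ℓ ω + b := by
    filter_upwards [h] with ω hω
    by_cases hg : ∀ x, IsVertex ω x → x.length ≤ L → subEnv x ω ∉ B
    · obtain ⟨u, hu⟩ := hω hg
      exact le_add_left (quenchedLaw_confined_le_of_drift ω hU u hu.1 hu.2 n)
    · push Not at hg
      obtain ⟨x, hx, hL, hxB⟩ := hg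
      refine prob_le_one.trans (le_add_right ((one_le_countAt hx hxB).trans ?_))
      exact Finset.single_le_sum (f := fun ℓ => countAt B ℓ ω) (fun _ _ => zero_le)
        (Finset.mem_range.2 (by omega))
  refine (lintegral_mono_ae hle).trans (le_of_eq ?_)
  rw [lintegral_add_right _ measurable_const,
    lintegral_finsetSum _ fun ℓ _ => measurable_countAt hB ℓ]
  simp only [lintegral_countAt q ρ hB, lintegral_const, measure_univ, mul_one, Finset.sum_mul]

end

/-! ### Asymptotics -/

theorem eventually_mul_rpow_le (C : ℝ) {a b : ℝ} (hab : a < b) :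
    ∀ᶠ n : ℕ in atTop, C * (n : ℝ) ^ a ≤ (n : ℝ) ^ b := by
  have h := ((tendsto_rpow_atTop (sub_pos.2 hab)).comp
    (tendsto_natCast_atTop_atTop (R := ℝ))).eventually_ge_atTop C
  filter_upwards [h, eventually_gt_atTop 0] with n hn hn0
  have hn' : (0 : ℝ) < n := by exact_mod_cast hn0
  have e : (n : ℝ) ^ b = (n : ℝ) ^ (b - a) * (n : ℝ) ^ a := by
    rw [← Real.rpow_add hn']; congr 1; ring
  rw [e]
  exact mul_le_mul_of_nonneg_right hn (by positivity)

section

variable (q : PMF ℕ) (ρ : Measure ℝ≥0) [IsProbabilityMeasure ρ]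

/-- For `L` at most n^δ with δ < γ, the number of vertices, of order m^L, is beaten by the bad-event
probability exp(-n^γ). The drift bound has the time scale 2(L+1)U, at most n^(1/2) because 1/8 + 1/4
< 1/2. -/
theorem exists_confined_le_of_drift (hm1 : 1 ≤ offspringMean q) (hm : offspringMean q < ⊤)
    {γ : ℝ} (hγ : 0 < γ)
    (h : ∀ᶠ n : ℕ in atTop, ∃ (B : Set Env) (U : ℝ), MeasurableSet B ∧ 1 ≤ U ∧
      U ≤ (n : ℝ) ^ (1 / 4 : ℝ) ∧ envLaw q ρ B ≤ ENNReal.ofReal (Real.exp (-(n : ℝ) ^ γ)) ∧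
      ∀ L : ℕ, ∀ᵐ ω ∂envLaw q ρ, (∀ x, IsVertex ω x → x.length ≤ L → subEnv x ω ∉ B) →
        ∃ u, IsDrift ω L U u) :
    ∃ δ : ℝ, 0 < δ ∧ δ ≤ 1 / 8 ∧ ∀ᶠ n : ℕ in atTop, ∀ L : ℕ, (L : ℝ) ≤ (n : ℝ) ^ δ →
      ∫⁻ ω, quenchedLaw ω root (confined n L) ∂envLaw q ρ ≤
        ENNReal.ofReal (Real.exp (-(n : ℝ) ^ δ)) := by
  obtain ⟨m, hm'⟩ : ∃ m : ℝ≥0, (m : ℝ≥0∞) = offspringMean q := ⟨_, ENNReal.coe_toNNReal hm.ne⟩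
  rw [← hm'] at hm1
  have hm1' : (1 : ℝ) ≤ m := by exact_mod_cast hm1
  set δ : ℝ := min (γ / 2) (1 / 8) with hδ
  have hδ0 : 0 < δ := by positivity
  have hδγ : δ < γ := (min_le_left _ _).trans_lt (by linarith)
  have hδ8 : δ ≤ 1 / 8 := min_le_right _ _
  refine ⟨δ, hδ0, hδ8, ?_⟩
  filter_upwards [h, eventually_mul_rpow_le (3 + Real.log m) hδγ,
    eventually_mul_rpow_le 4 (show (3 / 8 : ℝ) < 1 / 2 by norm_num),
    eventually_mul_rpow_le 4 (show (1 / 4 : ℝ) < 1 / 2 by norm_num),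
    eventually_ge_atTop 1] with n ⟨B, U, hB, hU, hUn, hBn, hdr⟩ h1 h2 h3 hn1 L hL
  refine (lintegral_confined_le q ρ hB hU L n (hdr L)).trans ?_
  have hn1' : (1 : ℝ) ≤ n := by exact_mod_cast hn1
  have hn0 : (0 : ℝ) < n := by linarith
  have hx1 : 1 ≤ (n : ℝ) ^ δ := Real.one_le_rpow hn1' hδ0.le
  have hlog2 : Real.log 2 ≤ 1 := by linarith [Real.log_two_lt_d9]
  have hhalf : Real.exp (-(n : ℝ) ^ δ) =
      Real.exp (-(n : ℝ) ^ δ) / 2 + Real.exp (-(n : ℝ) ^ δ) / 2 := by ring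
  rw [hhalf, ENNReal.ofReal_add (by positivity) (by positivity)]
  have hexp_half : ∀ y : ℝ, y + 1 + (n : ℝ) ^ δ ≤ 0 → Real.exp y ≤ Real.exp (-(n : ℝ) ^ δ) / 2 := by
    intro y hy
    rw [le_div_iff₀ two_pos, mul_comm]
    calc 2 * Real.exp y ≤ Real.exp 1 * Real.exp y := by
          gcongr; linarith [Real.add_one_le_exp (1 : ℝ)]
      _ = Real.exp (1 + y) := by rw [← Real.exp_add]
      _ ≤ _ := Real.exp_le_exp.2 (by linarith)
  refine add_le_add ?_ (ENNReal.ofReal_le_ofReal ?_)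
  · have hS : ∑ ℓ ∈ Finset.range (L + 1), offspringMean q ^ ℓ ≤
        ENNReal.ofReal (Real.exp ((1 + Real.log m) * (n : ℝ) ^ δ)) := by
      rw [← hm']
      have e : ∑ ℓ ∈ Finset.range (L + 1), (m : ℝ≥0∞) ^ ℓ =
          ENNReal.ofReal (∑ ℓ ∈ Finset.range (L + 1), (m : ℝ) ^ ℓ) := by
        rw [ENNReal.ofReal_sum_of_nonneg fun _ _ => by positivity]
        refine Finset.sum_congr rfl fun ℓ _ => ?_
        rw [← NNReal.coe_pow, ENNReal.ofReal_coe_nnreal, ENNReal.coe_pow]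
      rw [e]
      refine ENNReal.ofReal_le_ofReal ?_
      calc ∑ ℓ ∈ Finset.range (L + 1), (m : ℝ) ^ ℓ ≤ ∑ ℓ ∈ Finset.range (L + 1), (m : ℝ) ^ L :=
            Finset.sum_le_sum fun ℓ hℓ => pow_le_pow_right₀ hm1'
              (by rw [Finset.mem_range] at hℓ; omega)
        _ = (L + 1) * (m : ℝ) ^ L := by simp
        _ ≤ Real.exp L * Real.exp (L * Real.log m) := by
            rw [Real.exp_nat_mul, Real.exp_log (by positivity)]
            gcongr
            exact Real.add_one_le_exp _
        _ = Real.exp ((1 + Real.log m) * L) := by rw [← Real.exp_add]; congr 1; ring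
        _ ≤ _ := by
            have := Real.log_nonneg hm1'
            gcongr
    refine (mul_le_mul' hS hBn).trans ?_
    rw [← ENNReal.ofReal_mul (by positivity), ← Real.exp_add]
    refine ENNReal.ofReal_le_ofReal (hexp_half _ ?_)
    nlinarith
  · set b : ℝ := 2 * ((L + 1) * U) with hb
    have hb1 : 1 ≤ b := by
      rw [hb]; nlinarith [(Nat.cast_nonneg L : (0 : ℝ) ≤ L)]
    have hbn : b ≤ (n : ℝ) ^ (1 / 2 : ℝ) := by
      refine le_trans ?_ h2
      have hL1 : (L : ℝ) + 1 ≤ 2 * (n : ℝ) ^ (1 / 8 : ℝ) := by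
        have : (n : ℝ) ^ δ ≤ (n : ℝ) ^ (1 / 8 : ℝ) := Real.rpow_le_rpow_of_exponent_le hn1' hδ8
        linarith
      have e : (n : ℝ) ^ (3 / 8 : ℝ) = (n : ℝ) ^ (1 / 8 : ℝ) * (n : ℝ) ^ (1 / 4 : ℝ) := by
        rw [← Real.rpow_add hn0]; norm_num
      rw [hb, e]
      have := mul_le_mul hL1 hUn (by linarith) (by positivity)
      linarith
    have hnb : (n : ℝ) ^ (1 / 2 : ℝ) ≤ n / b := by
      rw [le_div_iff₀ (by positivity)]
      calc (n : ℝ) ^ (1 / 2 : ℝ) * b ≤ (n : ℝ) ^ (1 / 2 : ℝ) * (n : ℝ) ^ (1 / 2 : ℝ) := by gcongr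
        _ = n := by rw [← Real.rpow_add hn0]; norm_num
    have hbe : b ≤ Real.exp (2 * (n : ℝ) ^ (1 / 4 : ℝ)) := by
      have h4 : (n : ℝ) ^ (1 / 4 : ℝ) ≤ Real.exp ((n : ℝ) ^ (1 / 4 : ℝ)) := by
        linarith [Real.add_one_le_exp ((n : ℝ) ^ (1 / 4 : ℝ))]
      calc b ≤ (n : ℝ) ^ (1 / 2 : ℝ) := hbn
        _ = (n : ℝ) ^ (1 / 4 : ℝ) * (n : ℝ) ^ (1 / 4 : ℝ) := by
            rw [← Real.rpow_add hn0]; norm_num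
        _ ≤ Real.exp ((n : ℝ) ^ (1 / 4 : ℝ)) * Real.exp ((n : ℝ) ^ (1 / 4 : ℝ)) := by gcongr
        _ = _ := by rw [← Real.exp_add]; congr 1; ring
    calc b * Real.exp (-(n / b)) ≤ Real.exp (2 * (n : ℝ) ^ (1 / 4 : ℝ)) *
          Real.exp (-(n : ℝ) ^ (1 / 2 : ℝ)) := by gcongr
      _ = Real.exp (2 * (n : ℝ) ^ (1 / 4 : ℝ) - (n : ℝ) ^ (1 / 2 : ℝ)) := by
          rw [← Real.exp_add]; congr 1
      _ ≤ _ := by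
          refine hexp_half _ ?_
          have : (n : ℝ) ^ δ ≤ (n : ℝ) ^ (1 / 4 : ℝ) :=
            Real.rpow_le_rpow_of_exponent_le hn1' (by linarith)
          linarith

end

end RWRE

namespace RWRE

theorem escSum_subEnv (ω : Env) (x : List ℕ) : escSum (subEnv x ω) =
    ∑ j ∈ Finset.range (ω x).1, (ω (j :: x)).2 * esc (subEnv (j :: x) ω) := by
  simp only [escSum, subEnv_singleton]; rfl

section

variable (q : PMF ℕ) (ρ : Measure ℝ≥0) [IsProbabilityMeasure ρ]

theorem ae_numChildren : ∀ᵐ ω ∂envLaw q ρ, ∀ x, q (ω x).1 ≠ 0 := by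
  rw [ae_all_iff]
  intro x
  have h : ∀ᵐ k ∂q.toMeasure, q k ≠ 0 := by
    rw [ae_iff]
    have : {k | ¬ q k ≠ 0} = {k | q k = 0} := by ext; simp
    rw [this, PMF.toMeasure_apply_eq_zero_iff _ (by measurability)]
    rw [Set.disjoint_left]
    intro k hk hk'
    exact (q.mem_support_iff k).1 hk hk'
  rw [← map_numChildren q ρ x] at h
  exact ae_of_ae_map (measurable_numChildren_word x).aemeasurable h

/-! ### Trees without vertices with a single child -/

/-- A small β forces a small S, so β is small at every child up to the factor 2/i. There are at
least two children, and they are independent. -/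
theorem measure_esc_lt_le_sq {i s : ℝ≥0} (hi : 0 < i) (hρ : ∀ᵐ a ∂ρ, i ≤ a ∧ a ≤ s)
    (h0 : q 0 = 0) (h1 : q 1 = 0) {ε : ℝ≥0} (hε : ε ≤ 1 / 2) :
    envLaw q ρ {ω | esc ω < ε} ≤ envLaw q ρ {ω | esc ω < 2 / i * ε} ^ 2 := by
  have hms : ∀ b, MeasurableSet {ω | esc ω < b} := fun b => measurable_esc measurableSet_Iio
  set f : Env → ℝ≥0∞ := {ω | esc ω < 2 / i * ε}.indicator 1 with hf
  have hfm : Measurable f := measurable_one.indicator (hms _)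
  have hprod := lintegral_prod_children q ρ (fun _ => 1) (f := fun _ _ => f) fun _ _ => hfm
  simp only [one_mul, Finset.prod_const, Finset.card_range] at hprod
  set p := envLaw q ρ {ω | esc ω < 2 / i * ε}
  have hp : ∫⁻ ω, f ω ∂envLaw q ρ = p := lintegral_indicator_one (hms _)
  have hp1 : p ≤ 1 := prob_le_one
  rw [← lintegral_indicator_one (hms ε)]
  calc ∫⁻ ω, {ω | esc ω < ε}.indicator 1 ω ∂envLaw q ρ
      ≤ ∫⁻ ω, ∏ j ∈ Finset.range (ω []).1, f (subEnv [j] ω) ∂envLaw q ρ := by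
        refine lintegral_mono_ae ?_
        filter_upwards [ae_marksIn q hρ] with ω hω
        by_cases h : esc ω < ε
        · rw [Finset.prod_eq_one]
          · exact Set.indicator_le_self' (fun _ _ => zero_le) _ |>.trans le_rfl
          intro j hj
          have hS : escSum ω < 2 * ε := by
            have hr := ret_mul ω
            have he := ret_add_esc ω
            have hes : esc ω = ret ω * escSum ω := by
              rw [mul_add, mul_one] at hr
              exact add_left_cancel (he.trans hr.symm)
            -- The bound `ε ≤ 1 / 2` is used here: then β = ret·S is at least S/2.
            have h2 : 1 / 2 ≤ ret ω := by
              rw [← NNReal.coe_le_coe]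
              have : ((ret ω + esc ω : ℝ≥0) : ℝ) = 1 := by rw [he]; rfl
              have h3 : (esc ω : ℝ) < ε := h
              have h4 : (ε : ℝ) ≤ 1 / 2 := by exact_mod_cast hε
              push_cast at this ⊢
              linarith
            calc escSum ω = 2 * (1 / 2 * escSum ω) := by ring_nf
              _ ≤ 2 * (ret ω * escSum ω) := by gcongr
              _ = 2 * esc ω := by rw [hes]
              _ < 2 * ε := by gcongr
          have hle : i * esc (subEnv [j] ω) ≤ escSum ω :=
            (mul_le_mul_left (hω [j]).1 _).trans (Finset.single_le_sum
              (f := fun l => (ω [l]).2 * esc (subEnv [l] ω)) (fun _ _ => zero_le) hj)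
          have : subEnv [j] ω ∈ {ω | esc ω < 2 / i * ε} := by
            change esc _ < _
            rw [div_mul_eq_mul_div, lt_div_iff₀ hi, mul_comm]
            exact hle.trans_lt hS
          rw [hf, Set.indicator_of_mem this, Pi.one_apply]
        · rw [Set.indicator_of_notMem (by exact h)]; exact zero_le
    _ = ∑' k, q k * p ^ k := by rw [hprod, hp]
    _ ≤ ∑' k, q k * p ^ 2 := by
        refine ENNReal.tsum_le_tsum fun k => ?_
        rcases k with _ | _ | k
        · simp [h0]
        · simp [h1]
        · exact mul_le_mul_right (pow_le_pow_right_of_le_one' hp1 (by omega)) _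
    _ = p ^ 2 := by rw [ENNReal.tsum_mul_right, q.tsum_coe, one_mul]

/-- Each generation squares the probability and divides the threshold by a constant factor: a
polynomially small threshold in n then has a stretched exponentially small probability. -/
theorem measure_esc_lt_le_pow {i s : ℝ≥0} (hi : 0 < i) (hi1 : i ≤ 1)
    (hρ : ∀ᵐ a ∂ρ, i ≤ a ∧ a ≤ s) (h0 : q 0 = 0) (h1 : q 1 = 0) {b : ℝ≥0} (hb : b ≤ 1 / 2)
    (hbP : envLaw q ρ {ω | esc ω < b} ≤ 2⁻¹) (h : ℕ) :
    envLaw q ρ {ω | esc ω < b / (2 / i) ^ h} ≤ 2⁻¹ ^ 2 ^ h := by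
  have hM : 1 ≤ 2 / i := by rw [one_le_div hi]; exact hi1.trans one_le_two
  induction h with
  | zero => simpa using hbP
  | succ h ih =>
    have hε : b / (2 / i) ^ (h + 1) ≤ 1 / 2 :=
      (div_le_self zero_le (one_le_pow₀ hM)).trans hb
    refine (measure_esc_lt_le_sq q ρ hi hρ h0 h1 hε).trans ?_
    have e : 2 / i * (b / (2 / i) ^ (h + 1)) = b / (2 / i) ^ h := by
      have : (2 / i) ≠ 0 := by positivity
      rw [pow_succ]; field_simp
    rw [e, pow_succ 2 h, pow_mul]
    exact pow_le_pow_left₀ zero_le ih 2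

/-- From β = S/(1+S) one gets S - β = βS ≥ ε², and the factor 2/ε² turns this into the gain 2 that
the drift condition asks for. -/
theorem isDrift_of_esc {ω : Env} {L : ℕ} {ε : ℝ≥0} (hε : 0 < ε) (hε1 : ε ≤ 1)
    (h : ∀ x, IsVertex ω x → x.length ≤ L → ε ≤ esc (subEnv x ω)) :
    IsDrift ω L (3 / (ε : ℝ) ^ 2) fun x => 1 + 2 / (ε : ℝ) ^ 2 * esc (subEnv x ω) := by
  have hε0 : (0 : ℝ) < ε := hε
  have hε1' : (ε : ℝ) ≤ 1 := hε1
  have hK : 1 ≤ 1 / (ε : ℝ) ^ 2 := by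
    rw [le_div_iff₀ (by positivity), one_mul]; exact pow_le_one₀ hε0.le hε1'
  refine ⟨fun x hx hL => ?_, fun x hx hL => ?_⟩
  · have h1 : (esc (subEnv x ω) : ℝ) ≤ 1 := esc_le_one _
    rw [abs_of_nonneg (by positivity)]
    have : 2 / (ε : ℝ) ^ 2 * esc (subEnv x ω) ≤ 2 / (ε : ℝ) ^ 2 * 1 := by gcongr
    have e : 3 / (ε : ℝ) ^ 2 = 1 / (ε : ℝ) ^ 2 + 2 / (ε : ℝ) ^ 2 := by ring
    linarith
  · have hb : (ε : ℝ) ≤ esc (subEnv x ω) := h x hx hL.le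
    have hS : (escSum (subEnv x ω) : ℝ) = ∑ j ∈ Finset.range (ω x).1,
        ((ω (j :: x)).2 : ℝ) * esc (subEnv (j :: x) ω) := by
      rw [escSum_subEnv]; push_cast; rfl
    have hβ : (esc (subEnv x ω) : ℝ) * (1 + escSum (subEnv x ω)) = escSum (subEnv x ω) := by
      have := esc_eq (subEnv x ω)
      rw [eq_div_iff (by positivity)] at this
      exact_mod_cast this
    have e : ∑ j ∈ Finset.range (ω x).1, ((ω (j :: x)).2 : ℝ) *
        (1 + 2 / (ε : ℝ) ^ 2 * esc (subEnv (j :: x) ω) - 1) =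
        2 / (ε : ℝ) ^ 2 * escSum (subEnv x ω) := by
      rw [hS, Finset.mul_sum]
      exact Finset.sum_congr rfl fun j _ => by ring
    rw [e]
    set β := NNReal.toReal (esc (subEnv x ω))
    set S := NNReal.toReal (escSum (subEnv x ω))
    have hS0 : 0 ≤ S := NNReal.coe_nonneg _
    have hSβ : β ≤ S := by nlinarith
    have h2 : (ε : ℝ) ^ 2 ≤ S - β := by nlinarith
    have h3 : 2 ≤ 2 / (ε : ℝ) ^ 2 * (S - β) := by
      rw [div_mul_eq_mul_div, le_div_iff₀ (by positivity)]; linarith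
    linarith

theorem exists_confined_le_of_no_single_child {i s : ℝ≥0} (hi : 0 < i) (hi1 : i < 1)
    (hρ : ∀ᵐ a ∂ρ, i ≤ a ∧ a ≤ s) (h0 : q 0 = 0) (h1 : q 1 = 0) (hm1 : 1 ≤ offspringMean q)
    (hm : offspringMean q < ⊤) (hesc : ∀ᵐ ω ∂envLaw q ρ, 0 < esc ω) :
    ∃ δ : ℝ, 0 < δ ∧ δ ≤ 1 / 8 ∧ ∀ᶠ n : ℕ in atTop, ∀ L : ℕ, (L : ℝ) ≤ (n : ℝ) ^ δ →
      ∫⁻ ω, quenchedLaw ω root (confined n L) ∂envLaw q ρ ≤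
        ENNReal.ofReal (Real.exp (-(n : ℝ) ^ δ)) := by
  obtain ⟨b', hb', hbP'⟩ := exists_measure_esc_lt_le q ρ hesc (η := 2⁻¹) (by simp)
  obtain ⟨b, hb, hb2, hbP⟩ : ∃ b : ℝ≥0, 0 < b ∧ b ≤ 1 / 2 ∧
      envLaw q ρ {ω | esc ω < b} ≤ 2⁻¹ :=
    ⟨min b' (1 / 2), by positivity, min_le_right _ _, (measure_mono (t := {ω | esc ω < b'})
      fun ω (hω : esc ω < min b' (1 / 2)) => (lt_min_iff.1 hω).1).trans hbP'⟩
  set M : ℝ≥0 := 2 / i with hM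
  have hM1 : (1 : ℝ) < M := by
    have : 1 < M := by
      rw [hM, one_lt_div hi]; exact hi1.trans one_lt_two
    exact_mod_cast this
  have hlM := Real.log_pos hM1
  have hl2 := Real.log_pos one_lt_two
  -- With h = ⌊g log n⌋ one has M^(2h) ≤ n^(1/8), so 3/ε² stays below n^(1/4), while 2^h is at least
  -- n^(g log 2)/2.
  set g : ℝ := 1 / (16 * Real.log M) with hg
  have hg0 : 0 < g := by positivity
  have hbr : (0 : ℝ) < b := hb
  refine exists_confined_le_of_drift q ρ hm1 hm (γ := g * Real.log 2 / 2) (by positivity) ?_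
  filter_upwards [eventually_mul_rpow_le (3 / (b : ℝ) ^ 2) (show (1 / 8 : ℝ) < 1 / 4 by norm_num),
    eventually_mul_rpow_le (2 / Real.log 2)
      (show g * Real.log 2 / 2 < g * Real.log 2 by linarith [mul_pos hg0 hl2]),
    eventually_ge_atTop 1] with n hn1 hn2 hn
  have hn' : (1 : ℝ) ≤ n := by exact_mod_cast hn
  have hn0 : (0 : ℝ) < n := by linarith
  have hlog := Real.log_nonneg hn'
  set h := ⌊g * Real.log n⌋₊
  have hh1 : (h : ℝ) ≤ g * Real.log n := Nat.floor_le (by positivity)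
  have hh2 : g * Real.log n < h + 1 := Nat.lt_floor_add_one _
  set ε : ℝ≥0 := b / M ^ h with hε
  have hMh : 1 ≤ M ^ h := one_le_pow₀ (by exact_mod_cast hM1.le)
  have hε1 : ε ≤ 1 := (div_le_self zero_le hMh).trans (hb2.trans (by norm_num))
  have hε0 : 0 < ε := by
    have : 0 < M ^ h := lt_of_lt_of_le one_pos hMh
    positivity
  have hε0' : (0 : ℝ) < ε := hε0
  refine ⟨{ω | esc ω < ε}, 3 / (ε : ℝ) ^ 2, measurable_esc measurableSet_Iio, ?_, ?_, ?_,
    fun L => ?_⟩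
  · rw [le_div_iff₀ (by positivity), one_mul]
    exact (pow_le_one₀ hε0'.le hε1).trans (by norm_num)
  · refine le_trans (le_of_eq ?_) ((mul_le_mul_of_nonneg_left (a := 3 / (b : ℝ) ^ 2)
      (b := ((M : ℝ) ^ h) ^ 2) (c := (n : ℝ) ^ (1 / 8 : ℝ)) ?_ (by positivity)).trans hn1)
    · rw [hε]; push_cast; field_simp
    · rw [← pow_mul, ← Real.rpow_natCast, Real.rpow_def_of_pos (by linarith),
        Real.rpow_def_of_pos hn0]
      refine Real.exp_le_exp.2 ?_
      push_cast
      have : Real.log M * (h * 2) ≤ Real.log M * (g * Real.log n * 2) := by gcongr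
      refine this.trans (le_of_eq ?_)
      rw [hg]; field_simp; ring
  · refine (measure_esc_lt_le_pow q ρ hi hi1.le hρ h0 h1 hb2 hbP h).trans ?_
    have e : (2⁻¹ : ℝ≥0∞) ^ 2 ^ h = ENNReal.ofReal ((2⁻¹ : ℝ) ^ 2 ^ h) := by
      rw [ENNReal.ofReal_pow (by norm_num), ENNReal.ofReal_inv_of_pos two_pos]; simp
    rw [e]
    refine ENNReal.ofReal_le_ofReal ?_
    rw [← Real.rpow_natCast, Real.rpow_def_of_pos (by norm_num), Real.log_inv]
    refine Real.exp_le_exp.2 ?_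
    have h2h : (n : ℝ) ^ (g * Real.log 2) / 2 ≤ ((2 ^ h : ℕ) : ℝ) := by
      push_cast
      rw [← Real.rpow_natCast, Real.rpow_def_of_pos hn0, Real.rpow_def_of_pos two_pos,
        div_le_iff₀ two_pos]
      nth_rewrite 3 [← Real.exp_log two_pos]
      rw [← Real.exp_add]
      refine Real.exp_le_exp.2 ?_
      nlinarith
    rw [div_mul_eq_mul_div, div_le_iff₀ hl2] at hn2
    nlinarith
  · filter_upwards with ω hω
    exact ⟨_, isDrift_of_esc hε0 hε1 fun x hx hL => not_lt.1 (hω x hx hL)⟩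

end

end RWRE

namespace RWRE

/-! ### Marks bounded by one -/

/-- A correction to the escape probability at the vertices most of whose children have a small
escape probability. -/
noncomputable def trapLoad (c : ℝ≥0) : ℕ → Env → ℕ
  | 0, _ => 0
  | n + 1, ω => if ∑ j ∈ Finset.range (ω []).1, esc (subEnv [j] ω) < c * (ω []).1 then
      2 + ∑ j ∈ Finset.range (ω []).1, trapLoad c n (subEnv [j] ω) else 0

theorem measurable_trapLoad (c : ℝ≥0) (n : ℕ) : Measurable (trapLoad c n) := by
  induction n with
  | zero => exact measurable_const
  | succ n ih =>
    refine measurable_of_numChildren [] (fun k ω =>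
      if ∑ j ∈ Finset.range k, esc (subEnv [j] ω) < c * k then
        2 + ∑ j ∈ Finset.range k, trapLoad c n (subEnv [j] ω) else 0) fun k => ?_
    refine Measurable.ite ?_ ?_ measurable_const
    · exact (Finset.measurable_fun_sum _ fun j _ =>
        measurable_esc.comp (measurable_subEnv _)) measurableSet_Iio
    · exact measurable_const.add (Finset.measurable_fun_sum _ fun j _ =>
        ih.comp (measurable_subEnv _))

theorem trapLoad_le_succ (c : ℝ≥0) (n : ℕ) (ω : Env) : trapLoad c n ω ≤ trapLoad c (n + 1) ω := by
  induction n generalizing ω with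
  | zero => exact Nat.zero_le _
  | succ n ih =>
    rw [trapLoad, trapLoad]
    split_ifs
    · exact Nat.add_le_add_left (Finset.sum_le_sum fun j _ => ih _) _
    · exact le_rfl

/-- If the average is below `c`, more than half of the terms are below `2 * c`, so the factors `t⁻¹`
outnumber the factors `t` by at least one. This bounds the indicator of a condition on the sum by a
product over the children, to which independence applies. -/
theorem one_le_mul_prod_ite {k : ℕ} {β : ℕ → ℝ≥0} {c t : ℝ≥0} (ht : 0 < t) (ht1 : t ≤ 1)
    (h : ∑ j ∈ Finset.range k, β j < c * k) :
    1 ≤ t * ∏ j ∈ Finset.range k, if β j < 2 * c then t⁻¹ else t := by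
  classical
  set F := (Finset.range k).filter fun j => β j < 2 * c with hF
  set F' := (Finset.range k).filter fun j => ¬ β j < 2 * c with hF'
  have hcard : F.card + F'.card = k := by
    rw [hF, hF', Finset.card_filter_add_card_filter_not, Finset.card_range]
  have h2 : (2 * c) * F'.card ≤ ∑ j ∈ Finset.range k, β j := by
    calc (2 * c) * F'.card = ∑ j ∈ F', 2 * c := by rw [Finset.sum_const, nsmul_eq_mul, mul_comm]
      _ ≤ ∑ j ∈ F', β j := Finset.sum_le_sum fun j hj => not_lt.1 (Finset.mem_filter.1 hj).2
      _ ≤ _ := Finset.sum_le_sum_of_subset (Finset.filter_subset _ _)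
  have hlt : 2 * F'.card < k := by
    have h3 : (2 * c) * F'.card < c * k := h2.trans_lt h
    have h4 : c * (2 * F'.card) < c * k := by rwa [← mul_assoc, mul_comm c]
    exact_mod_cast lt_of_mul_lt_mul_left h4 zero_le
  rw [Finset.prod_ite, Finset.prod_const, Finset.prod_const]
  change 1 ≤ t * (t⁻¹ ^ F.card * t ^ F'.card)
  have hti : 1 ≤ t⁻¹ := (one_le_inv₀ ht).2 ht1
  calc (1 : ℝ≥0) = t⁻¹ ^ (F'.card + 1) * t ^ (F'.card + 1) := by
        rw [← mul_pow, inv_mul_cancel₀ ht.ne', one_pow]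
    _ ≤ t⁻¹ ^ F.card * t ^ (F'.card + 1) := by
        gcongr
        omega
    _ = _ := by rw [pow_succ]; ring

/-! ### Exponential moments of the load -/

section

variable (q : PMF ℕ) (ρ : Measure ℝ≥0) [IsProbabilityMeasure ρ]

/-- The exponential weight of a non-vanishing load. -/
noncomputable def loadWeight (c a : ℝ≥0) (n : ℕ) (ω : Env) : ℝ≥0∞ :=
  if trapLoad c n ω = 0 then 0 else (a : ℝ≥0∞) ^ trapLoad c n ω

theorem measurable_loadWeight (c a : ℝ≥0) (n : ℕ) : Measurable (loadWeight c a n) :=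
  (measurable_of_countable fun w : ℕ => if w = 0 then 0 else (a : ℝ≥0∞) ^ w).comp
    (measurable_trapLoad c n)

theorem pow_trapLoad_le (c a : ℝ≥0) (n : ℕ) (ω : Env) :
    (a : ℝ≥0∞) ^ trapLoad c n ω ≤ 1 + loadWeight c a n ω := by
  unfold loadWeight
  split_ifs with h
  · simp [h]
  · exact le_add_self

/-- Induction on the depth. A nonzero load is 2 plus the loads of the children. An only child must
itself have a small escape probability, which is `f1`, of mean at most t². For two or more children
the condition is replaced by a product bound, with factors `f2` of mean at most 3t and a prefactor
t. The total is at most a²(pt² + 9t³). -/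
theorem lintegral_loadWeight_le {c a t : ℝ≥0} {p Φ η : ℝ≥0∞} (h0 : q 0 = 0) (hp : q 1 = p)
    (ht : 0 < t) (ht1 : 3 * t ≤ 1) (hη : envLaw q ρ {ω | esc ω < 2 * c} ≤ η)
    (hΦη : η + Φ ≤ (t : ℝ≥0∞) ^ 2) (hΦ1 : Φ ≤ 1)
    (hrec : (a : ℝ≥0∞) ^ 2 * (p * (t : ℝ≥0∞) ^ 2 + 9 * (t : ℝ≥0∞) ^ 3) ≤ Φ) (n : ℕ) :
    ∫⁻ ω, loadWeight c a n ω ∂envLaw q ρ ≤ Φ := by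
  have hms : MeasurableSet {ω | esc ω < 2 * c} := measurable_esc measurableSet_Iio
  have ht1' : t ≤ 1 := by
    refine le_trans ?_ ht1
    nth_rewrite 1 [← one_mul t]
    gcongr
    norm_num
  induction n with
  | zero => simp [loadWeight, trapLoad]
  | succ n ih =>
    set w : Env → ℝ≥0∞ := fun ω => (a : ℝ≥0∞) ^ trapLoad c n ω with hw
    have hwm : Measurable w := (measurable_of_countable fun w : ℕ => (a : ℝ≥0∞) ^ w).comp
      (measurable_trapLoad c n)
    set f1 : Env → ℝ≥0∞ := fun ω => if esc ω < 2 * c then w ω else 0 with hf1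
    have hf1m : Measurable f1 := Measurable.ite hms hwm measurable_const
    set f2 : Env → ℝ≥0∞ := fun ω => w ω * ((if esc ω < 2 * c then t⁻¹ else t : ℝ≥0) : ℝ≥0∞)
      with hf2
    have hf2m : Measurable f2 := hwm.fun_mul
      (Measurable.ite hms measurable_const measurable_const).coe_nnreal_ennreal
    have hI1 : ∫⁻ ω, f1 ω ∂envLaw q ρ ≤ (t : ℝ≥0∞) ^ 2 := by
      refine le_trans (lintegral_mono (g := fun ω => {ω | esc ω < 2 * c}.indicator 1 ω +
        loadWeight c a n ω) fun ω => ?_) ?_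
      · by_cases h : esc ω < 2 * c
        · have h' : ω ∈ {ω | esc ω < 2 * c} := h
          simp only [hf1, h, if_true, Set.indicator_of_mem h', Pi.one_apply]
          exact pow_trapLoad_le c a n ω
        · simp [hf1, h]
      · rw [lintegral_add_right _ (measurable_loadWeight c a n), lintegral_indicator_one hms]
        exact (add_le_add hη ih).trans hΦη
    have hI2 : ∫⁻ ω, f2 ω ∂envLaw q ρ ≤ 3 * t := by
      have hle : ∀ ω, f2 ω ≤ ((t⁻¹ : ℝ≥0) : ℝ≥0∞) * f1 ω + t * (1 + loadWeight c a n ω) := by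
        intro ω
        by_cases h : esc ω < 2 * c
        · simp only [hf1, hf2, h, if_true]
          rw [mul_comm]; exact le_self_add
        · simp only [hf1, hf2, h, if_false, mul_zero, zero_add]
          rw [mul_comm]
          exact mul_le_mul_right (pow_trapLoad_le c a n ω) _
      refine (lintegral_mono hle).trans ?_
      rw [lintegral_add_left (hf1m.const_mul _), lintegral_const_mul _ hf1m,
        lintegral_const_mul _ ((measurable_loadWeight c a n).const_add 1),
        lintegral_add_right _ (measurable_loadWeight c a n), lintegral_const, measure_univ, mul_one]
      have e1 : ((t⁻¹ : ℝ≥0) : ℝ≥0∞) * (t : ℝ≥0∞) ^ 2 = t := by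
        norm_cast
        rw [sq, ← mul_assoc, inv_mul_cancel₀ ht.ne', one_mul]
      calc _ ≤ ((t⁻¹ : ℝ≥0) : ℝ≥0∞) * (t : ℝ≥0∞) ^ 2 + t * (1 + 1) := by
            gcongr
            exact ih.trans hΦ1
        _ = 3 * t := by rw [e1]; ring
    set g : ℕ → ℝ≥0∞ := fun k => if k = 0 then 0 else if k = 1 then (a : ℝ≥0∞) ^ 2 else
      (a : ℝ≥0∞) ^ 2 * t with hg
    have hprod := lintegral_prod_children q ρ g (f := fun k _ => if k = 1 then f1 else f2)
      fun k _ => by split_ifs; exacts [hf1m, hf2m]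
    have hpt : ∀ ω, loadWeight c a (n + 1) ω ≤ g (ω []).1 * ∏ j ∈ Finset.range (ω []).1,
        (fun (k _ : ℕ) => if k = 1 then f1 else f2) (ω []).1 j (subEnv [j] ω) := by
      intro ω
      unfold loadWeight
      by_cases hlt : ∑ j ∈ Finset.range (ω []).1, esc (subEnv [j] ω) < c * (ω []).1
      swap
      · rw [trapLoad, if_neg hlt, if_pos rfl]; exact zero_le
      rw [trapLoad, if_pos hlt, if_neg (by omega), pow_add, ← Finset.prod_pow_eq_pow_sum]
      rcases hk : (ω []).1 with _ | _ | k
      · rw [hk] at hlt; simp at hlt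
      · rw [hk] at hlt
        simp only [zero_add, Finset.range_one, Finset.sum_singleton, Nat.cast_one, mul_one] at hlt
        have hlt' : esc (subEnv [0] ω) < 2 * c := by
          refine hlt.trans_le ?_
          nth_rewrite 1 [← one_mul c]
          gcongr
          norm_num
        simp [hg, hf1, hw, hlt']
      · rw [hk] at hlt
        have h1 := one_le_mul_prod_ite ht ht1' hlt
        have hne : k + 1 + 1 ≠ 1 := by omega
        simp only [hg, hne, if_false, hf2, Nat.add_eq_zero_iff, one_ne_zero, and_false]
        rw [Finset.prod_mul_distrib, ← ENNReal.ofNNReal_finsetProd, mul_assoc, mul_left_comm (t : ℝ≥0∞),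
          ← ENNReal.coe_mul]
        refine mul_le_mul_right ?_ _
        nth_rewrite 1 [← mul_one (∏ j ∈ Finset.range (k + 1 + 1), _)]
        exact mul_le_mul_right (by exact_mod_cast h1) _
    refine (lintegral_mono hpt).trans ?_
    rw [hprod]
    refine le_trans (le_trans (ENNReal.tsum_le_tsum (g := fun k => q k * (if k = 1 then
      (a : ℝ≥0∞) ^ 2 * (t : ℝ≥0∞) ^ 2 else (a : ℝ≥0∞) ^ 2 * (9 * (t : ℝ≥0∞) ^ 3))) fun k => ?_)
      ((le_self_add).trans (tsum_pmf_ite q _ _).le)) ?_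
    · rcases k with _ | _ | k
      · simp [h0]
      · simp only [zero_add, hg, one_ne_zero, if_false, if_true, Finset.range_one,
          Finset.prod_singleton]
        gcongr
      · have hne : k + 1 + 1 ≠ 1 := by omega
        simp only [hg, hne, if_false, Nat.add_eq_zero_iff, one_ne_zero, and_false,
          Finset.prod_const, Finset.card_range]
        have h3t : 3 * (t : ℝ≥0∞) ≤ 1 := by exact_mod_cast ht1
        have h9 : (∫⁻ ω, f2 ω ∂envLaw q ρ) ^ (k + 1 + 1) ≤ 9 * (t : ℝ≥0∞) ^ 2 :=
          calc _ ≤ (3 * (t : ℝ≥0∞)) ^ (k + 1 + 1) := pow_le_pow_left₀ zero_le hI2 _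
            _ ≤ (3 * (t : ℝ≥0∞)) ^ 2 := pow_le_pow_right_of_le_one' h3t (by omega)
            _ = _ := by ring
        refine mul_le_mul_right ?_ _
        refine (mul_le_mul_right h9 _).trans (le_of_eq (by ring))
    · rw [hp]
      refine le_trans (le_of_eq (by ring)) hrec

/-- Markov's inequality at each depth; the load increases with the depth, so the union over depths
is free. -/
theorem measure_trapLoad_gt_le {c a : ℝ≥0} (ha : 1 ≤ a)
    (h : ∀ n, ∫⁻ ω, loadWeight c a n ω ∂envLaw q ρ ≤ 1) (w : ℕ) :
    envLaw q ρ {ω | ∃ n, w < trapLoad c n ω} ≤ ((a : ℝ≥0∞) ^ w)⁻¹ := by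
  have hU : {ω | ∃ n, w < trapLoad c n ω} = ⋃ n, {ω | w < trapLoad c n ω} := by
    ext ω; simp
  rw [hU, Monotone.measure_iUnion]
  · refine iSup_le fun n => ?_
    have ha0 : (a : ℝ≥0∞) ^ w ≠ 0 := by
      have : a ≠ 0 := (lt_of_lt_of_le one_pos ha).ne'
      exact pow_ne_zero _ (by exact_mod_cast this)
    have := mul_meas_ge_le_lintegral (μ := envLaw q ρ) (measurable_loadWeight c a n)
      ((a : ℝ≥0∞) ^ w)
    rw [← one_div, ENNReal.le_div_iff_mul_le (Or.inl ha0) (Or.inl (by finiteness)), mul_comm]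
    refine le_trans (mul_le_mul_right (measure_mono fun ω (hω : w < trapLoad c n ω) => ?_) _)
      (this.trans (h n))
    change (a : ℝ≥0∞) ^ w ≤ loadWeight c a n ω
    rw [loadWeight, if_neg (by omega)]
    exact pow_le_pow_right₀ (by exact_mod_cast ha) hω.le
  · intro n n' hn ω hω
    exact lt_of_lt_of_le hω (monotone_nat_of_le_succ
      (f := fun n => trapLoad c n ω) (fun n => trapLoad_le_succ c n ω) hn)

/-- The load has an exponential tail. -/
theorem exists_trapLoad_tail (h0 : q 0 = 0) (h1 : q 1 < 1)
    (hesc : ∀ᵐ ω ∂envLaw q ρ, 0 < esc ω) :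
    ∃ c a : ℝ≥0, 0 < c ∧ 1 < a ∧
      ∀ w : ℕ, envLaw q ρ {ω | ∃ n, w < trapLoad c n ω} ≤ ((a : ℝ≥0∞) ^ w)⁻¹ := by
  obtain ⟨p, hp⟩ : ∃ p : ℝ≥0, (p : ℝ≥0∞) = q 1 := ⟨_, ENNReal.coe_toNNReal (q.apply_ne_top 1)⟩
  rw [← hp] at h1
  have hp1 : p < 1 := by exact_mod_cast h1
  obtain ⟨d, hd⟩ : ∃ d, p + d = 1 := ⟨1 - p, add_tsub_cancel_of_le hp1.le⟩
  have hd0 : 0 < d := by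
    rcases eq_or_ne d 0 with rfl | h
    · rw [add_zero] at hd; exact absurd hd hp1.ne
    · exact pos_iff_ne_zero.2 h
  have hd1 : d ≤ 1 := by rw [← hd]; exact le_add_self
  -- With d = 1 - q₁ this gives q₁t² + 9t³ = (1 - 3d/4)t². Taking a = 1 + d/16 and Φ = (1 - d/2)t²
  -- closes the recursion and leaves η = (d/2)t² for the event of a small escape probability.
  set t : ℝ≥0 := d / 36 with ht
  have ht0 : 0 < t := by positivity
  obtain ⟨b, hb, hbP⟩ := exists_measure_esc_lt_le q ρ hesc (η := ((d / 2 * t ^ 2 : ℝ≥0) : ℝ≥0∞))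
    (by positivity)
  have hdr : (p : ℝ) + d = 1 := by exact_mod_cast hd
  have hd0r : (0 : ℝ) < d := hd0
  have hd1r : (d : ℝ) ≤ 1 := hd1
  have htr : (t : ℝ) = d / 36 := by rw [ht]; push_cast; rfl
  have hsum : d / 2 * t ^ 2 + (p + d / 2) * t ^ 2 = t ^ 2 := by
    rw [← add_mul]
    have : d / 2 + (p + d / 2) = 1 := by
      rw [← hd, ← NNReal.coe_inj]; push_cast; ring
    rw [this, one_mul]
  refine ⟨b / 2, 1 + d / 16, by positivity, lt_add_of_pos_right _ (by positivity),
    measure_trapLoad_gt_le q ρ le_self_add fun n => ?_⟩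
  have hΦ1 : (((p + d / 2) * t ^ 2 : ℝ≥0) : ℝ≥0∞) ≤ 1 := by
    norm_cast
    rw [← NNReal.coe_le_coe]
    push_cast
    rw [htr]
    have hp0 : (0 : ℝ) ≤ p := NNReal.coe_nonneg _
    have h2 : ((d : ℝ) / 36) ^ 2 ≤ 1 := pow_le_one₀ (by positivity) (by linarith)
    nlinarith [sq_nonneg ((d : ℝ) / 36)]
  refine (lintegral_loadWeight_le q ρ (t := t) (p := p) (η := ((d / 2 * t ^ 2 : ℝ≥0) : ℝ≥0∞))
    (Φ := (((p + d / 2) * t ^ 2 : ℝ≥0) : ℝ≥0∞)) h0 hp.symm ht0 ?_ ?_ ?_ hΦ1 ?_ n).trans hΦ1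
  · rw [← NNReal.coe_le_coe]; push_cast; rw [htr]; linarith
  · rwa [mul_div_cancel₀ b two_ne_zero]
  · exact_mod_cast hsum.le
  · norm_cast
    rw [← NNReal.coe_le_coe]
    push_cast
    have hpr : (p : ℝ) = 1 - d := by linarith
    rw [hpr]
    have e : (1 - (d : ℝ)) * (t : ℝ) ^ 2 + 9 * (t : ℝ) ^ 3 = (1 - 3 * d / 4) * (t : ℝ) ^ 2 := by
      rw [htr]; ring
    rw [e, ← mul_assoc]
    refine mul_le_mul_of_nonneg_right ?_ (by positivity)
    nlinarith [mul_pos hd0r hd0r, mul_pos (mul_pos hd0r hd0r) hd0r]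

/-- At a loaded vertex the load is 2 more than the sum over the children; marks at most 1 do not
enlarge this sum, and S ≥ β, so the load alone pays the drift. At any other vertex with ν children S
≥ icν, hence S - β = βS is at least ν/D with D = (1+ic)/(ic)². The multiple (2+w)D of it pays both
for the drift and for the children's loads, each at most `w`. The depth `L - x.length` decreases by
one from parent to child, in step with the recursion. -/
theorem isDrift_of_trapLoad {ω : Env} {L w : ℕ} {c i s : ℝ≥0} (hi : 0 < i) (hs : s ≤ 1)
    (hc : 0 < c) (hω : MarksIn i s ω) (hν : ∀ x, 1 ≤ (ω x).1)
    (h : ∀ x, IsVertex ω x → x.length ≤ L → ∀ n, trapLoad c n (subEnv x ω) ≤ w) :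
    IsDrift ω L ((2 + w) * (1 + (1 + i * c) / (i * c) ^ 2)) fun x =>
      1 + (2 + w) * ((1 + i * c) / (i * c : ℝ) ^ 2) * esc (subEnv x ω) -
        trapLoad c (L - x.length) (subEnv x ω) := by
  have hi0 : (0 : ℝ) < i := hi
  have hc0 : (0 : ℝ) < c := hc
  set D : ℝ := (1 + i * c) / (i * c : ℝ) ^ 2 with hD
  have hD0 : 0 < D := by positivity
  have hw0 : (0 : ℝ) ≤ w := Nat.cast_nonneg _
  refine ⟨fun x hx hL => ?_, fun x hx hL => ?_⟩
  · have h1 : (esc (subEnv x ω) : ℝ) ≤ 1 := esc_le_one _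
    have h2 : (0 : ℝ) ≤ esc (subEnv x ω) := NNReal.coe_nonneg _
    have h3 : (trapLoad c (L - x.length) (subEnv x ω) : ℝ) ≤ w := by
      exact_mod_cast h x hx hL _
    have h4 : (0 : ℝ) ≤ trapLoad c (L - x.length) (subEnv x ω) := Nat.cast_nonneg _
    have h5 : (2 + w) * D * esc (subEnv x ω) ≤ (2 + w) * D * 1 := by gcongr
    have h6 : 0 ≤ (2 + w) * D * esc (subEnv x ω) := by positivity
    have h7 : 0 ≤ (2 + w) * D := by positivity
    rw [abs_le]
    constructor <;> nlinarith
  · obtain ⟨N, hN⟩ : ∃ N, L - x.length = N + 1 := ⟨L - x.length - 1, by omega⟩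
    have hN' : ∀ j, L - (j :: x).length = N := by intro j; simp only [List.length_cons]; omega
    simp only [hN, hN']
    have hS : (escSum (subEnv x ω) : ℝ) = ∑ j ∈ Finset.range (ω x).1,
        ((ω (j :: x)).2 : ℝ) * esc (subEnv (j :: x) ω) := by
      rw [escSum_subEnv]; push_cast; rfl
    have hβ : (esc (subEnv x ω) : ℝ) * (1 + escSum (subEnv x ω)) = escSum (subEnv x ω) := by
      have := esc_eq (subEnv x ω)
      rw [eq_div_iff (by positivity)] at this
      exact_mod_cast this
    have hroot : subEnv x ω [] = ω x := rfl
    have e : ∑ j ∈ Finset.range (ω x).1, ((ω (j :: x)).2 : ℝ) *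
        (1 + (2 + w) * D * esc (subEnv (j :: x) ω) - trapLoad c N (subEnv (j :: x) ω) - 1) =
        (2 + w) * D * escSum (subEnv x ω) - ∑ j ∈ Finset.range (ω x).1,
          ((ω (j :: x)).2 : ℝ) * trapLoad c N (subEnv (j :: x) ω) := by
      rw [hS, Finset.mul_sum, ← Finset.sum_sub_distrib]
      exact Finset.sum_congr rfl fun j _ => by ring
    rw [e]
    have hA : ∑ j ∈ Finset.range (ω x).1,
          ((ω (j :: x)).2 : ℝ) * trapLoad c N (subEnv (j :: x) ω) ≤
        ((∑ j ∈ Finset.range (ω x).1, trapLoad c N (subEnv (j :: x) ω) : ℕ) : ℝ) := by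
      push_cast
      refine Finset.sum_le_sum fun j _ => mul_le_of_le_one_left (Nat.cast_nonneg _) ?_
      exact_mod_cast (hω (j :: x)).2.trans hs
    have hW : trapLoad c (N + 1) (subEnv x ω) =
        if ∑ j ∈ Finset.range (ω x).1, esc (subEnv (j :: x) ω) < c * (ω x).1 then
        2 + ∑ j ∈ Finset.range (ω x).1, trapLoad c N (subEnv (j :: x) ω) else 0 := by
      simp only [trapLoad, hroot, subEnv_singleton]
    rw [hW]
    set β := NNReal.toReal (esc (subEnv x ω))
    set S := NNReal.toReal (escSum (subEnv x ω)) with hSdef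
    have hS0 : 0 ≤ S := NNReal.coe_nonneg _
    have hβ0 : 0 ≤ β := NNReal.coe_nonneg _
    have hSβ : β ≤ S := by nlinarith
    split_ifs with htype
    · have : (2 + w) * D * β ≤ (2 + w) * D * S := by gcongr
      push_cast at hA ⊢
      linarith
    · have hν1 : (1 : ℝ) ≤ (ω x).1 := by exact_mod_cast hν x
      have hsum : ((∑ j ∈ Finset.range (ω x).1, trapLoad c N (subEnv (j :: x) ω) : ℕ) : ℝ) ≤
          (ω x).1 * w := by
        have := Finset.sum_le_card_nsmul (Finset.range (ω x).1)
          (fun j => trapLoad c N (subEnv (j :: x) ω)) w fun j hj =>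
            h (j :: x) ⟨hx, Finset.mem_range.1 hj⟩ (by simpa using hL) N
        rw [Finset.card_range, smul_eq_mul] at this
        exact_mod_cast this
      have hSl : i * c * (ω x).1 ≤ S := by
        rw [not_lt] at htype
        have h1 : (c : ℝ) * (ω x).1 ≤ ∑ j ∈ Finset.range (ω x).1,
            (esc (subEnv (j :: x) ω) : ℝ) := by exact_mod_cast htype
        rw [hS]
        calc (i : ℝ) * c * (ω x).1 = i * (c * (ω x).1) := by ring
          _ ≤ i * ∑ j ∈ Finset.range (ω x).1, (esc (subEnv (j :: x) ω) : ℝ) := by gcongr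
          _ ≤ _ := by
              rw [Finset.mul_sum]
              refine Finset.sum_le_sum fun j _ => ?_
              have : (i : ℝ) ≤ (ω (j :: x)).2 := (hω (j :: x)).1
              gcongr
      set y : ℝ := i * c with hy
      have hy0 : 0 < y := by positivity
      have hyS : y ≤ S := by nlinarith
      have hyβ : y / (1 + y) ≤ β := by
        rw [div_le_iff₀ (by positivity)]
        nlinarith
      have hdiff : y ^ 2 / (1 + y) * (ω x).1 ≤ S - β := by
        have h1 : S - β = β * S := by linarith
        rw [h1]
        calc y ^ 2 / (1 + y) * (ω x).1 = (y / (1 + y)) * (y * (ω x).1) := by ring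
          _ ≤ β * S := by gcongr
      have hDy : D * (y ^ 2 / (1 + y)) = 1 := by rw [hD]; field_simp
      have h8 : (2 + w) * (ω x).1 ≤ (2 + w) * D * (S - β) := by
        calc (2 + w) * ((ω x).1 : ℝ) = (2 + w) * (D * (y ^ 2 / (1 + y))) * (ω x).1 := by
              rw [hDy, mul_one]
          _ = (2 + w) * D * (y ^ 2 / (1 + y) * (ω x).1) := by ring
          _ ≤ _ := by gcongr
      push_cast at hA hsum ⊢
      linarith

theorem exists_confined_le_of_marks_le_one {i s : ℝ≥0} (hi : 0 < i) (hs : s ≤ 1)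
    (hρ : ∀ᵐ a ∂ρ, i ≤ a ∧ a ≤ s) (h0 : q 0 = 0) (h1 : q 1 < 1) (hm1 : 1 ≤ offspringMean q)
    (hm : offspringMean q < ⊤) (hesc : ∀ᵐ ω ∂envLaw q ρ, 0 < esc ω) :
    ∃ δ : ℝ, 0 < δ ∧ δ ≤ 1 / 8 ∧ ∀ᶠ n : ℕ in atTop, ∀ L : ℕ, (L : ℝ) ≤ (n : ℝ) ^ δ →
      ∫⁻ ω, quenchedLaw ω root (confined n L) ∂envLaw q ρ ≤
        ENNReal.ofReal (Real.exp (-(n : ℝ) ^ δ)) := by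
  obtain ⟨c, a, hc, ha, htail⟩ := exists_trapLoad_tail q ρ h0 h1 hesc
  have ha1 : (1 : ℝ) < a := by exact_mod_cast ha
  have hla := Real.log_pos ha1
  set D : ℝ := (1 + i * c) / (i * c : ℝ) ^ 2 with hD
  have hi0 : (0 : ℝ) < i := hi
  have hc0 : (0 : ℝ) < c := hc
  have hD0 : 0 < D := by positivity
  refine exists_confined_le_of_drift q ρ hm1 hm (γ := 1 / 16) (by norm_num) ?_
  filter_upwards [eventually_mul_rpow_le (3 * (1 + D)) (show (1 / 8 : ℝ) < 1 / 4 by norm_num),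
    eventually_mul_rpow_le (2 / Real.log a) (show (1 / 16 : ℝ) < 1 / 8 by norm_num),
    eventually_mul_rpow_le 2 (show (0 : ℝ) < 1 / 8 by norm_num),
    eventually_ge_atTop 1] with n hn1 hn2 hn3 hn
  rw [Real.rpow_zero, mul_one] at hn3
  have hn' : (1 : ℝ) ≤ n := by exact_mod_cast hn
  -- The bound on `u` is linear in `w`, hence below n^(1/4), and the tail a^(-w) is below
  -- exp(-n^(1/16)).
  set w := ⌊(n : ℝ) ^ (1 / 8 : ℝ)⌋₊
  have hw1 : (w : ℝ) ≤ (n : ℝ) ^ (1 / 8 : ℝ) := Nat.floor_le (by positivity)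
  have hw2 : (n : ℝ) ^ (1 / 8 : ℝ) < w + 1 := Nat.lt_floor_add_one _
  have hw0 : (0 : ℝ) ≤ w := Nat.cast_nonneg _
  refine ⟨{ω | ∃ n, w < trapLoad c n ω}, (2 + w) * (1 + D), ?_, ?_, ?_, ?_, fun L => ?_⟩
  · rw [Set.ofPred_exists]
    exact MeasurableSet.iUnion fun n => measurable_trapLoad c n measurableSet_Ioi
  · nlinarith
  · refine le_trans ?_ hn1
    rw [mul_right_comm]
    gcongr
    linarith
  · refine (htail w).trans ?_
    have e : ((a : ℝ≥0∞) ^ w)⁻¹ = ENNReal.ofReal (((a : ℝ) ^ w)⁻¹) := by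
      rw [ENNReal.ofReal_inv_of_pos (by positivity), ENNReal.ofReal_pow (by positivity),
        ENNReal.ofReal_coe_nnreal]
    rw [e]
    refine ENNReal.ofReal_le_ofReal ?_
    rw [← Real.rpow_natCast, Real.rpow_def_of_pos (by linarith), ← Real.exp_neg]
    refine Real.exp_le_exp.2 (neg_le_neg ?_)
    rw [div_mul_eq_mul_div, div_le_iff₀ hla] at hn2
    nlinarith
  · filter_upwards [ae_marksIn q hρ, ae_numChildren q ρ] with ω hω hq hB
    have hν : ∀ x, 1 ≤ (ω x).1 := fun x => Nat.one_le_iff_ne_zero.2 fun h => hq x (by rw [h, h0])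
    refine ⟨_, isDrift_of_trapLoad hi hs hc hω hν fun x hx hL n => ?_⟩
    by_contra hlt
    exact hB x hx hL ⟨n, not_le.1 hlt⟩

end

end RWRE

namespace RWRE

/-! ### First visits to generations -/

/-- The walk visits generation `ℓ` for the first time at time `n`, having stayed below it. -/
def FirstHit (X : ℕ → Vertex) (n : ℕ) (ℓ : ℤ) : Prop := gen (X n) = ℓ ∧ ∀ m < n, gen (X m) < ℓ

theorem FirstHit.lt_of_lt {X : ℕ → Vertex} {m n : ℕ} {ℓ ℓ' : ℤ} (h : FirstHit X m ℓ)
    (h' : FirstHit X n ℓ') (hl : ℓ < ℓ') : m < n := by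
  by_contra hmn
  rcases (not_lt.1 hmn).eq_or_lt with rfl | hlt
  · have := h.1.symm.trans h'.1; omega
  · have := h.2 n hlt; have := h'.1; omega

theorem FirstHit.eq {X : ℕ → Vertex} {m n : ℕ} {ℓ : ℤ} (h : FirstHit X m ℓ)
    (h' : FirstHit X n ℓ) : m = n := by
  rcases lt_trichotomy m n with hlt | heq | hlt
  · have := h'.2 m hlt; have := h.1; omega
  · exact heq
  · have := h.2 n hlt; have := h'.1; omega

theorem FirstHit.congr {X X' : ℕ → Vertex} {m n : ℕ} {ℓ : ℤ} (hX : ∀ k ≤ n, X k = X' k)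
    (hm : m ≤ n) (h : FirstHit X m ℓ) : FirstHit X' m ℓ := by
  refine ⟨?_, fun k hk => ?_⟩
  · rw [← hX m hm]; exact h.1
  · rw [← hX k (by omega)]; exact h.2 k hk

theorem exists_firstHit {X : ℕ → Vertex} (h0 : gen (X 0) ≤ 0)
    (hstep : ∀ k, gen (X (k + 1)) ≤ gen (X k) + 1) {ℓ : ℤ} (hℓ : 0 ≤ ℓ) {k : ℕ}
    (hk : ℓ ≤ gen (X k)) : ∃ m ≤ k, FirstHit X m ℓ := by
  classical
  have hex : ∃ m, ℓ ≤ gen (X m) := ⟨k, hk⟩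
  refine ⟨Nat.find hex, Nat.find_min' hex hk, le_antisymm ?_ (Nat.find_spec hex),
    fun m hm => not_le.1 (Nat.find_min hex hm)⟩
  rcases h : Nat.find hex with _ | m
  · exact h0.trans hℓ
  · have := Nat.find_min hex (m := m) (by omega)
    have := hstep m
    omega

/-- The data on which the transitions from the generations less than `ℓ` depend. -/
def upTo (ℓ : ℕ) : Set (List ℕ × Bool) :=
  {p | (p.2 = true ∧ p.1.length < ℓ) ∨ (p.2 = false ∧ p.1.length ≤ ℓ)}

/-- The mark of `x` is counted with the past, since it governs the step from the parent to `x`. All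
other data at and below `x` are fresh when the walk arrives there. -/
theorem disjoint_upTo_strictBelow {ℓ : ℕ} {x : List ℕ} (hx : x.length = ℓ) :
    Disjoint (upTo ℓ) (strictBelow x) := by
  rw [Set.disjoint_left]
  rintro ⟨y, b⟩ hy ⟨⟨u, hu⟩, hne⟩
  have hlen : y.length = u.length + ℓ := by rw [← hx, ← List.length_append, hu]
  rcases hy with ⟨-, h⟩ | ⟨hb, h⟩
  · simp only at h; omega
  · simp only at h hb
    have hu0 : u.length = 0 := by omega
    rw [List.length_eq_zero_iff] at hu0
    subst hu0
    rw [List.nil_append] at hu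
    exact hne (by simp [hu, hb])

theorem numChildren_reveal_upTo {ℓ : ℕ} {z : Vertex} (h : gen z < ℓ) (ω : Env) :
    numChildren (reveal (upTo ℓ) ω) z = numChildren ω z := by
  rcases z with _ | x
  · rfl
  · have : x.length < ℓ := by simpa [gen] using h
    exact reveal_fst (Or.inl ⟨rfl, this⟩) ω

theorem transProb_reveal_upTo {ℓ : ℕ} {y : Vertex} (h : gen y < ℓ) (ω : Env) (z : Vertex) :
    transProb (reveal (upTo ℓ) ω) y z = transProb ω y z := by
  rcases y with _ | x
  · rfl
  · have hx : x.length < ℓ := by simpa [gen] using h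
    have h1 : (reveal (upTo ℓ) ω x).1 = (ω x).1 := reveal_fst (Or.inl ⟨rfl, hx⟩) ω
    have h2 : ∀ i, (reveal (upTo ℓ) ω (i :: x)).2 = (ω (i :: x)).2 := fun i =>
      reveal_snd (Or.inr ⟨rfl, by simpa using hx⟩) ω
    have h3 : total (reveal (upTo ℓ) ω) x = total ω x := by simp only [total, h1, h2]
    simp only [transProb, h1, h2, h3]

theorem quenchedLaw_reveal_upTo {ℓ n : ℕ} {F : Set (ℕ → Vertex)} (hF : DependsUpTo n F)
    (h : ∀ X ∈ F, ∀ m < n, gen (X m) < ℓ) (ω : Env) (y : Vertex) :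
    quenchedLaw (reveal (upTo ℓ) ω) y F = quenchedLaw ω y F := by
  have key : ∀ (a : ℕ → Vertex) (N : ℕ), (∀ m < N, gen (a m) < ℓ) →
      quenchedLaw (reveal (upTo ℓ) ω) y (startsWith a N) = quenchedLaw ω y (startsWith a N) := by
    intro a N
    induction N with
    | zero => intro _; simp only [quenchedLaw_startsWith_zero]
    | succ N ih =>
      intro ha
      rw [quenchedLaw_startsWith_succ, quenchedLaw_startsWith_succ,
        ih fun m hm => ha m (by omega), transProb_reveal_upTo (ha N (by omega))]
  rw [hF.measure_eq, hF.measure_eq]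
  exact tsum_congr fun b => key _ _ (h _ b.2)

theorem measurable_numChildren (z : Vertex) : Measurable fun ω : Env => numChildren ω z := by
  rcases z with _ | x
  · exact measurable_const
  · exact measurable_numChildren_word x

theorem measurable_quenchedLaw_apply {n : ℕ} {F : Env → Set (ℕ → Vertex)}
    (hdep : ∀ ω, DependsUpTo n (F ω)) (hm : ∀ X, MeasurableSet {ω | X ∈ F ω}) (y : Vertex) :
    Measurable fun ω => quenchedLaw ω y (F ω) := by
  classical
  have e : ∀ ω, quenchedLaw ω y (F ω) = ∑' b : (Finset.Iic n → Vertex),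
      {ω | extendPath n b ∈ F ω}.indicator
        (fun ω => quenchedLaw ω y (startsWith (extendPath n b) n)) ω := by
    intro ω
    rw [(hdep ω).measure_eq]
    exact tsum_subtype {b : Finset.Iic n → Vertex | extendPath n b ∈ F ω}
      fun b => quenchedLaw ω y (startsWith (extendPath n b) n)
  simp only [e]
  exact Measurable.tsum fun b =>
    (measurable_quenchedLaw_startsWith y _ _).indicator (hm _)

section

variable (q : PMF ℕ) (ρ : Measure ℝ≥0) [IsProbabilityMeasure ρ]

/-- The environment below the vertex at which the walk first visits generation `ℓ`, except for
the mark of this vertex, is independent of the past. -/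
theorem lintegral_firstHit_le {ℓ : ℕ} {F : ℕ → Env → Set (ℕ → Vertex)}
    (hdep : ∀ n ω, DependsUpTo n (F n ω)) (hm : ∀ n X, MeasurableSet {ω | X ∈ F n ω})
    (hfirst : ∀ n ω, ∀ X ∈ F n ω, FirstHit X n ℓ)
    (hloc : ∀ n ω, F n (reveal (upTo ℓ) ω) = F n ω)
    {E : Env → Set (ℕ → Vertex)} (hE : ∀ ω, MeasurableSet (E ω)) {h : Env → ℝ≥0∞}
    (hh : Measurable h) (hinv : ∀ ω ω', AgreeButMark ω ω' → h ω = h ω')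
    (hle : ∀ᵐ ω ∂envLaw q ρ, ∀ x : List ℕ, x.length = ℓ →
      quenchedLaw ω (word x) (E ω) ≤ h (subEnv x ω)) :
    ∫⁻ ω, quenchedLaw ω root (⋃ n, F n ω ∩ shiftPath n ⁻¹' E ω) ∂envLaw q ρ ≤
      (∫⁻ ω, h ω ∂envLaw q ρ) * ∫⁻ ω, quenchedLaw ω root (⋃ n, F n ω) ∂envLaw q ρ := by
  -- Decompose by the time `n` and the place `x` of the first visit. For fixed `n` and `x` the
  -- quenched probability of the past is a function of the data in `upTo ℓ`, and `h` at `x` a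
  -- function of those in `strictBelow x`.
  set G : ℕ → List ℕ → Env → Set (ℕ → Vertex) := fun n x ω => F n ω ∩ {X | X n = word x} with hG
  have hGdep : ∀ n x ω, DependsUpTo n (G n x ω) := by
    intro n x ω X X' hX hXG
    refine ⟨hdep n ω X X' hX hXG.1, ?_⟩
    change X' n = word x
    rw [← hX n le_rfl]; exact hXG.2
  have hGm : ∀ n x, Measurable fun ω => quenchedLaw ω root (G n x ω) := by
    intro n x
    refine measurable_quenchedLaw_apply (hGdep n x) (fun X => ?_) root
    have : {ω | X ∈ G n x ω} = {ω | X ∈ F n ω} ∩ {_ω | X n = word x} := rfl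
    rw [this]
    exact (hm n X).inter (MeasurableSet.const _)
  have hGempty : ∀ n x ω, x.length ≠ ℓ → G n x ω = ∅ := by
    intro n x ω hx
    refine Set.eq_empty_of_forall_notMem fun X hX => hx ?_
    have h1 := (hfirst n ω X hX.1).1
    rw [show X n = word x from hX.2] at h1
    simpa [gen, word] using h1
  have hcover : ∀ n ω, F n ω = ⋃ x, G n x ω := by
    intro n ω
    ext X
    simp only [hG, Set.mem_iUnion, Set.mem_inter_iff, Set.mem_ofPred_eq, exists_and_left]
    refine ⟨fun hX => ⟨hX, ?_⟩, fun hX => hX.1⟩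
    have h1 := (hfirst n ω X hX).1
    rcases hXn : X n with _ | x
    · rw [hXn] at h1; simp [gen] at h1
    · exact ⟨x, rfl⟩
  have hquenched : ∀ᵐ ω ∂envLaw q ρ, quenchedLaw ω root (⋃ n, F n ω ∩ shiftPath n ⁻¹' E ω) ≤
      ∑' n, ∑' x, quenchedLaw ω root (G n x ω) * h (subEnv x ω) := by
    filter_upwards [hle] with ω hω
    refine (measure_iUnion_le _).trans (ENNReal.tsum_le_tsum fun n => ?_)
    rw [hcover n ω, Set.iUnion_inter]
    refine (measure_iUnion_le _).trans (ENNReal.tsum_le_tsum fun x => ?_)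
    by_cases hx : x.length = ℓ
    · rw [quenchedLaw_markov ω root (word x) n (hGdep n x ω) (fun X hX => hX.2) (hE ω)]
      exact mul_le_mul_right (hω x hx) _
    · rw [hGempty n x ω hx]; simp
  have hsum : ∀ ω, ∑' n, ∑' x, quenchedLaw ω root (G n x ω) =
      quenchedLaw ω root (⋃ n, F n ω) := by
    intro ω
    rw [measure_iUnion]
    · refine tsum_congr fun n => ?_
      rw [hcover n ω, measure_iUnion]
      · intro x x' hne
        refine Set.disjoint_left.2 fun X hX hX' => hne ?_
        have h1 : X n = word x := hX.2
        have h2 : X n = word x' := hX'.2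
        exact Option.some.inj (h1.symm.trans h2)
      · exact fun x => (hGdep n x ω).measurableSet
    · intro n n' hne
      exact Set.disjoint_left.2 fun X hX hX' => hne ((hfirst n ω X hX).eq (hfirst n' ω X hX'))
    · exact fun n => (hdep n ω).measurableSet
  refine (lintegral_mono_ae hquenched).trans ?_
  simp only [← hsum]
  have hprodm : ∀ n x, Measurable fun ω => quenchedLaw ω root (G n x ω) * h (subEnv x ω) :=
    fun n x => (hGm n x).fun_mul (hh.comp (measurable_subEnv x))
  rw [lintegral_tsum fun n => (Measurable.tsum fun x => hprodm n x).aemeasurable,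
    lintegral_tsum fun n => (Measurable.tsum fun x => hGm n x).aemeasurable,
    ← ENNReal.tsum_mul_left]
  refine ENNReal.tsum_le_tsum fun n => ?_
  rw [lintegral_tsum fun x => (hprodm n x).aemeasurable,
    lintegral_tsum fun x => (hGm n x).aemeasurable, ← ENNReal.tsum_mul_left]
  refine ENNReal.tsum_le_tsum fun x => ?_
  by_cases hx : x.length = ℓ
  · rw [lintegral_mul_of_reveal q ρ (disjoint_upTo_strictBelow hx) (g := fun ω => h (subEnv x ω))
      (hGm n x) (hh.comp (measurable_subEnv x)), lintegral_subEnv q ρ x hh, mul_comm]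
    · intro ω
      have : G n x (reveal (upTo ℓ) ω) = G n x ω := by simp only [hG, hloc]
      simp only [this]
      exact quenchedLaw_reveal_upTo (hGdep n x ω) (fun X hX => (hfirst n ω X hX.1).2) ω root
    · intro ω
      exact hinv _ _ (agreeButMark_reveal le_rfl ω)
  · simp [hGempty n x _ hx]

/-! ### Successive failures to regenerate -/

/-- The walk visits generation `k * M` for the first time at time `n`, and none of the first
visits to the generations `M, …, (k - 1) * M` looks like a regeneration before the next of these
generations is reached. -/
def noRegen (M k n : ℕ) (ω : Env) : Set (ℕ → Vertex) :=
  {X | FirstHit X n (k * M : ℕ) ∧ ∀ j, 1 ≤ j → j < k → ∃ m < n, FirstHit X m (j * M : ℕ) ∧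
    (numChildren ω (X m) ≤ 1 ∨ ∃ t, m ≤ t ∧ t < n ∧ gen (X t) < (j * M : ℕ) ∧
      ∀ r ≤ t, gen (X r) < ((j + 1) * M : ℕ))}

theorem dependsUpTo_noRegen (M k n : ℕ) (ω : Env) : DependsUpTo n (noRegen M k n ω) := by
  rintro X X' hX ⟨h1, h2⟩
  refine ⟨h1.congr hX le_rfl, fun j hj hjk => ?_⟩
  obtain ⟨m, hm, hmj, hor⟩ := h2 j hj hjk
  refine ⟨m, hm, hmj.congr hX hm.le, hor.imp (fun h => ?_) ?_⟩
  · rw [← hX m hm.le]; exact h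
  · rintro ⟨t, hmt, htn, ht, hr⟩
    refine ⟨t, hmt, htn, ?_, fun r hrt => ?_⟩
    · rw [← hX t htn.le]; exact ht
    · rw [← hX r (by omega)]; exact hr r hrt

theorem measurableSet_mem_noRegen (M k n : ℕ) (X : ℕ → Vertex) :
    MeasurableSet {ω | X ∈ noRegen M k n ω} := by
  have hν : ∀ m, MeasurableSet {ω : Env | numChildren ω (X m) ≤ 1} := fun m =>
    measurable_numChildren (X m) measurableSet_Iic
  have e : {ω | X ∈ noRegen M k n ω} = {_ω | FirstHit X n (k * M : ℕ)} ∩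
      ⋂ j, ⋂ (_ : 1 ≤ j), ⋂ (_ : j < k), ⋃ m, ⋃ (_ : m < n), {_ω | FirstHit X m (j * M : ℕ)} ∩
        ({ω : Env | numChildren ω (X m) ≤ 1} ∪ {_ω | ∃ t, m ≤ t ∧ t < n ∧
          gen (X t) < (j * M : ℕ) ∧ ∀ r ≤ t, gen (X r) < ((j + 1) * M : ℕ)}) := by
    ext ω
    simp only [noRegen, Set.mem_ofPred_eq, Set.mem_inter_iff, Set.mem_iInter, Set.mem_iUnion,
      Set.mem_union, exists_prop]
  rw [e]
  refine (MeasurableSet.const _).inter (MeasurableSet.iInter fun j => MeasurableSet.iInter fun _ =>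
    MeasurableSet.iInter fun _ => MeasurableSet.iUnion fun m => MeasurableSet.iUnion fun _ =>
      (MeasurableSet.const _).inter ((hν m).union (MeasurableSet.const _)))

theorem noRegen_reveal (M k n : ℕ) (ω : Env) :
    noRegen M k n (reveal (upTo (k * M)) ω) = noRegen M k n ω := by
  ext X
  simp only [noRegen, Set.mem_ofPred_eq]
  refine and_congr_right fun hn => forall_congr' fun j => forall₂_congr fun hj hjk =>
    exists_congr fun m => and_congr_right fun hm => and_congr_right fun hmj => ?_
  rw [numChildren_reveal_upTo]
  exact hn.2 m hm

/-- A failure at level j is decided before level (j+1)M is reached, so at the first visit to level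
kM all earlier failures belong to the past, and only the failure at level k concerns the future. -/
theorem iUnion_noRegen_succ_subset {M : ℕ} (hM : 1 ≤ M) {k : ℕ} (hk : 1 ≤ k) (ω : Env) :
    ⋃ n, noRegen M (k + 1) n ω ⊆ ⋃ n, noRegen M k n ω ∩ shiftPath n ⁻¹'
      {X | numChildren ω (X 0) ≤ 1 ∨ ∃ t, gen (X t) < (k * M : ℕ)} := by
  intro X hX
  obtain ⟨n, hn, hX⟩ := Set.mem_iUnion.1 hX
  obtain ⟨m, hmn, hm, hor⟩ := hX k hk (by omega)
  refine Set.mem_iUnion.2 ⟨m, ⟨hm, fun j hj hjk => ?_⟩, ?_⟩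
  · obtain ⟨m', hm'n, hm', hor'⟩ := hX j hj (by omega)
    have hlt : ((j * M : ℕ) : ℤ) < (k * M : ℕ) := by
      exact_mod_cast Nat.mul_lt_mul_of_pos_right hjk hM
    refine ⟨m', hm'.lt_of_lt hm hlt, hm', hor'.imp_right ?_⟩
    rintro ⟨t, h1, h2, h3, h4⟩
    refine ⟨t, h1, ?_, h3, h4⟩
    -- Were the fall at level j later than the first visit to level kM ≥ (j+1)M, the walk would have
    -- reached level (j+1)M before falling.
    by_contra htm
    have h5 := h4 m (not_lt.1 htm)
    have h6 := hm.1
    have h7 : (j + 1) * M ≤ k * M := Nat.mul_le_mul_right M hjk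
    omega
  · refine hor.imp id ?_
    rintro ⟨t, h1, h2, h3, h4⟩
    refine ⟨t - m, ?_⟩
    change gen (X (m + (t - m))) < _
    rwa [Nat.add_sub_cancel' h1]

/-- The probability that a vertex is not the position of a regeneration. -/
noncomputable def missProb (ω : Env) : ℝ≥0∞ := if 2 ≤ (ω []).1 then (ret ω : ℝ≥0∞) else 1

theorem measurable_missProb : Measurable missProb :=
  Measurable.ite (measurable_numChildren_word [] measurableSet_Ici)
    measurable_ret.coe_nnreal_ennreal measurable_const

theorem AgreeButMark.ret_eq {ω ω' : Env} (h : AgreeButMark ω ω') : ret ω = ret ω' := by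
  have h1 := ret_add_esc ω
  rw [← ret_add_esc ω', h.esc_eq] at h1
  exact add_right_cancel h1

theorem AgreeButMark.missProb_eq {ω ω' : Env} (h : AgreeButMark ω ω') :
    missProb ω = missProb ω' := by
  simp only [missProb, h.1, h.ret_eq]

/-- Each level contributes a factor `missProb`, read off the environment at and below the vertex
first hit, independently of the past. -/
theorem lintegral_noRegen_le {M : ℕ} (hM : 1 ≤ M) (k : ℕ) :
    ∫⁻ ω, quenchedLaw ω root (⋃ n, noRegen M (k + 1) n ω) ∂envLaw q ρ ≤
      (∫⁻ ω, missProb ω ∂envLaw q ρ) ^ k := by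
  induction k with
  | zero =>
    rw [pow_zero]
    exact (lintegral_mono fun ω => prob_le_one).trans (by simp)
  | succ k ih =>
    have hE : ∀ ω, MeasurableSet {X : ℕ → Vertex |
        numChildren ω (X 0) ≤ 1 ∨ ∃ t, gen (X t) < ((k + 1) * M : ℕ)} := by
      intro ω
      rw [Set.ofPred_or, Set.ofPred_exists]
      exact (measurableSet_path 0 fun z => numChildren ω z ≤ 1).union
        (MeasurableSet.iUnion fun t => measurableSet_path t fun z => gen z < ((k + 1) * M : ℕ))
    have key := lintegral_firstHit_le q ρ (ℓ := (k + 1) * M) (F := fun n ω => noRegen M (k + 1) n ω)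
      (dependsUpTo_noRegen M (k + 1)) (measurableSet_mem_noRegen M (k + 1))
      (fun n ω X hX => hX.1) (fun n ω => noRegen_reveal M (k + 1) n ω) hE measurable_missProb
      (fun ω ω' h => h.missProb_eq) (by
        filter_upwards with ω x hx
        by_cases hν : 2 ≤ (ω x).1
        · have e : missProb (subEnv x ω) = ret (subEnv x ω) := if_pos hν
          rw [e]
          refine le_trans ?_ (quenchedLaw_gen_lt_length_le ω x)
          have hsub : {X : ℕ → Vertex | numChildren ω (X 0) ≤ 1 ∨
              ∃ t, gen (X t) < ((k + 1) * M : ℕ)} ⊆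
              {X | X 0 ≠ word x} ∪ {X | ∃ k, gen (X k) < x.length} := by
            rintro X (hX | ⟨t, ht⟩)
            · left
              intro h0
              rw [h0] at hX
              exact absurd hν (not_le.2 (Nat.lt_succ_of_le hX))
            · right
              exact ⟨t, by rw [hx]; exact ht⟩
          refine (measure_mono hsub).trans ((measure_union_le _ _).trans ?_)
          rw [quenchedLaw_start, zero_add]
        · have e : missProb (subEnv x ω) = 1 := if_neg hν
          rw [e]; exact prob_le_one)
    rw [pow_succ']
    refine le_trans (lintegral_mono fun ω => measure_mono
      (iUnion_noRegen_succ_subset hM (Nat.le_add_left 1 k) ω)) (key.trans ?_)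
    exact mul_le_mul_right ih _

/-- The complementary probability is the mean of β on the event of at least two children. As β > 0
almost surely, it can vanish only if the root almost surely has a single child. -/
theorem lintegral_missProb_lt_one (h1 : q 1 < 1) (h0 : q 0 = 0)
    (hesc : ∀ᵐ ω ∂envLaw q ρ, 0 < esc ω) : ∫⁻ ω, missProb ω ∂envLaw q ρ < 1 := by
  set f : Env → ℝ≥0∞ := fun ω => if 2 ≤ (ω []).1 then (esc ω : ℝ≥0∞) else 0 with hf
  have hfm : Measurable f := Measurable.ite (measurable_numChildren_word [] measurableSet_Ici)
    measurable_esc.coe_nnreal_ennreal measurable_const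
  have hadd : ∫⁻ ω, missProb ω ∂envLaw q ρ + ∫⁻ ω, f ω ∂envLaw q ρ = 1 := by
    rw [← lintegral_add_left measurable_missProb]
    refine (lintegral_congr fun ω => ?_).trans (b := ∫⁻ _, 1 ∂envLaw q ρ) (by simp)
    simp only [missProb, hf]
    split_ifs
    · exact_mod_cast ret_add_esc ω
    · simp
  have hpos : ∫⁻ ω, f ω ∂envLaw q ρ ≠ 0 := by
    intro hz
    rw [lintegral_eq_zero_iff hfm] at hz
    have hν : ∀ᵐ ω ∂envLaw q ρ, (ω []).1 = 1 := by
      filter_upwards [hz, hesc, ae_numChildren q ρ] with ω h h' hq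
      have hn0 : (ω []).1 ≠ 0 := fun h => hq [] (by rw [h, h0])
      by_contra hne
      have : 2 ≤ (ω []).1 := by omega
      simp only [hf, Pi.zero_apply, this, if_true, ENNReal.coe_eq_zero] at h
      exact h'.ne' h
    have hone := lintegral_single q ρ 1 0 (f := fun _ => 1) measurable_const
    simp only [mul_one, lintegral_const, measure_univ] at hone
    rw [lintegral_congr_ae (g := fun _ => 1) (by filter_upwards [hν] with ω h; simp [h])] at hone
    simp only [lintegral_const, measure_univ, mul_one] at hone
    exact h1.ne hone.symm
  have hle : ∫⁻ ω, missProb ω ∂envLaw q ρ ≠ ⊤ :=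
    ne_top_of_le_ne_top ENNReal.one_ne_top (le_self_add.trans hadd.le)
  calc ∫⁻ ω, missProb ω ∂envLaw q ρ < ∫⁻ ω, missProb ω ∂envLaw q ρ + ∫⁻ ω, f ω ∂envLaw q ρ :=
        ENNReal.lt_add_right hle hpos
    _ = 1 := hadd

end

end RWRE

namespace RWRE

/-! ### Regeneration times -/

theorem returnTime_eq_top_iff {X : ℕ → Vertex} {z : Vertex} :
    returnTime X z = ⊤ ↔ ∀ k, ¬ (X k = z ∧ X (k + 1) = parent z) := by
  simp only [returnTime, iInf_eq_top, ENat.natCast_ne_top, imp_false]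
  constructor
  · exact fun h k hk => h (k + 1) ⟨by omega, hk⟩
  · rintro h (_ | k) ⟨h1, h2⟩
    · omega
    · exact h k h2

theorem lt_firstRegen_iff {ω : Env} {X : ℕ → Vertex} {n : ℕ} :
    (n : ℕ∞) < firstRegen ω X ↔ ∀ k, 0 < k → k ≤ n → 2 ≤ numChildren ω (X k) →
      returnTime X (X k) = ⊤ → (k : ℕ∞) ≠ hitGen X (gen (X k)) := by
  rw [← not_le, firstRegen, ← ENat.lt_add_one_iff (ENat.natCast_ne_top n), iInf_lt_iff]
  simp only [iInf_lt_iff, not_exists]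
  refine ⟨fun h k h0 hkn h2 h3 h4 => h k ⟨h0, h2, h3, h4⟩ ?_, fun h k hk hlt => ?_⟩
  · exact_mod_cast Nat.lt_succ_of_le hkn
  · have : k < n + 1 := by exact_mod_cast hlt
    exact h k hk.1 (by omega) hk.2.1 hk.2.2.1 hk.2.2.2

theorem eq_hitGen_iff {X : ℕ → Vertex} {k : ℕ} :
    (k : ℕ∞) = hitGen X (gen (X k)) ↔ ∀ j < k, gen (X j) ≠ gen (X k) := by
  constructor
  · intro h j hj he
    have : hitGen X (gen (X k)) ≤ j := iInf₂_le j he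
    rw [← h] at this
    have : k ≤ j := by exact_mod_cast this
    omega
  · intro h
    refine le_antisymm (le_iInf₂ fun j hj => ?_) (iInf₂_le (f := fun (j : ℕ) (_ : gen (X j) = gen (X k)) => (j : ℕ∞)) k rfl)
    by_contra hlt
    exact h j (by exact_mod_cast not_le.1 hlt) hj

theorem measurableSet_returnTime (z : Vertex) :
    MeasurableSet {X : ℕ → Vertex | returnTime X z = ⊤} := by
  have : {X : ℕ → Vertex | returnTime X z = ⊤} =
      ⋂ k, ({X | X k = z} ∩ {X | X (k + 1) = parent z})ᶜ := by
    ext X; simp [returnTime_eq_top_iff]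
  rw [this]
  exact MeasurableSet.iInter fun k =>
    ((measurableSet_path k (· = z)).inter (measurableSet_path (k + 1) (· = parent z))).compl

theorem measurableSet_lt_firstRegen (n : ℕ) :
    MeasurableSet {p : Env × (ℕ → Vertex) | (n : ℕ∞) < firstRegen p.1 p.2} := by
  have e : {p : Env × (ℕ → Vertex) | (n : ℕ∞) < firstRegen p.1 p.2} =
      ⋂ k, ⋂ (_ : 0 < k), ⋂ (_ : k ≤ n), ⋂ z, (({ω : Env | 2 ≤ numChildren ω z} ×ˢ
        ({X : ℕ → Vertex | X k = z} ∩ {X | returnTime X z = ⊤} ∩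
          {X | ∀ j < k, gen (X j) ≠ gen (X k)})))ᶜ := by
    ext ⟨ω, X⟩
    simp only [Set.mem_ofPred_eq, lt_firstRegen_iff, Set.mem_iInter, Set.mem_compl_iff,
      Set.mem_prod, Set.mem_inter_iff, not_and, eq_hitGen_iff, ne_eq]
    refine forall₃_congr fun k _ _ => ⟨?_, fun h h1 h2 => h (X k) h1 ⟨rfl, h2⟩⟩
    rintro h z h1 ⟨rfl, h2⟩
    exact h h1 h2
  rw [e]
  refine MeasurableSet.iInter fun k => MeasurableSet.iInter fun _ => MeasurableSet.iInter fun _ =>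
    MeasurableSet.iInter fun z => (MeasurableSet.prod (measurable_numChildren z measurableSet_Ici)
      (((measurableSet_path k (· = z)).inter (measurableSet_returnTime z)).inter ?_)).compl
  refine DependsUpTo.measurableSet (m := k) fun X X' h hX j hj => ?_
  rw [← h j hj.le, ← h k le_rfl]
  exact hX j hj

/-- The first visit to generation `ℓ` is followed by a visit to generation `ℓ + M` and then by a
visit to a generation less than `ℓ`. -/
def deepReturnAt (ℓ M : ℕ) : Set (ℕ → Vertex) :=
  ⋃ n, {X | FirstHit X n ℓ} ∩ shiftPath n ⁻¹' deepReturn ℓ M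

/-- If the walk leaves the slab by time `n`, it has first hit every level jM by then. Since no
regeneration occurred there, the vertex hit has at most one child or the walk later steps to its
parent. In the latter case the walk falls below the level either before reaching the next one, a
failure in the sense of `noRegen`, or after, a deep return. -/
theorem mem_of_lt_firstRegen {ω : Env} {X : ℕ → Vertex} {n M : ℕ} (hM : 1 ≤ M) (h0 : X 0 = root)
    (hX : ∀ k, transProb ω (X k) (X (k + 1)) ≠ 0) (hD : returnTime X root = ⊤)
    (hn : (n : ℕ∞) < firstRegen ω X) :
    X ∈ confined n (M * M) ∪ (⋃ j ∈ Finset.range M, deepReturnAt (j * M) M) ∪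
      ⋃ m, noRegen M M m ω := by
  have hword : ∀ k, ∃ x, X k = word x := by
    intro k
    induction k with
    | zero => exact ⟨[], h0⟩
    | succ k ih =>
      obtain ⟨x, hx⟩ := ih
      have h := hX k
      rw [hx] at h
      rcases transProb_word_ne_zero h with h | ⟨i, -, h⟩
      · cases x with
        | nil => exact absurd ⟨hx, h⟩ (returnTime_eq_top_iff.1 hD k)
        | cons i x => exact ⟨x, h⟩
      · exact ⟨_, h⟩
  have hnonneg : ∀ k, 0 ≤ gen (X k) := by
    intro k
    obtain ⟨x, hx⟩ := hword k
    rw [hx]; simp [gen, word]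
  have hstep : ∀ k, gen (X (k + 1)) ≤ gen (X k) + 1 := by
    intro k
    obtain ⟨x, hx⟩ := hword k
    have h := hX k
    rw [hx] at h
    rw [hx]
    rcases transProb_word_ne_zero h with h | ⟨i, -, h⟩
    · rw [h]
      cases x with
      | nil => simp [wordParent, rootParent, gen, word]
      | cons i x => simp [wordParent, gen, word]; omega
    · rw [h]; simp [gen, word]
  have hg0 : gen (X 0) = 0 := by rw [h0]; rfl
  by_cases hconf : X ∈ confined n (M * M)
  · exact Or.inl (Or.inl hconf)
  by_cases hdeep : X ∈ ⋃ j ∈ Finset.range M, deepReturnAt (j * M) M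
  · exact Or.inl (Or.inr hdeep)
  right
  obtain ⟨k, hkn, hk⟩ : ∃ k ≤ n, ((M * M : ℕ) : ℤ) ≤ gen (X k) := by
    by_contra hcon
    push Not at hcon
    exact hconf fun k hk => ⟨hnonneg k, hcon k hk⟩
  have hfirst : ∀ j ≤ M, ∃ m ≤ n, FirstHit X m (j * M : ℕ) := by
    intro j hj
    have : ((j * M : ℕ) : ℤ) ≤ (M * M : ℕ) := by exact_mod_cast Nat.mul_le_mul_right M hj
    obtain ⟨m, hm, h⟩ := exists_firstHit hg0.le hstep (by positivity) (this.trans hk)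
    exact ⟨m, hm.trans hkn, h⟩
  obtain ⟨N, -, hN⟩ := hfirst M le_rfl
  refine Set.mem_iUnion.2 ⟨N, hN, fun j hj hjM => ?_⟩
  obtain ⟨m, hmn, hm⟩ := hfirst j hjM.le
  have hlt : ((j * M : ℕ) : ℤ) < (M * M : ℕ) := by
    exact_mod_cast Nat.mul_lt_mul_of_pos_right hjM hM
  have hpos : (0 : ℤ) < (j * M : ℕ) := by exact_mod_cast Nat.mul_pos hj hM
  have hm0 : 0 < m := by
    rcases Nat.eq_zero_or_pos m with rfl | h
    · have := hm.1; omega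
    · exact h
  refine ⟨m, hm.lt_of_lt hN hlt, hm, ?_⟩
  by_cases hν : numChildren ω (X m) ≤ 1
  · exact Or.inl hν
  right
  have hret : returnTime X (X m) ≠ ⊤ := fun h =>
    lt_firstRegen_iff.1 hn m hm0 hmn (by omega) h
      (eq_hitGen_iff.2 fun i hi => (by rw [hm.1]; exact (hm.2 i hi).ne))
  obtain ⟨t, ht1, ht2⟩ : ∃ t, X t = X m ∧ X (t + 1) = parent (X m) := by
    by_contra hcon
    push Not at hcon
    exact hret (returnTime_eq_top_iff.2 fun t ht => hcon t ht.1 ht.2)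
  have htm : m ≤ t := by
    by_contra hlt
    have h1 := hm.2 t (not_le.1 hlt)
    rw [ht1, hm.1] at h1
    omega
  have htg : gen (X (t + 1)) < (j * M : ℕ) := by
    rw [ht2, ← hm.1]
    obtain ⟨x, hx⟩ := hword m
    rw [hx]
    cases x with
    | nil => simp [parent, word, wordParent, rootParent, gen]
    | cons i x => simp [parent, word, wordParent, gen]
  obtain ⟨r, hrn, hr⟩ := hfirst (j + 1) hjM
  have hrN : r ≤ N := by
    by_contra h
    have h1 := hr.2 N (not_le.1 h)
    rw [hN.1] at h1
    have h2 : ((j + 1) * M : ℕ) ≤ M * M := Nat.mul_le_mul_right M hjM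
    omega
  have hj1 : ((j * M : ℕ) : ℤ) < ((j + 1) * M : ℕ) := by
    exact_mod_cast Nat.mul_lt_mul_of_pos_right (Nat.lt_succ_self j) hM
  have hmr : m < r := hm.lt_of_lt hr hj1
  -- Here `r` is the first visit to the next level: a fall before `r` is what `noRegen` records;
  -- otherwise the step to the parent at time `t + 1` comes after `r` and completes a deep return.
  by_cases hback : ∃ u, m ≤ u ∧ u < r ∧ gen (X u) < (j * M : ℕ)
  · obtain ⟨u, h1, h2, h3⟩ := hback
    exact ⟨u, h1, by omega, h3, fun i hi => hr.2 i (by omega)⟩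
  · exfalso
    push Not at hback
    have htr : r ≤ t + 1 := by
      by_contra h
      have := hback (t + 1) (by omega) (by omega)
      omega
    refine hdeep (Set.mem_iUnion₂.2 ⟨j, Finset.mem_range.2 hjM, Set.mem_iUnion.2 ⟨m, hm,
      r - m, t + 1 - m, by omega, fun i hi => ?_, ?_, ?_⟩⟩)
    · change _ ≤ gen (X (m + i))
      rcases (show m + i ≤ r by omega).eq_or_lt with h | h
      · rw [h, hr.1]; exact hj1.le
      · exact hback _ (by omega) h
    · change gen (X (m + (r - m))) = _
      rw [Nat.add_sub_cancel' hmr.le, hr.1]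
      push_cast; ring
    · change gen (X (m + (t + 1 - m))) < _
      rwa [Nat.add_sub_cancel' (by omega)]

section

variable (q : PMF ℕ) (ρ : Measure ℝ≥0) [IsProbabilityMeasure ρ]

theorem lintegral_deepReturnAt_le {R : Env → ℝ≥0∞} (hR : Measurable R)
    (hinv : ∀ ω ω', AgreeButMark ω ω' → R ω = R ω') {M : ℕ}
    (hle : ∀ᵐ ω ∂envLaw q ρ, ∀ x, quenchedLaw ω (word x) (deepReturn x.length M) ≤
      R (subEnv x ω)) (ℓ : ℕ) :
    ∫⁻ ω, quenchedLaw ω root (deepReturnAt ℓ M) ∂envLaw q ρ ≤ ∫⁻ ω, R ω ∂envLaw q ρ := by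
  have key := lintegral_firstHit_le q ρ (ℓ := ℓ) (F := fun n _ => {X | FirstHit X n ℓ})
    (fun n ω X X' h hX => FirstHit.congr h le_rfl hX) (fun n X => MeasurableSet.const _)
    (fun n ω X hX => hX) (fun n ω => rfl) (E := fun _ => deepReturn ℓ M)
    (fun _ => measurableSet_deepReturn ℓ M) hR hinv
    (by filter_upwards [hle] with ω hω x hx; rw [← hx]; exact hω x)
  refine key.trans ?_
  nth_rewrite 2 [← mul_one (∫⁻ ω, R ω ∂envLaw q ρ)]
  refine mul_le_mul_right ?_ _
  exact (lintegral_mono fun ω => prob_le_one).trans (by simp)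

/-- Union bound over the three scenarios with spacing `M + 1`: confinement, deep returns at `M + 1`
levels, and `M` successive failures. -/
theorem annealedLaw_lt_firstRegen_le {κ : ℝ≥0∞} {R : ℕ → Env → ℝ≥0∞} (hR : ∀ M, Measurable (R M))
    (hinv : ∀ M ω ω', AgreeButMark ω ω' → R M ω = R M ω')
    (hκ : ∀ M, ∫⁻ ω, R M ω ∂envLaw q ρ ≤ κ ^ M)
    (hle : ∀ᵐ ω ∂envLaw q ρ, ∀ M x, quenchedLaw ω (word x) (deepReturn x.length M) ≤
      R M (subEnv x ω)) (n M : ℕ) :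
    annealedLaw q ρ root ({p | returnTime p.2 root = ⊤} ∩
        {p | (n : ℕ∞) < firstRegen p.1 p.2}) ≤
      ∫⁻ ω, quenchedLaw ω root (confined n ((M + 1) * (M + 1))) ∂envLaw q ρ +
        ((M + 1 : ℕ) * κ ^ (M + 1) + (∫⁻ ω, missProb ω ∂envLaw q ρ) ^ M) := by
  have hms : MeasurableSet ({p : Env × (ℕ → Vertex) | returnTime p.2 root = ⊤} ∩
      {p | (n : ℕ∞) < firstRegen p.1 p.2}) :=
    (measurable_snd (measurableSet_returnTime root)).inter (measurableSet_lt_firstRegen n)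
  rw [annealedLaw, Measure.compProd_apply hms]
  set N := M + 1 with hN
  have hdm : ∀ ℓ, Measurable fun ω : Env => quenchedLaw ω root (deepReturnAt ℓ N) := by
    intro ℓ
    have : MeasurableSet (deepReturnAt ℓ N) := by
      refine MeasurableSet.iUnion fun m => MeasurableSet.inter ?_
        (measurable_shiftPath m (measurableSet_deepReturn ℓ N))
      exact DependsUpTo.measurableSet (m := m) fun X X' h hX => FirstHit.congr h le_rfl hX
    exact (Measure.measurable_coe this).comp (measurable_quenchedLaw root)
  have hcm : Measurable fun ω : Env => quenchedLaw ω root (confined n (N * N)) :=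
    (Measure.measurable_coe (dependsUpTo_confined n (N * N)).measurableSet).comp
      (measurable_quenchedLaw root)
  have hpt : ∀ ω, quenchedKernel root ω (Prod.mk ω ⁻¹' ({p | returnTime p.2 root = ⊤} ∩
      {p | (n : ℕ∞) < firstRegen p.1 p.2})) ≤ quenchedLaw ω root (confined n (N * N)) +
        (∑ j ∈ Finset.range N, quenchedLaw ω root (deepReturnAt (j * N) N) +
          quenchedLaw ω root (⋃ m, noRegen N (M + 1) m ω)) := by
    intro ω
    change quenchedLaw ω root _ ≤ _
    refine le_trans (measure_mono_ae (t := confined n (N * N) ∪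
      (⋃ j ∈ Finset.range N, deepReturnAt (j * N) N) ∪ ⋃ m, noRegen N (M + 1) m ω) ?_) ?_
    · have hs : ∀ᵐ X ∂quenchedLaw ω root, X 0 = root := by
        rw [ae_iff]; exact quenchedLaw_start ω root
      filter_upwards [quenchedLaw_ae_transProb_ne_zero ω root, hs] with X hX h0 hXm
      exact mem_of_lt_firstRegen (by omega) h0 hX hXm.1 hXm.2
    · rw [← add_assoc]
      refine (measure_union_le _ _).trans (add_le_add_left ((measure_union_le _ _).trans
        (add_le_add_right (measure_biUnion_finset_le _ _) _)) _)
  refine (lintegral_mono hpt).trans ?_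
  rw [lintegral_add_left hcm, lintegral_add_left (Finset.measurable_fun_sum _ fun j _ => hdm _),
    lintegral_finsetSum _ fun j _ => hdm _]
  refine add_le_add_right (add_le_add ?_ (lintegral_noRegen_le q ρ (by omega) M)) _
  refine (Finset.sum_le_card_nsmul _ _ (κ ^ N) fun j _ => ?_).trans (le_of_eq ?_)
  · refine (lintegral_deepReturnAt_le q ρ (hR N) (hinv N) ?_ _).trans (hκ N)
    filter_upwards [hle] with ω hω x using hω N x
  · rw [Finset.card_range, nsmul_eq_mul]

/-- The stretched exponential upper bound. -/
theorem exists_annealedLaw_lt_firstRegen_le {i s : ℝ≥0} (hi : 0 < i)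
    (hρ : ∀ᵐ a ∂ρ, i ≤ a ∧ a ≤ s) (h0 : q 0 = 0) (h1 : q 1 < 1) (hm : offspringMean q < ⊤)
    (hesc : ∀ᵐ ω ∂envLaw q ρ, 0 < esc ω) {δ : ℝ} (hδ : 0 < δ)
    (hconf : ∀ᶠ n : ℕ in atTop, ∀ L : ℕ, (L : ℝ) ≤ (n : ℝ) ^ δ →
      ∫⁻ ω, quenchedLaw ω root (confined n L) ∂envLaw q ρ ≤
        ENNReal.ofReal (Real.exp (-(n : ℝ) ^ δ))) :
    ∃ α : ℝ, 0 < α ∧ ∀ᶠ n : ℕ in atTop, annealedLaw q ρ root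
      ({p | returnTime p.2 root = ⊤} ∩ {p | (n : ℕ∞) < firstRegen p.1 p.2}) ≤
        ENNReal.ofReal (Real.exp (-(n : ℝ) ^ α)) := by
  obtain ⟨κ, R, hκ1, hR, hinv, hκ, hle⟩ := exists_deepReturn_bound q ρ hi hρ h1 hm hesc
  have hmiss := lintegral_missProb_lt_one q ρ h1 h0 hesc
  obtain ⟨r, hr0, hr1, hκr, hmr⟩ : ∃ r : ℝ, 0 < r ∧ r < 1 ∧ κ ≤ ENNReal.ofReal r ∧
      ∫⁻ ω, missProb ω ∂envLaw q ρ ≤ ENNReal.ofReal r := by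
    set x := max κ (∫⁻ ω, missProb ω ∂envLaw q ρ)
    have hx : x < 1 := max_lt hκ1 hmiss
    have hxt : x ≠ ⊤ := ne_top_of_lt hx
    have hx1 : x.toReal < 1 := by
      rw [← ENNReal.toReal_one]; exact (ENNReal.toReal_lt_toReal hxt ENNReal.one_ne_top).2 hx
    have hle : x ≤ ENNReal.ofReal ((1 + x.toReal) / 2) := by
      rw [ENNReal.le_ofReal_iff_toReal_le hxt (by positivity)]; linarith
    exact ⟨(1 + x.toReal) / 2, by positivity, by linarith, (le_max_left _ _).trans hle,
      (le_max_right _ _).trans hle⟩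
  have hlr : 0 < -Real.log r := by linarith [Real.log_neg hr0 hr1]
  set lr := -Real.log r with hlrdef
  have hrexp : r = Real.exp (-lr) := by rw [hlrdef, neg_neg, Real.exp_log hr0]
  refine ⟨δ / 8, by positivity, ?_⟩
  filter_upwards [hconf, eventually_mul_rpow_le 2 (show δ / 8 < δ by linarith),
    eventually_mul_rpow_le 4 (show (0 : ℝ) < δ / 4 by linarith),
    eventually_mul_rpow_le (16 / lr) (show δ / 8 < δ / 4 by linarith),
    eventually_mul_rpow_le 4 (show (0 : ℝ) < δ / 8 by linarith),
    eventually_mul_rpow_le 4 (show δ / 4 < δ / 2 by linarith),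
    eventually_ge_atTop 1] with n hc h2 h3 h4 h6 h7 hn1
  rw [Real.rpow_zero, mul_one] at h3 h6
  have hn' : (1 : ℝ) ≤ n := by exact_mod_cast hn1
  have hn0 : (0 : ℝ) < n := by linarith
  set z := (n : ℝ) ^ (δ / 8) with hz
  have hz0 : 0 < z := by positivity
  set y := (n : ℝ) ^ (δ / 4) with hy
  have hyz : y = z * z := by rw [hy, hz, ← Real.rpow_add hn0]; congr 1; ring
  -- With M of order n^(δ/4) the slab has height (M+1)² ≤ n^δ, as the confinement bound requires,
  -- and r^M beats both the prefactor M + 2 and exp(-n^(δ/8)).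
  set M := ⌊y⌋₊
  have hM1 : (M : ℝ) ≤ y := Nat.floor_le (by positivity)
  have hM2 : y < M + 1 := Nat.lt_floor_add_one _
  have hL : (((M + 1) * (M + 1) : ℕ) : ℝ) ≤ (n : ℝ) ^ δ := by
    have e : (n : ℝ) ^ δ = (n : ℝ) ^ (δ / 2) * (n : ℝ) ^ (δ / 2) := by
      rw [← Real.rpow_add hn0]; congr 1; ring
    rw [e]
    push_cast
    have : (M : ℝ) + 1 ≤ (n : ℝ) ^ (δ / 2) := by linarith
    gcongr
  refine (annealedLaw_lt_firstRegen_le q ρ hR hinv hκ hle n M).trans ?_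
  have hrM : r ^ M ≤ Real.exp (-(lr * (y / 2))) := by
    rw [hrexp, ← Real.exp_nat_mul]
    refine Real.exp_le_exp.2 ?_
    nlinarith
  have hbound : ((M + 1 : ℕ) : ℝ≥0∞) * κ ^ (M + 1) + (∫⁻ ω, missProb ω ∂envLaw q ρ) ^ M ≤
      ENNReal.ofReal ((M + 2) * r ^ M) := by
    have e : ENNReal.ofReal (((M : ℝ) + 2) * r ^ M) =
        ((M + 1 : ℕ) : ℝ≥0∞) * ENNReal.ofReal r ^ M + ENNReal.ofReal r ^ M := by
      rw [ENNReal.ofReal_mul (by positivity), ENNReal.ofReal_pow hr0.le]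
      have : ENNReal.ofReal ((M : ℝ) + 2) = ((M + 1 : ℕ) : ℝ≥0∞) + 1 := by
        rw [show (M : ℝ) + 2 = ((M + 1 : ℕ) : ℝ) + 1 by push_cast; ring,
          ENNReal.ofReal_add (by positivity) one_pos.le, ENNReal.ofReal_natCast,
          ENNReal.ofReal_one]
      rw [this, add_mul, one_mul]
    rw [e]
    refine add_le_add (mul_le_mul_right ?_ _) (pow_le_pow_left₀ zero_le hmr M)
    exact (pow_le_pow_right_of_le_one' hκ1.le (Nat.le_succ M)).trans
      (pow_le_pow_left₀ zero_le hκr M)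
  refine (add_le_add (hc _ hL) hbound).trans ?_
  rw [← ENNReal.ofReal_add (by positivity) (by positivity)]
  refine ENNReal.ofReal_le_ofReal ?_
  have hexp : ∀ x, 1 + z ≤ x → Real.exp (-x) ≤ Real.exp (-z) / 2 := by
    intro x hx
    rw [le_div_iff₀ two_pos, mul_comm]
    calc 2 * Real.exp (-x) ≤ Real.exp 1 * Real.exp (-x) := by
          gcongr; linarith [Real.add_one_le_exp (1 : ℝ)]
      _ = Real.exp (1 - x) := by rw [← Real.exp_add]; congr 1
      _ ≤ _ := Real.exp_le_exp.2 (by linarith)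
  have hfirst : Real.exp (-(n : ℝ) ^ δ) ≤ Real.exp (-z) / 2 := hexp _ (by linarith)
  have hsecond : ((M : ℝ) + 2) * r ^ M ≤ Real.exp (-z) / 2 := by
    have hM3 : (M : ℝ) + 2 ≤ Real.exp (2 * z) := by
      have hz1 : z ≤ Real.exp z := by linarith [Real.add_one_le_exp z]
      calc (M : ℝ) + 2 ≤ z * z + 2 := by linarith
        _ ≤ (z + 1) * (z + 1) := by nlinarith
        _ ≤ Real.exp z * Real.exp z := by
            have := Real.add_one_le_exp z
            gcongr
        _ = _ := by rw [← Real.exp_add]; congr 1; ring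
    calc ((M : ℝ) + 2) * r ^ M ≤ Real.exp (2 * z) * Real.exp (-(lr * (y / 2))) := by gcongr
      _ = Real.exp (-(lr * (y / 2) - 2 * z)) := by rw [← Real.exp_add]; congr 1; ring
      _ ≤ _ := by
          refine hexp _ ?_
          rw [div_mul_eq_mul_div, div_le_iff₀ hlr] at h4
          nlinarith
  linarith

end

end RWRE

namespace RWRE

/-! ### Returning to the root late and then escaping -/

/-- The walk never visits the parent of the root, and visits the root at some time `≥ n`. -/
def lateReturn (n : ℕ) : Set (ℕ → Vertex) :=
  {X | (∀ k, 0 ≤ gen (X k)) ∧ ∃ t, n ≤ t ∧ X t = root}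

theorem measurableSet_lateReturn (n : ℕ) : MeasurableSet (lateReturn n) := by
  rw [lateReturn, Set.ofPred_and, Set.ofPred_forall, Set.ofPred_exists]
  refine (MeasurableSet.iInter fun k => measurableSet_path k fun z => 0 ≤ gen z).inter
    (MeasurableSet.iUnion fun t => ?_)
  rw [Set.ofPred_and]
  exact (MeasurableSet.const _).inter (measurableSet_path t (· = root))

theorem mem_lateReturn_of_shift {X : ℕ → Vertex} {x : List ℕ} {n : ℕ} (h0 : X 0 = word x)
    (h : shiftPath 1 X ∈ lateReturn n) : X ∈ lateReturn (n + 1) := by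
  obtain ⟨h1, t, ht, hr⟩ := h
  refine ⟨fun k => ?_, 1 + t, by omega, hr⟩
  rcases k with _ | k
  · rw [h0]; simp [gen, word]
  · have := h1 k
    rwa [shiftPath, add_comm] at this

theorem lateReturn_anti {m n : ℕ} (h : m ≤ n) : lateReturn n ⊆ lateReturn m :=
  fun _ ⟨h1, t, ht, hr⟩ => ⟨h1, t, h.trans ht, hr⟩

theorem transProb_wordParent_ge (ω : Env) (x : List ℕ) :
    ((1 / total ω x : ℝ≥0) : ℝ≥0∞) ≤ transProb ω (word x) (wordParent x) := by
  simp only [transProb, word, if_true]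
  exact le_self_add

theorem transProb_child_ge {ω : Env} {x : List ℕ} {j : ℕ} (hj : j < (ω x).1) :
    (((ω (j :: x)).2 / total ω x : ℝ≥0) : ℝ≥0∞) ≤ transProb ω (word x) (word (j :: x)) := by
  simp only [transProb, word]
  refine le_add_left (le_trans (le_of_eq ?_) (Finset.single_le_sum (f := fun i =>
    if (some (j :: x) : Vertex) = some (i :: x) then
      (((ω (i :: x)).2 / total ω x : ℝ≥0) : ℝ≥0∞) else 0)
    (fun _ _ => zero_le) (Finset.mem_range.2 hj)))
  simp

theorem step_single_le (ω : Env) {x : List ℕ} {z : Vertex} {c : ℝ≥0∞}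
    (hc : c ≤ transProb ω (word x) z) {E E' : Set (ℕ → Vertex)} (hE' : MeasurableSet E')
    (h : ∀ X, X 0 = word x → shiftPath 1 X ∈ E' → X ∈ E) :
    c * quenchedLaw ω z E' ≤ quenchedLaw ω (word x) E :=
  (mul_le_mul_left hc _).trans ((ENNReal.le_tsum z).trans (step_le_quenchedLaw ω (word x) hE' h))

/-- Going straight down along the leftmost path, and then never coming back. -/
theorem pow_mul_esc_le (ω : Env) {c : ℝ≥0} {N : ℕ}
    (hc : ∀ j < N, c ≤ (ω (0 :: List.replicate j 0)).2 / total ω (List.replicate j 0))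
    (hν : ∀ j < N, 1 ≤ (ω (List.replicate j 0)).1) (j : ℕ) (hj : j ≤ N) :
    (c : ℝ≥0∞) ^ (N - j) * esc (subEnv (List.replicate N 0) ω) ≤
      quenchedLaw ω (word (List.replicate j 0)) {X | ∀ k, 0 ≤ gen (X k)} := by
  have hms : MeasurableSet {X : ℕ → Vertex | ∀ k, 0 ≤ gen (X k)} := by
    rw [Set.ofPred_forall]
    exact MeasurableSet.iInter fun k => measurableSet_path k fun z => 0 ≤ gen z
  induction hj using Nat.decreasingInduction with
  | self =>
    rw [Nat.sub_self, pow_zero, one_mul]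
    refine (esc_le_quenchedLaw ω _).trans (measure_mono fun X hX k => ?_)
    exact (by positivity : (0 : ℤ) ≤ _).trans (hX k)
  | of_succ j hj ih =>
    have e : N - j = N - (j + 1) + 1 := by omega
    rw [e, pow_succ', mul_assoc]
    have h1 : (c : ℝ≥0∞) ≤ transProb ω (word (List.replicate j 0))
        (word (0 :: List.replicate j 0)) :=
      (ENNReal.coe_le_coe.2 (hc j hj)).trans (transProb_child_ge (hν j hj))
    refine (mul_le_mul_right ih _).trans (step_single_le ω h1 hms fun X h0 hX k => ?_)
    rcases k with _ | k
    · rw [h0]; simp [gen, word]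
    · have := hX k
      rwa [shiftPath, add_comm] at this

/-- Going straight up to the root. -/
theorem pow_mul_le_lateReturn (ω : Env) {c : ℝ≥0} {N : ℕ}
    (hc : ∀ x, IsVertex ω x → x.length ≤ N → c ≤ 1 / total ω x) {x : List ℕ} (hx : IsVertex ω x)
    (hN : x.length ≤ N) :
    (c : ℝ≥0∞) ^ x.length * quenchedLaw ω root {X | ∀ k, 0 ≤ gen (X k)} ≤
      quenchedLaw ω (word x) (lateReturn 0) := by
  induction x with
  | nil =>
    rw [List.length_nil, pow_zero, one_mul]
    refine measure_mono_ae ?_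
    have hs : ∀ᵐ X ∂quenchedLaw ω root, X 0 = root := by
      rw [ae_iff]; exact quenchedLaw_start ω root
    filter_upwards [hs] with X h0 hX using ⟨hX, 0, le_rfl, h0⟩
  | cons i x ih =>
    rw [List.length_cons, pow_succ', mul_assoc]
    simp only [List.length_cons] at hN
    refine (mul_le_mul_right (ih hx.1 (by omega)) _).trans ?_
    exact step_single_le ω ((ENNReal.coe_le_coe.2 (hc (i :: x) hx (by simpa using hN))).trans
      (transProb_wordParent_ge ω (i :: x))) (measurableSet_lateReturn 0)
      fun X h0 hX => lateReturn_anti (Nat.zero_le 1) (mem_lateReturn_of_shift h0 hX)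

/-- After a regeneration at x the walk stays below x forever, since the only exit is the step from x
to its parent. A positive time cannot be the first visit to generation 0, so x is not the root, and
the visit to the root at a time at least `n` is contradicted. -/
theorem lt_firstRegen_of_lateReturn {ω : Env} {X : ℕ → Vertex} {n : ℕ} (h0 : X 0 = root)
    (hX : ∀ k, transProb ω (X k) (X (k + 1)) ≠ 0) (h : X ∈ lateReturn n) :
    returnTime X root = ⊤ ∧ (n : ℕ∞) < firstRegen ω X := by
  obtain ⟨hg, t, hnt, ht⟩ := h
  refine ⟨returnTime_eq_top_iff.2 fun k hk => ?_, ?_⟩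
  · have := hg (k + 1)
    rw [hk.2] at this
    simp [parent, root, word, wordParent, rootParent, gen] at this
  rw [lt_firstRegen_iff]
  intro k hk0 hkn _ hret hhit
  obtain ⟨x, hx⟩ : ∃ x, X k = word x := by
    rcases hXk : X k with _ | x
    · have := hg k; rw [hXk] at this; simp [gen] at this
    · exact ⟨x, rfl⟩
  rw [hx] at hret
  rw [returnTime_eq_top_iff] at hret
  have hx0 : x ≠ [] := by
    rintro rfl
    have := eq_hitGen_iff.1 hhit 0 hk0
    rw [h0, hx] at this
    exact this rfl
  have key : ∀ d, ∃ w, X (k + d) = word w ∧ x <:+ w := by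
    intro d
    induction d with
    | zero => exact ⟨x, hx, List.suffix_rfl⟩
    | succ d ih =>
      obtain ⟨w, hw, hxw⟩ := ih
      have hs := hX (k + d)
      rw [hw] at hs
      rcases transProb_word_ne_zero hs with h | ⟨i, -, h⟩
      · cases w with
        | nil => exact absurd (List.suffix_nil.1 hxw) hx0
        | cons i w =>
          rcases List.suffix_cons_iff.1 hxw with heq | hsuf
          · subst heq
            exact absurd ⟨hw, h⟩ (hret (k + d))
          · exact ⟨w, h, hsuf⟩
      · exact ⟨i :: w, h, hxw.trans (List.suffix_cons i w)⟩
  obtain ⟨w, hw, hxw⟩ := key (t - k)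
  rw [Nat.add_sub_cancel' (hkn.trans hnt), ht] at hw
  have : w = [] := (Option.some.inj hw).symm
  rw [this] at hxw
  exact hx0 (List.suffix_nil.1 hxw)

/-! ### Traps -/

/-- A trap around generation `h`: the offspring numbers and the marks push the walk towards
generation `h`. -/
def trapData (k₁ k₂ : ℕ) (u : ℝ≥0) (h ℓ : ℕ) : Set (ℕ × ℝ≥0) :=
  {d | (ℓ < 2 * h → d.1 = if ℓ < h then k₁ else k₂) ∧
    if ℓ ≤ h then 1 ≤ k₁ * d.2 * u else k₂ * d.2 ≤ u}

/-- The words of length at most `N` with letters less than `K`. -/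
def wordsLE (K : ℕ) : ℕ → Finset (List ℕ)
  | 0 => {[]}
  | N + 1 => wordsLE K N ∪ (Finset.range K ×ˢ wordsLE K N).image fun p => p.1 :: p.2

theorem nil_mem_wordsLE (K N : ℕ) : [] ∈ wordsLE K N := by
  induction N with
  | zero => simp [wordsLE]
  | succ N ih => exact Finset.mem_union_left _ ih

theorem card_wordsLE_le (K N : ℕ) : (wordsLE K N).card ≤ (K + 1) ^ N := by
  induction N with
  | zero => simp [wordsLE]
  | succ N ih =>
    refine (Finset.card_union_le _ _).trans ((Nat.add_le_add_left Finset.card_image_le _).trans ?_)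
    rw [Finset.card_product, Finset.card_range, pow_succ]
    calc _ = (wordsLE K N).card * (K + 1) := by ring
      _ ≤ _ := Nat.mul_le_mul_right _ ih

theorem length_le_of_mem_wordsLE {K N : ℕ} {x : List ℕ} (h : x ∈ wordsLE K N) : x.length ≤ N := by
  induction N generalizing x with
  | zero => simp only [wordsLE, Finset.mem_singleton] at h; simp [h]
  | succ N ih =>
    simp only [wordsLE, Finset.mem_union, Finset.mem_image, Finset.mem_product] at h
    rcases h with h | ⟨p, hp, rfl⟩
    · exact (ih h).trans (Nat.le_succ N)
    · simpa using ih hp.2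

theorem cons_mem_wordsLE {K N : ℕ} {x : List ℕ} (h : x ∈ wordsLE K N) {i : ℕ} (hi : i < K)
    (hx : x.length < N) : i :: x ∈ wordsLE K N := by
  induction N generalizing x i with
  | zero => omega
  | succ N ih =>
    simp only [wordsLE, Finset.mem_union, Finset.mem_image, Finset.mem_product] at h
    rcases h with h | ⟨p, hp, rfl⟩
    · exact Finset.mem_union_right _ (Finset.mem_image.2
        ⟨(i, x), Finset.mem_product.2 ⟨Finset.mem_range.2 hi, h⟩, rfl⟩)
    · refine Finset.mem_union_right _ (Finset.mem_image.2 ⟨(i, p.1 :: p.2),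
        Finset.mem_product.2 ⟨Finset.mem_range.2 hi, ?_⟩, rfl⟩)
      exact ih hp.2 (Finset.mem_range.1 hp.1) (by simpa using hx)

/-- The environments with a trap. -/
def trapped (k₁ k₂ : ℕ) (u : ℝ≥0) (h : ℕ) : Set Env :=
  Set.pi (wordsLE (max k₁ k₂) (2 * h)) fun x => trapData k₁ k₂ u h x.length

theorem measurableSet_trapData (k₁ k₂ : ℕ) (u : ℝ≥0) (h ℓ : ℕ) :
    MeasurableSet (trapData k₁ k₂ u h ℓ) := by
  refine MeasurableSet.inter (s₁ := {d : ℕ × ℝ≥0 | ℓ < 2 * h → d.1 = if ℓ < h then k₁ else k₂})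
    (s₂ := {d | if ℓ ≤ h then 1 ≤ k₁ * d.2 * u else k₂ * d.2 ≤ u}) ?_ ?_
  · exact measurable_fst (MeasurableSet.of_discrete
      (s := {k | ℓ < 2 * h → k = if ℓ < h then k₁ else k₂}))
  · split_ifs
    · exact ((measurable_snd.const_mul (k₁ : ℝ≥0)).mul_const u) measurableSet_Ici
    · exact (measurable_snd.const_mul (k₂ : ℝ≥0)) measurableSet_Iic

/-- The trap is imposed on a deterministic box of words rather than on the random tree, so that its
probability is a finite product. The prescribed offspring numbers keep the tree inside the box. -/
theorem mem_wordsLE_of_trapped {k₁ k₂ : ℕ} {u : ℝ≥0} {h : ℕ} {ω : Env}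
    (hω : ω ∈ trapped k₁ k₂ u h) {x : List ℕ} (hx : IsVertex ω x) (hl : x.length ≤ 2 * h) :
    x ∈ wordsLE (max k₁ k₂) (2 * h) := by
  induction x with
  | nil => exact nil_mem_wordsLE _ _
  | cons i x ih =>
    simp only [List.length_cons] at hl
    have hmem := ih hx.1 (by omega)
    refine cons_mem_wordsLE hmem (hx.2.trans_le ?_) (by omega)
    rw [(hω x hmem).1 (by omega)]
    split_ifs
    exacts [le_max_left _ _, le_max_right _ _]

/-- In generation 2h only the marks are constrained, so the trap is independent of the escape from a
vertex of that generation. -/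
theorem trapped_reveal (k₁ k₂ : ℕ) (u : ℝ≥0) (h : ℕ) (ω : Env) :
    reveal (upTo (2 * h)) ω ∈ trapped k₁ k₂ u h ↔ ω ∈ trapped k₁ k₂ u h := by
  refine forall₂_congr fun x hx => ?_
  have hl := length_le_of_mem_wordsLE (Finset.mem_coe.1 hx)
  have h2 : (reveal (upTo (2 * h)) ω x).2 = (ω x).2 := reveal_snd (Or.inr ⟨rfl, hl⟩) ω
  have h1 : x.length < 2 * h → (reveal (upTo (2 * h)) ω x).1 = (ω x).1 :=
    fun hlt => reveal_fst (Or.inl ⟨rfl, hlt⟩) ω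
  simp only [trapData, Set.mem_ofPred_eq, h2]
  exact and_congr_left fun _ => forall_congr' fun hlt => by rw [h1 hlt]

/-- The probability, up to a small error, not to leave the trap. -/
noncomputable def trapFun (u : ℝ≥0) (h : ℕ) : Vertex → ℝ≥0
  | none => 0
  | some x => 1 - u ^ min x.length (2 * h - x.length)

/-- Let S be the sum of the children's marks. Before generation h one has Su ≥ 1, exactly what makes
1 - u^ℓ subharmonic; after it S ≤ u does the same for 1 - u^(2h-ℓ). At generation h itself all
neighbours have the value 1 - u^(h-1), and only there is the factor on the left needed. -/
theorem trapFun_step {k₁ k₂ : ℕ} {u : ℝ≥0} {h : ℕ} (hu : u ≤ 1) {ω : Env}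
    (hω : ω ∈ trapped k₁ k₂ u h) {x : List ℕ} (hx : IsVertex ω x) (h1 : 1 ≤ x.length)
    (h2 : x.length < 2 * h) :
    (((1 - u ^ (h - 1)) * trapFun u h (word x) : ℝ≥0) : ℝ≥0∞) ≤
      ∑' z, transProb ω (word x) z * trapFun u h z := by
  rw [tsum_transProb_mul ω x fun z => (trapFun u h z : ℝ≥0∞)]
  norm_cast
  have hmem := mem_wordsLE_of_trapped hω hx h2.le
  have hν := (hω x hmem).1 h2
  have hchild : ∀ j < (ω x).1, ω (j :: x) ∈ trapData k₁ k₂ u h (x.length + 1) := by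
    intro j hj
    have := hω (j :: x) (mem_wordsLE_of_trapped hω (x := j :: x) ⟨hx, hj⟩ (by simpa using h2))
    exact this
  set S : ℝ≥0 := ∑ j ∈ Finset.range (ω x).1, (ω (j :: x)).2 with hS
  have hT : total ω x = 1 + S := rfl
  set ℓ := x.length with hℓ
  obtain ⟨v, hv⟩ : ∃ v : ℕ → ℝ≥0, ∀ m, v m = 1 - u ^ min m (2 * h - m) := ⟨_, fun _ => rfl⟩
  have hvr : ∀ m, (v m : ℝ) = 1 - (u : ℝ) ^ min m (2 * h - m) := by
    intro m
    rw [hv, NNReal.coe_sub (pow_le_one' hu _)]; push_cast; rfl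
  have e0 : trapFun u h (word x) = v ℓ := (hv ℓ).symm
  have e1 : ∀ j, trapFun u h (word (j :: x)) = v (ℓ + 1) := by
    intro j; rw [hv]; simp [trapFun, word, hℓ]
  have e2 : trapFun u h (wordParent x) = v (ℓ - 1) := by
    cases x with
    | nil => exact absurd h1 (by simp [hℓ])
    | cons i x => rw [hv]; simp [trapFun, wordParent, word, hℓ]
  rw [e0, e2]
  simp only [e1]
  rw [← Finset.sum_mul, ← Finset.sum_div, ← hS, hT, ← NNReal.coe_le_coe]
  push_cast
  rw [NNReal.coe_sub (pow_le_one' hu _), hvr, hvr, hvr]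
  push_cast
  have hu0 : (0 : ℝ) ≤ u := NNReal.coe_nonneg u
  have hu1 : (u : ℝ) ≤ 1 := hu
  have hS0 : (0 : ℝ) ≤ S := NNReal.coe_nonneg S
  have hp : ∀ m, (u : ℝ) ^ m ≤ 1 := fun m => pow_le_one₀ hu0 hu1
  have hp0 : ∀ m, 0 ≤ (u : ℝ) ^ m := fun m => pow_nonneg hu0 m
  rw [one_div_mul_eq_div, div_mul_eq_mul_div, ← add_div, le_div_iff₀ (by positivity)]
  rcases lt_trichotomy ℓ h with hlt | heq | hgt
  · have hSu : (1 : ℝ) ≤ S * u := by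
      rw [if_pos hlt] at hν
      have hk : 0 < k₁ := by
        rcases Nat.eq_zero_or_pos k₁ with h0 | h0
        · have := (hω [] (nil_mem_wordsLE _ _)).2
          rw [List.length_nil, if_pos (Nat.zero_le _), h0] at this
          simp at this
        · exact h0
      have : ∀ j ∈ Finset.range (ω x).1, (1 : ℝ) ≤ k₁ * (ω (j :: x)).2 * u := by
        intro j hj
        have := (hchild j (Finset.mem_range.1 hj)).2
        rw [if_pos (by omega)] at this
        exact_mod_cast this
      have h3 := Finset.sum_le_sum this
      rw [Finset.sum_const, Finset.card_range, hν, nsmul_eq_mul, mul_one, ← Finset.sum_mul,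
        ← Finset.mul_sum] at h3
      have hSr : (S : ℝ) = ∑ j ∈ Finset.range k₁, ((ω (j :: x)).2 : ℝ) := by
        rw [hS, hν]; push_cast; rfl
      rw [← hSr, mul_assoc] at h3
      have hk' : (0 : ℝ) < k₁ := by exact_mod_cast hk
      nlinarith
    obtain ⟨m, hm⟩ : ∃ m, ℓ = m + 1 := ⟨ℓ - 1, by omega⟩
    have a1 : min ℓ (2 * h - ℓ) = m + 1 := by omega
    have a2 : min (ℓ - 1) (2 * h - (ℓ - 1)) = m := by omega
    have a3 : min (ℓ + 1) (2 * h - (ℓ + 1)) = m + 2 := by omega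
    rw [a1, a2, a3]
    have hkey : (u : ℝ) ^ m * ((1 - u) * (1 - S * u)) ≤ 0 :=
      mul_nonpos_of_nonneg_of_nonpos (hp0 m)
        (mul_nonpos_of_nonneg_of_nonpos (by linarith) (by linarith))
    have hθ : (1 - (u : ℝ) ^ (h - 1)) * (1 - (u : ℝ) ^ (m + 1)) ≤ 1 - (u : ℝ) ^ (m + 1) :=
      mul_le_of_le_one_left (by linarith [hp (m + 1)]) (by linarith [hp0 (h - 1)])
    have := mul_le_mul_of_nonneg_right hθ (by positivity : (0 : ℝ) ≤ 1 + S)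
    refine this.trans ?_
    rw [pow_succ, pow_add]
    nlinarith
  · have a1 : min (ℓ - 1) (2 * h - (ℓ - 1)) = h - 1 := by omega
    have a3 : min (ℓ + 1) (2 * h - (ℓ + 1)) = h - 1 := by omega
    rw [a1, a3]
    have hθ : (1 - (u : ℝ) ^ (h - 1)) * (1 - (u : ℝ) ^ min ℓ (2 * h - ℓ)) ≤
        1 - (u : ℝ) ^ (h - 1) :=
      mul_le_of_le_one_right (by linarith [hp (h - 1)]) (by linarith [hp0 (min ℓ (2 * h - ℓ))])
    have := mul_le_mul_of_nonneg_right hθ (by positivity : (0 : ℝ) ≤ 1 + S)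
    linarith
  · have hSu : (S : ℝ) ≤ u := by
      rw [if_neg (by omega)] at hν
      have hSr : (S : ℝ) = ∑ j ∈ Finset.range k₂, ((ω (j :: x)).2 : ℝ) := by
        rw [hS, hν]; push_cast; rfl
      have : ∀ j ∈ Finset.range k₂, (k₂ : ℝ) * (ω (j :: x)).2 ≤ u := by
        intro j hj
        have := (hchild j (by rw [hν]; exact Finset.mem_range.1 hj)).2
        rw [if_neg (by omega)] at this
        exact_mod_cast this
      have h3 := Finset.sum_le_sum this
      rw [Finset.sum_const, Finset.card_range, nsmul_eq_mul, ← Finset.mul_sum, ← hSr] at h3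
      rcases Nat.eq_zero_or_pos k₂ with h0 | h0
      · rw [hSr, h0]; simp
      · have hk' : (0 : ℝ) < k₂ := by exact_mod_cast h0
        exact le_of_mul_le_mul_left h3 hk'
    obtain ⟨m, hm⟩ : ∃ m, 2 * h - ℓ = m + 1 := ⟨2 * h - ℓ - 1, by omega⟩
    have a1 : min ℓ (2 * h - ℓ) = m + 1 := by omega
    have a2 : min (ℓ - 1) (2 * h - (ℓ - 1)) = m + 2 := by omega
    have a3 : min (ℓ + 1) (2 * h - (ℓ + 1)) = m := by omega
    rw [a1, a2, a3]
    have hkey : (u : ℝ) ^ m * ((1 - u) * (S - u)) ≤ 0 :=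
      mul_nonpos_of_nonneg_of_nonpos (hp0 m)
        (mul_nonpos_of_nonneg_of_nonpos (by linarith) (by linarith))
    have hθ : (1 - (u : ℝ) ^ (h - 1)) * (1 - (u : ℝ) ^ (m + 1)) ≤ 1 - (u : ℝ) ^ (m + 1) :=
      mul_le_of_le_one_left (by linarith [hp (m + 1)]) (by linarith [hp0 (h - 1)])
    have := mul_le_mul_of_nonneg_right hθ (by positivity : (0 : ℝ) ≤ 1 + S)
    refine this.trans ?_
    rw [pow_succ, pow_add]
    nlinarith

theorem trapFun_le_one (u : ℝ≥0) (h : ℕ) (z : Vertex) : trapFun u h z ≤ 1 := by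
  rcases z with _ | x
  · exact zero_le
  · exact tsub_le_self

/-- `trapFun` vanishes at generations 0 and 2h, so iterating the one-step inequality keeps the walk
strictly inside the trap for `n` steps; `c` then bounds the chance of returning to the root and
escaping. -/
theorem pow_mul_trapFun_le {k₁ k₂ : ℕ} {u : ℝ≥0} {h : ℕ} (hu : u ≤ 1) {ω : Env}
    (hω : ω ∈ trapped k₁ k₂ u h) {c : ℝ≥0∞}
    (hc : ∀ x, IsVertex ω x → x.length < 2 * h → c ≤ quenchedLaw ω (word x) (lateReturn 0))
    (n : ℕ) {x : List ℕ} (hx : IsVertex ω x) (hl : x.length ≤ 2 * h) :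
    ((1 - u ^ (h - 1) : ℝ≥0) : ℝ≥0∞) ^ n * (trapFun u h (word x) * c) ≤
      quenchedLaw ω (word x) (lateReturn n) := by
  have hzero : ∀ x : List ℕ, x.length = 0 ∨ 2 * h ≤ x.length → trapFun u h (word x) = 0 := by
    intro x hx
    have : min x.length (2 * h - x.length) = 0 := by omega
    simp [trapFun, word, this]
  induction n generalizing x with
  | zero =>
    by_cases hlt : x.length < 2 * h
    · rw [pow_zero, one_mul]
      refine le_trans ?_ (hc x hx hlt)
      exact mul_le_of_le_one_left zero_le (by exact_mod_cast trapFun_le_one u h _)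
    · rw [hzero x (Or.inr (not_lt.1 hlt))]; simp
  | succ n ih =>
    by_cases hlt : 1 ≤ x.length ∧ x.length < 2 * h
    swap
    · rw [hzero x (by omega)]; simp
    refine le_trans ?_ (step_le_quenchedLaw ω (word x) (E' := lateReturn n)
      (measurableSet_lateReturn n) fun X h0 hX => mem_lateReturn_of_shift h0 hX)
    calc ((1 - u ^ (h - 1) : ℝ≥0) : ℝ≥0∞) ^ (n + 1) * (trapFun u h (word x) * c)
        = ((1 - u ^ (h - 1) : ℝ≥0) : ℝ≥0∞) ^ n * c *
          (((1 - u ^ (h - 1)) * trapFun u h (word x) : ℝ≥0) : ℝ≥0∞) := by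
          rw [ENNReal.coe_mul, pow_succ]; ring
      _ ≤ ((1 - u ^ (h - 1) : ℝ≥0) : ℝ≥0∞) ^ n * c *
          ∑' z, transProb ω (word x) z * trapFun u h z :=
          mul_le_mul_right (trapFun_step hu hω hx hlt.1 hlt.2) _
      _ ≤ _ := by
          rw [← ENNReal.tsum_mul_left]
          refine ENNReal.tsum_le_tsum fun z => ?_
          by_cases hz : transProb ω (word x) z = 0
          · simp [hz]
          rw [mul_left_comm]
          refine mul_le_mul_right ?_ _
          rcases transProb_word_ne_zero hz with rfl | ⟨i, hi, rfl⟩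
          · cases x with
            | nil => simp at hlt
            | cons i x =>
              refine le_trans (le_of_eq (by rw [wordParent]; ring)) (ih hx.1 ?_)
              have := hlt.2
              simp only [List.length_cons] at this
              omega
          · refine le_trans (le_of_eq (by ring)) (ih (x := i :: x) ⟨hx, hi⟩ ?_)
            simpa using hlt.2

end RWRE

/-! ### The cost of a trap and of leaving it through the root -/

namespace RWRE

/-- Scenario: step to the first child, stay in the trap for `n` steps, climb to the root, descend
along the leftmost path to generation 2h and escape below it. All transition probabilities used in
the first 2h generations are at least `c`, and climbing and descending cost at most 4h of them. -/
theorem lateReturn_ge {k₁ k₂ : ℕ} {u i s : ℝ≥0} {h : ℕ} (hh : 1 ≤ h) (hu : u ≤ 1) {ω : Env}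
    (hω : ω ∈ trapped k₁ k₂ u h) (hA : MarksIn i s ω) (hν : ∀ x, 1 ≤ (ω x).1) {c : ℝ≥0}
    (hc : c * (1 + max k₁ k₂ * s) ≤ min 1 i) (n : ℕ) :
    (c : ℝ≥0∞) * (((1 - u ^ (h - 1) : ℝ≥0) : ℝ≥0∞) ^ n * (((1 - u : ℝ≥0) : ℝ≥0∞) *
      ((c : ℝ≥0∞) ^ (4 * h) * esc (subEnv (List.replicate (2 * h) 0) ω)))) ≤
      quenchedLaw ω root (lateReturn n) := by
  have hvert : ∀ j, IsVertex ω (List.replicate j 0) := by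
    intro j
    induction j with
    | zero => trivial
    | succ j ih => exact ⟨ih, hν _⟩
  have htot : ∀ x, IsVertex ω x → x.length < 2 * h → total ω x ≤ 1 + max k₁ k₂ * s := by
    intro x hx hl
    refine add_le_add_right ((Finset.sum_le_card_nsmul _ _ s fun j _ => (hA _).2).trans ?_) 1
    rw [Finset.card_range, nsmul_eq_mul, (hω x (mem_wordsLE_of_trapped hω hx hl.le)).1 hl]
    gcongr
    split_ifs
    exacts [le_max_left _ _, le_max_right _ _]
  have hup : ∀ x, IsVertex ω x → x.length < 2 * h → c ≤ 1 / total ω x := by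
    intro x hx hl
    rw [le_div_iff₀ (total_pos ω x)]
    exact (mul_le_mul_right (htot x hx hl) c).trans (hc.trans (min_le_left _ _))
  have hdown : ∀ x, IsVertex ω x → x.length < 2 * h → ∀ j, c ≤ (ω (j :: x)).2 / total ω x := by
    intro x hx hl j
    rw [le_div_iff₀ (total_pos ω x)]
    exact (mul_le_mul_right (htot x hx hl) c).trans ((hc.trans (min_le_right _ _)).trans (hA _).1)
  have hc1 : c ≤ 1 := by
    refine le_trans ?_ (hc.trans (min_le_left _ _))
    exact le_mul_of_one_le_right zero_le le_self_add
  have hspine := pow_mul_esc_le ω (c := c) (N := 2 * h)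
    (fun j hj => hdown _ (hvert j) (by simpa using hj) 0) (fun j _ => hν _) 0 (Nat.zero_le _)
  set e := esc (subEnv (List.replicate (2 * h) 0) ω) with he
  have hback : ∀ x, IsVertex ω x → x.length < 2 * h →
      (c : ℝ≥0∞) ^ (4 * h) * e ≤ quenchedLaw ω (word x) (lateReturn 0) := by
    intro x hx hl
    refine le_trans ?_ (pow_mul_le_lateReturn ω (c := c) (N := 2 * h - 1)
      (fun x hx hl => hup x hx (by omega)) hx (by omega))
    have e4 : 4 * h = 2 * h + 2 * h := by ring
    rw [e4, pow_add, mul_assoc]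
    refine mul_le_mul' (pow_le_pow_right_of_le_one' (by exact_mod_cast hc1) hl.le) ?_
    exact hspine
  have h0 : IsVertex ω [0] := hvert 1
  have hstay := pow_mul_trapFun_le hu hω hback n h0 (by simp; omega)
  have htrap : trapFun u h (word [0]) = 1 - u := by
    have : min 1 (2 * h - 1) = 1 := by omega
    simp [trapFun, word, this]
  rw [htrap] at hstay
  refine (mul_le_mul_right hstay _).trans ?_
  exact step_single_le ω (x := []) ((ENNReal.coe_le_coe.2 (hdown [] trivial (by simp; omega) 0)).trans
    (transProb_child_ge (hν []))) (measurableSet_lateReturn n)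
    fun X h0 hX => lateReturn_anti (Nat.le_succ n) (mem_lateReturn_of_shift h0 hX)

/-- Take h = ⌊η log n⌋. The trap has at most (K+1)^(2h) ≤ n^(1/2) vertices, and staying in it costs
n·u^(h-1), of order n^(1 - η|log u|), in the exponent. Any α above 1/2 and above 1 - η|log u| is
enough, and such an α < 1 exists. -/
theorem eventually_exp_neg_rpow_le {K : ℕ} (hK1 : 1 ≤ K) {u c p C₀ : ℝ} (hu0r : 0 < u)
    (hu1r : u < 1) (hc0r : 0 < c) (hp0r : 0 < p) (hp1 : p ≤ 1) (hC₀0 : 0 < C₀) :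
    ∃ α : ℝ, 0 < α ∧ α < 1 ∧ ∀ᶠ n : ℕ in atTop, ∃ h : ℕ, 1 ≤ h ∧ Real.exp (-(n : ℝ) ^ α) ≤
      C₀ * (1 - u ^ (h - 1)) ^ n * c ^ (4 * h) * p ^ ((K + 1) ^ (2 * h)) := by
  set lK := Real.log (K + 1) with hlK
  have hlK0 : 0 < lK := Real.log_pos (by
    have : (1 : ℝ) ≤ K := by exact_mod_cast hK1
    linarith)
  set lu := -Real.log u with hlu
  have hlu0 : 0 < lu := by linarith [Real.log_neg hu0r hu1r]
  set η : ℝ := 1 / (4 * lK) with hη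
  have hη0 : 0 < η := by positivity
  set α : ℝ := max (3 / 4) (1 - η * lu / 2) with hα
  have hα1 : 1 / 2 < α := lt_of_lt_of_le (by norm_num) (le_max_left _ _)
  have hα2 : 1 - η * lu < α :=
    lt_of_lt_of_le (by linarith [mul_pos hη0 hlu0]) (le_max_right _ _)
  refine ⟨α, by linarith, max_lt (by norm_num) (by linarith [mul_pos hη0 hlu0]), ?_⟩
  filter_upwards [eventually_mul_rpow_le (4 * -Real.log C₀) (show (0 : ℝ) < α by linarith),
    eventually_mul_rpow_le (16 * |Real.log c|) hα1,
    eventually_mul_rpow_le (4 * -Real.log p) hα1,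
    eventually_mul_rpow_le (8 * (u ^ 2)⁻¹) hα2,
    eventually_mul_rpow_le (2 * (u ^ 2)⁻¹) (mul_pos hη0 hlu0),
    (Real.tendsto_log_atTop.comp (tendsto_natCast_atTop_atTop (R := ℝ))).eventually_ge_atTop (1 / η),
    eventually_ge_atTop 1] with n b1 b2 b3 b4 b5 b6 hn1
  rw [Real.rpow_zero, mul_one] at b1 b5
  have hn' : (1 : ℝ) ≤ n := by exact_mod_cast hn1
  have hn0 : (0 : ℝ) < n := by linarith
  have hlog : 1 / η ≤ Real.log n := b6
  rw [div_le_iff₀ hη0] at hlog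
  set h := ⌊Real.log n * η⌋₊
  have hh1 : (h : ℝ) ≤ Real.log n * η := Nat.floor_le (by linarith)
  have hh2 : Real.log n * η < h + 1 := Nat.lt_floor_add_one _
  have hh : 1 ≤ h := Nat.le_floor (by simpa using hlog)
  refine ⟨h, hh, ?_⟩
  have hpowK : (((K + 1) ^ (2 * h) : ℕ) : ℝ) ≤ (n : ℝ) ^ (1 / 2 : ℝ) := by
    push_cast
    rw [← Real.rpow_natCast, Real.rpow_def_of_pos (by positivity), Real.rpow_def_of_pos hn0]
    refine Real.exp_le_exp.2 ?_
    push_cast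
    have : lK * (2 * h) ≤ lK * (2 * (Real.log n * η)) := by gcongr
    refine this.trans (le_of_eq ?_)
    rw [hη]; field_simp; ring
  have hhn : (h : ℝ) ≤ (n : ℝ) ^ (1 / 2 : ℝ) := by
    refine le_trans ?_ hpowK
    have : h < (K + 1) ^ (2 * h) :=
      (Nat.lt_pow_self (by omega : 1 < K + 1)).trans_le (Nat.pow_le_pow_right (by omega) (by omega))
    exact_mod_cast this.le
  set θ := u ^ (h - 1) with hθ
  have hθ0 : 0 < θ := by positivity
  have hθle : θ ≤ (u ^ 2)⁻¹ * (n : ℝ) ^ (-(η * lu)) := by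
    have e1 : θ * u ^ 2 ≤ (n : ℝ) ^ (-(η * lu)) := by
      rw [hθ, ← pow_add, show h - 1 + 2 = h + 1 by omega, ← Real.rpow_natCast,
        Real.rpow_def_of_pos hu0r, Real.rpow_def_of_pos hn0]
      refine Real.exp_le_exp.2 ?_
      have : Real.log u = -lu := by rw [hlu, neg_neg]
      rw [this]
      push_cast
      nlinarith
    rw [inv_mul_eq_div, le_div_iff₀ (by positivity)]
    exact e1
  have hθhalf : θ ≤ 1 / 2 := by
    refine hθle.trans ?_
    rw [Real.rpow_neg hn0.le, ← div_eq_mul_inv, div_le_iff₀ (by positivity)]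
    linarith
  have hnθ : n * θ ≤ (u ^ 2)⁻¹ * (n : ℝ) ^ (1 - η * lu) := by
    have e2 : (n : ℝ) ^ (1 - η * lu) = n * (n : ℝ) ^ (-(η * lu)) := by
      rw [sub_eq_add_neg, Real.rpow_add hn0, Real.rpow_one]
    rw [e2]
    calc n * θ ≤ n * ((u ^ 2)⁻¹ * (n : ℝ) ^ (-(η * lu))) := by gcongr
      _ = _ := by ring
  have f1 : Real.exp (Real.log C₀) = C₀ := Real.exp_log hC₀0
  have f2 : Real.exp (-(2 * θ) * n) ≤ (1 - θ) ^ n := by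
    rw [mul_comm, Real.exp_nat_mul]
    refine pow_le_pow_left₀ (Real.exp_pos _).le ?_ n
    rw [← Real.le_log_iff_exp_le (by linarith)]
    refine le_trans ?_ (Real.one_sub_inv_le_log_of_pos (by linarith))
    have : (1 - θ)⁻¹ ≤ 1 + 2 * θ := by
      rw [inv_le_iff_one_le_mul₀ (by linarith)]
      nlinarith
    linarith
  have f3 : Real.exp (4 * h * Real.log c) = c ^ (4 * h) := by
    rw [← Real.rpow_natCast, Real.rpow_def_of_pos hc0r]; push_cast; congr 1; ring
  have f4 : Real.exp (((K + 1) ^ (2 * h) : ℕ) * Real.log p) = p ^ ((K + 1) ^ (2 * h)) := by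
    rw [Real.exp_nat_mul, Real.exp_log hp0r]
  rw [← f1, ← f3, ← f4]
  have hlp : Real.log p ≤ 0 := Real.log_nonpos hp0r.le hp1
  calc Real.exp (-(n : ℝ) ^ α) ≤ Real.exp (Real.log C₀ + -(2 * θ) * n + 4 * h * Real.log c +
        ((K + 1) ^ (2 * h) : ℕ) * Real.log p) := by
        refine Real.exp_le_exp.2 ?_
        have g3 : -((n : ℝ) ^ (1 / 2 : ℝ) * |Real.log c|) ≤ h * Real.log c := by
          have : (h : ℝ) * |Real.log c| ≤ (n : ℝ) ^ (1 / 2 : ℝ) * |Real.log c| := by gcongr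
          have := neg_abs_le (Real.log c)
          have hh0 : (0 : ℝ) ≤ h := Nat.cast_nonneg h
          nlinarith
        have g4 : (n : ℝ) ^ (1 / 2 : ℝ) * Real.log p ≤ ((K + 1) ^ (2 * h) : ℕ) * Real.log p :=
          mul_le_mul_of_nonpos_right hpowK hlp
        linarith
    _ = Real.exp (Real.log C₀) * Real.exp (-(2 * θ) * n) * Real.exp (4 * h * Real.log c) *
        Real.exp (((K + 1) ^ (2 * h) : ℕ) * Real.log p) := by
        rw [← Real.exp_add, ← Real.exp_add, ← Real.exp_add]
    _ ≤ _ := by gcongr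


/-- The parameters of a trap. -/
theorem exists_trap_parameters (ρ : Measure ℝ≥0) {k₁ k₂ : ℕ} (h1 : ρ {a | 1 < k₁ * a} ≠ 0)
    (h2 : ρ {a | k₂ * a < 1} ≠ 0) :
    ∃ u : ℝ≥0, 0 < u ∧ u < 1 ∧ ρ {a | 1 ≤ k₁ * a * u} ≠ 0 ∧ ρ {a | k₂ * a ≤ u} ≠ 0 := by
  -- A sequence in (0,1) increasing to 1: the strict inequalities of the hypotheses are covered by
  -- the countable unions over `n` of the weak ones, so some `n` gives positive measure for each,
  -- and the larger of the two serves both.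
  set v : ℕ → ℝ≥0 := fun n => (n + 1) / (n + 2) with hv
  have hv1 : ∀ n, v n < 1 := fun n => by
    rw [hv, div_lt_one (by positivity)]; gcongr; norm_num
  have hv0 : ∀ n, 0 < v n := fun n => by positivity
  have hmono : ∀ m n, m ≤ n → v m ≤ v n := by
    intro m n hmn
    have : (m : ℝ≥0) ≤ n := by exact_mod_cast hmn
    rw [hv, div_le_div_iff₀ (by positivity) (by positivity)]
    nlinarith
  have hlim : ∀ x : ℝ≥0, x < 1 → ∃ n, x ≤ v n := by
    intro x hx
    have hx' : (0 : ℝ) < 1 - x := by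
      have : (x : ℝ) < 1 := hx
      linarith
    obtain ⟨n, hn⟩ := exists_nat_one_div_lt hx'
    refine ⟨n, ?_⟩
    rw [hv, le_div_iff₀ (by positivity), ← NNReal.coe_le_coe]
    push_cast
    rw [div_lt_iff₀ (by positivity)] at hn
    nlinarith [NNReal.coe_nonneg x]
  obtain ⟨n1, hn1⟩ : ∃ n, ρ {a | 1 ≤ k₁ * a * v n} ≠ 0 := by
    by_contra hcon
    push Not at hcon
    refine h1 (measure_mono_null (t := ⋃ n, {a : ℝ≥0 | 1 ≤ k₁ * a * v n}) (fun a ha => ?_)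
      (measure_iUnion_null hcon))
    have ha' : 1 < k₁ * a := ha
    obtain ⟨n, hn⟩ := hlim ((k₁ * a)⁻¹) (inv_lt_one_of_one_lt₀ ha')
    refine Set.mem_iUnion.2 ⟨n, ?_⟩
    change 1 ≤ k₁ * a * v n
    have h0 : (k₁ * a) ≠ 0 := (one_pos.trans ha').ne'
    calc (1 : ℝ≥0) = k₁ * a * (k₁ * a)⁻¹ := (mul_inv_cancel₀ h0).symm
      _ ≤ _ := mul_le_mul_right hn _
  obtain ⟨n2, hn2⟩ : ∃ n, ρ {a | k₂ * a ≤ v n} ≠ 0 := by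
    by_contra hcon
    push Not at hcon
    refine h2 (measure_mono_null (t := ⋃ n, {a : ℝ≥0 | k₂ * a ≤ v n}) (fun a ha => ?_)
      (measure_iUnion_null hcon))
    obtain ⟨n, hn⟩ := hlim (k₂ * a) ha
    exact Set.mem_iUnion.2 ⟨n, hn⟩
  refine ⟨v (max n1 n2), hv0 _, hv1 _, fun h => hn1 (measure_mono_null (fun a ha => ?_) h),
    fun h => hn2 (measure_mono_null (fun a ha => ?_) h)⟩
  · have ha' : 1 ≤ k₁ * a * v n1 := ha
    exact ha'.trans (mul_le_mul_right (hmono _ _ (le_max_left _ _)) _)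
  · have ha' : k₂ * a ≤ v n2 := ha
    exact ha'.trans (hmono _ _ (le_max_right _ _))

section

variable (q : PMF ℕ) (ρ : Measure ℝ≥0) [IsProbabilityMeasure ρ]

/-- The conditions at different words are independent and each has probability at least `p`. In the
last generation, where the offspring number is free, prescribing it as well only lowers the bound.
-/
theorem pow_le_measure_trapped {k₁ k₂ : ℕ} {u : ℝ≥0} {p : ℝ≥0∞} (hp1 : p ≤ 1)
    (h1 : p ≤ q k₁ * ρ {a | 1 ≤ k₁ * a * u}) (h2 : p ≤ q k₁ * ρ {a | k₂ * a ≤ u})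
    (h3 : p ≤ q k₂ * ρ {a | 1 ≤ k₁ * a * u}) (h4 : p ≤ q k₂ * ρ {a | k₂ * a ≤ u}) (h : ℕ) :
    p ^ (max k₁ k₂ + 1) ^ (2 * h) ≤ envLaw q ρ (trapped k₁ k₂ u h) := by
  rw [trapped, envLaw, Measure.infinitePi_pi _ fun x _ => measurableSet_trapData _ _ _ _ _]
  refine le_trans ?_ (Finset.prod_le_prod' (f := fun _ => p) fun x _ => ?_)
  · rw [Finset.prod_const]
    exact pow_le_pow_right_of_le_one' hp1 (card_wordsLE_le _ _)
  · set k := if x.length < h then k₁ else k₂ with hk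
    set A : Set ℝ≥0 := if x.length ≤ h then {a | 1 ≤ k₁ * a * u} else {a | k₂ * a ≤ u} with hA
    have hsub : ({k} : Set ℕ) ×ˢ A ⊆ trapData k₁ k₂ u h x.length := by
      rintro ⟨k', a⟩ ⟨hk', ha⟩
      refine ⟨fun _ => hk', ?_⟩
      rw [hA] at ha
      split_ifs at ha ⊢
      · exact ha
      · exact ha
    refine le_trans ?_ (measure_mono hsub)
    rw [Measure.prod_prod, PMF.toMeasure_apply_singleton _ _ (measurableSet_singleton _), hk, hA]
    split_ifs <;> assumption

/-- The quenched bound is a constant times the indicator of the trap times the escape probability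
from the leftmost vertex of generation 2h; the last two are independent. -/
theorem annealedLaw_lt_firstRegen_ge {k₁ k₂ : ℕ} {u i s : ℝ≥0} (hu : u ≤ 1)
    (hρ : ∀ᵐ a ∂ρ, i ≤ a ∧ a ≤ s) (h0 : q 0 = 0) {c : ℝ≥0}
    (hc : c * (1 + max k₁ k₂ * s) ≤ min 1 i) {p : ℝ≥0∞} (hp1 : p ≤ 1)
    (h1 : p ≤ q k₁ * ρ {a | 1 ≤ k₁ * a * u}) (h2 : p ≤ q k₁ * ρ {a | k₂ * a ≤ u})
    (h3 : p ≤ q k₂ * ρ {a | 1 ≤ k₁ * a * u}) (h4 : p ≤ q k₂ * ρ {a | k₂ * a ≤ u}) {h : ℕ}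
    (hh : 1 ≤ h) (n : ℕ) :
    (c : ℝ≥0∞) * (((1 - u ^ (h - 1) : ℝ≥0) : ℝ≥0∞) ^ n * (((1 - u : ℝ≥0) : ℝ≥0∞) *
      (c : ℝ≥0∞) ^ (4 * h))) * (p ^ (max k₁ k₂ + 1) ^ (2 * h) *
        ∫⁻ ω, (esc ω : ℝ≥0∞) ∂envLaw q ρ) ≤
      annealedLaw q ρ root ({p | returnTime p.2 root = ⊤} ∩
        {p | (n : ℕ∞) < firstRegen p.1 p.2}) := by
  have hms : MeasurableSet ({p : Env × (ℕ → Vertex) | returnTime p.2 root = ⊤} ∩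
      {p | (n : ℕ∞) < firstRegen p.1 p.2}) :=
    (measurable_snd (measurableSet_returnTime root)).inter (measurableSet_lt_firstRegen n)
  have htm : MeasurableSet (trapped k₁ k₂ u h) :=
    MeasurableSet.pi (Finset.countable_toSet _) fun x _ => measurableSet_trapData _ _ _ _ _
  rw [annealedLaw, Measure.compProd_apply hms]
  set x₀ : List ℕ := List.replicate (2 * h) 0 with hx₀
  set C : ℝ≥0∞ := (c : ℝ≥0∞) * (((1 - u ^ (h - 1) : ℝ≥0) : ℝ≥0∞) ^ n *
    (((1 - u : ℝ≥0) : ℝ≥0∞) * (c : ℝ≥0∞) ^ (4 * h))) with hC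
  have hem : Measurable fun ω : Env => (esc ω : ℝ≥0∞) := measurable_esc.coe_nnreal_ennreal
  have hlow : ∀ᵐ ω ∂envLaw q ρ, C * ((trapped k₁ k₂ u h).indicator 1 ω * esc (subEnv x₀ ω)) ≤
      quenchedKernel root ω (Prod.mk ω ⁻¹' ({p | returnTime p.2 root = ⊤} ∩
        {p | (n : ℕ∞) < firstRegen p.1 p.2})) := by
    filter_upwards [ae_marksIn q hρ, ae_numChildren q ρ] with ω hω hq
    have hν : ∀ x, 1 ≤ (ω x).1 := fun x => Nat.one_le_iff_ne_zero.2 fun h => hq x (by rw [h, h0])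
    by_cases ht : ω ∈ trapped k₁ k₂ u h
    · rw [Set.indicator_of_mem ht, Pi.one_apply, one_mul]
      change _ ≤ quenchedLaw ω root _
      refine le_trans (le_trans (le_of_eq ?_) (lateReturn_ge hh hu ht hω hν hc n)) ?_
      · rw [hC]; ring
      · refine measure_mono_ae ?_
        have hs : ∀ᵐ X ∂quenchedLaw ω root, X 0 = root := by
          rw [ae_iff]; exact quenchedLaw_start ω root
        filter_upwards [quenchedLaw_ae_transProb_ne_zero ω root, hs] with X hX h0 hXm
        exact lt_firstRegen_of_lateReturn h0 hX hXm
    · rw [Set.indicator_of_notMem ht, zero_mul, mul_zero]; exact zero_le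
  refine le_trans ?_ (lintegral_mono_ae hlow)
  have hind : Measurable fun ω : Env => (trapped k₁ k₂ u h).indicator (1 : Env → ℝ≥0∞) ω :=
    measurable_one.indicator htm
  have hes : Measurable fun ω : Env => (esc (subEnv x₀ ω) : ℝ≥0∞) :=
    hem.comp (measurable_subEnv x₀)
  rw [lintegral_const_mul _ (hind.fun_mul hes)]
  refine mul_le_mul_right ?_ _
  rw [lintegral_mul_of_reveal q ρ (disjoint_upTo_strictBelow (x := x₀) (ℓ := 2 * h) (by simp [hx₀]))
    hind hes, lintegral_indicator_one htm,
    lintegral_subEnv q ρ x₀ (f := fun ω => (esc ω : ℝ≥0∞)) hem]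
  · exact mul_le_mul_left (pow_le_measure_trapped q ρ hp1 h1 h2 h3 h4 h) _
  · intro ω
    have := trapped_reveal k₁ k₂ u h ω
    by_cases ht : ω ∈ trapped k₁ k₂ u h
    · rw [Set.indicator_of_mem ht, Set.indicator_of_mem (this.2 ht)]; rfl
    · rw [Set.indicator_of_notMem ht, Set.indicator_of_notMem fun h => ht (this.1 h)]
  · intro ω
    rw [(agreeButMark_reveal le_rfl ω).esc_eq]

/-- Some vertices have a drift away from the root. -/
theorem exists_outward_drift (htr : (offspringMean q)⁻¹ < momentA ρ 1) :
    ∃ k, q k ≠ 0 ∧ ρ {a | 1 < k * a} ≠ 0 := by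
  by_contra hcon
  push Not at hcon
  -- If kA ≤ 1 almost surely for every k charged by `q`, then m𝐄[A] = ∑ q_k 𝐄[kA] ≤ 1.
  have hle : offspringMean q * momentA ρ 1 ≤ 1 := by
    rw [offspringMean, momentA, ← ENNReal.tsum_mul_right, ← q.tsum_coe]
    refine ENNReal.tsum_le_tsum fun k => ?_
    by_cases hk : q k = 0
    · simp [hk]
    have hae : ∀ᵐ a : ℝ≥0 ∂ρ, (k : ℝ≥0∞) * (a : ℝ≥0∞) ^ (1 : ℝ) ≤ 1 := by
      have := hcon k hk
      rw [← compl_compl {a : ℝ≥0 | 1 < k * a}] at this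
      filter_upwards [mem_ae_iff.2 this] with a ha
      have : (k : ℝ≥0) * a ≤ 1 := not_lt.1 ha
      rw [ENNReal.rpow_one]
      exact_mod_cast this
    have h1 : (k : ℝ≥0∞) * ∫⁻ a : ℝ≥0, (a : ℝ≥0∞) ^ (1 : ℝ) ∂ρ ≤ 1 := by
      rw [← lintegral_const_mul _ (by fun_prop)]
      exact (lintegral_mono_ae hae).trans (by simp)
    calc (k : ℝ≥0∞) * q k * ∫⁻ a : ℝ≥0, (a : ℝ≥0∞) ^ (1 : ℝ) ∂ρ =
        q k * (k * ∫⁻ a : ℝ≥0, (a : ℝ≥0∞) ^ (1 : ℝ) ∂ρ) := by ring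
      _ ≤ q k * 1 := mul_le_mul_right h1 _
      _ = q k := mul_one _
  refine absurd htr (not_lt.2 ?_)
  rw [← one_div]
  refine ENNReal.le_div_iff_mul_le ?_ ?_ |>.2 (by rwa [mul_comm])
  · by_cases h0 : offspringMean q = 0
    · right; exact one_ne_zero
    · left; exact h0
  · right; exact ENNReal.one_ne_top

/-- The stretched exponential lower bound. -/
theorem exists_le_annealedLaw_lt_firstRegen {k₁ k₂ : ℕ} {i s : ℝ≥0} (hi : 0 < i)
    (hρ : ∀ᵐ a ∂ρ, i ≤ a ∧ a ≤ s) (h0 : q 0 = 0)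
    (hesc : ∫⁻ ω, (esc ω : ℝ≥0∞) ∂envLaw q ρ ≠ 0) (hq1 : q k₁ ≠ 0) (hq2 : q k₂ ≠ 0)
    (hk1 : ρ {a | 1 < k₁ * a} ≠ 0) (hk2 : ρ {a | k₂ * a < 1} ≠ 0) :
    ∃ α : ℝ, 0 < α ∧ α < 1 ∧ ∀ᶠ n : ℕ in atTop, ENNReal.ofReal (Real.exp (-(n : ℝ) ^ α)) ≤
      annealedLaw q ρ root ({p | returnTime p.2 root = ⊤} ∩
        {p | (n : ℕ∞) < firstRegen p.1 p.2}) := by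
  obtain ⟨u, hu0, hu1, hA1, hA2⟩ := exists_trap_parameters ρ hk1 hk2
  set K := max k₁ k₂ with hK
  have hK1 : 1 ≤ K := by
    refine le_trans (Nat.one_le_iff_ne_zero.2 ?_) (le_max_left k₁ k₂)
    rintro rfl
    exact hq1 h0
  set c : ℝ≥0 := min 1 i / (1 + (K : ℝ≥0) * s) with hcdef
  have hc : c * (1 + (K : ℝ≥0) * s) ≤ min 1 i := by
    rw [hcdef, div_mul_cancel₀ _ (by positivity)]
  have hc0 : 0 < c := by positivity
  -- One constant below all four products of an offspring probability and a mark probability.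
  set p' : ℝ≥0∞ := min (q k₁) (q k₂) * min (ρ {a | 1 ≤ k₁ * a * u}) (ρ {a | k₂ * a ≤ u}) with hp'
  have hp'0 : p' ≠ 0 := by
    refine mul_ne_zero (ne_of_gt (lt_min ?_ ?_)) (ne_of_gt (lt_min ?_ ?_)) <;>
      exact pos_iff_ne_zero.2 ‹_›
  have hp'1 : p' ≤ 1 := mul_le_one' ((min_le_left _ _).trans (q.coe_le_one _))
    ((min_le_left _ _).trans prob_le_one)
  obtain ⟨p, hp⟩ : ∃ p : ℝ≥0, (p : ℝ≥0∞) = p' :=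
    ⟨_, ENNReal.coe_toNNReal (ne_top_of_le_ne_top ENNReal.one_ne_top hp'1)⟩
  have hesc1 : ∫⁻ ω, (esc ω : ℝ≥0∞) ∂envLaw q ρ ≠ ⊤ :=
    ne_top_of_le_ne_top ENNReal.one_ne_top
      ((lintegral_mono fun ω => ENNReal.coe_le_coe.2 (esc_le_one ω)).trans (by simp))
  obtain ⟨e, he⟩ : ∃ e : ℝ≥0, (e : ℝ≥0∞) = ∫⁻ ω, (esc ω : ℝ≥0∞) ∂envLaw q ρ :=
    ⟨_, ENNReal.coe_toNNReal hesc1⟩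
  have he0 : 0 < e := by
    rw [← he] at hesc
    exact pos_iff_ne_zero.2 (by exact_mod_cast hesc)
  have hp0 : 0 < p := by
    rw [← hp] at hp'0
    exact pos_iff_ne_zero.2 (by exact_mod_cast hp'0)
  have hp1 : p ≤ 1 := by rw [← hp] at hp'1; exact_mod_cast hp'1
  have hkey := fun (h : ℕ) (hh : 1 ≤ h) (n : ℕ) => annealedLaw_lt_firstRegen_ge q ρ hu1.le hρ h0
    hc (p := p') hp'1 (mul_le_mul' (min_le_left _ _) (min_le_left _ _))
    (mul_le_mul' (min_le_left _ _) (min_le_right _ _))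
    (mul_le_mul' (min_le_right _ _) (min_le_left _ _))
    (mul_le_mul' (min_le_right _ _) (min_le_right _ _)) hh n
  rw [← hp, ← he] at hkey
  have hu1r : (u : ℝ) < 1 := hu1
  have hC₀0 : (0 : ℝ) < c * (1 - u) * e := by
    have : (0 : ℝ) < 1 - u := by linarith
    have hc0r : (0 : ℝ) < c := hc0
    have he0r : (0 : ℝ) < e := he0
    positivity
  obtain ⟨α, hα0, hα1, hα⟩ := eventually_exp_neg_rpow_le hK1 (u := u) (c := c) (p := p)
    (C₀ := c * (1 - u) * e) hu0 hu1r hc0 hp0 hp1 hC₀0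
  refine ⟨α, hα0, hα1, ?_⟩
  filter_upwards [hα] with n ⟨h, hh, hle⟩
  refine le_trans ?_ (hkey h hh n)
  have e1 : ((1 - u ^ (h - 1) : ℝ≥0) : ℝ) = 1 - (u : ℝ) ^ (h - 1) := by
    rw [NNReal.coe_sub (pow_le_one' hu1.le _)]; push_cast; rfl
  have e2 : ((1 - u : ℝ≥0) : ℝ) = 1 - (u : ℝ) := by
    rw [NNReal.coe_sub hu1.le]; push_cast; rfl
  rw [← e1, ← e2] at hle
  refine (ENNReal.ofReal_le_ofReal hle).trans (le_of_eq ?_)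
  generalize (K + 1) ^ (2 * h) = N
  generalize 1 - u ^ (h - 1) = x
  generalize 1 - u = y
  have e3 : (c : ℝ) * y * e * (x : ℝ) ^ n * (c : ℝ) ^ (4 * h) * (p : ℝ) ^ N =
      ((c * (x ^ n * (y * c ^ (4 * h))) * (p ^ N * e) : ℝ≥0) : ℝ) := by
    push_cast; ring
  rw [e3, ENNReal.ofReal_coe_nnreal]
  push_cast
  rfl

end

end RWRE

namespace RWRE

/-! ### Conclusion -/

theorem measure_mul_lt_one_ne_zero (ρ : Measure ℝ≥0) {k : ℕ} (h : essInfA ρ < (k : ℝ≥0∞)⁻¹) :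
    ρ {a | k * a < 1} ≠ 0 := by
  intro h0
  refine absurd h (not_lt.2 (le_essInf_of_ae_le _ ?_))
  have hae : ∀ᵐ a : ℝ≥0 ∂ρ, ¬ (k * a < 1) := by
    rw [ae_iff]; simpa using h0
  filter_upwards [hae] with a ha
  rw [ENNReal.inv_le_iff_inv_le]
  rw [not_lt] at ha
  have ha0 : a ≠ 0 := by
    rintro rfl; simp at ha
  have hinv : a⁻¹ ≤ (k : ℝ≥0) := by
    rw [inv_le_iff_one_le_mul₀ (pos_iff_ne_zero.2 ha0)]; exact ha
  rw [← ENNReal.coe_inv ha0]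
  exact_mod_cast hinv

section

variable (q : PMF ℕ) (ρ : Measure ℝ≥0) [IsProbabilityMeasure ρ]

theorem ae_mem_Icc_of_essInfA (hi : 0 < essInfA ρ) (hs : essSupA ρ < ⊤) :
    ∃ i s : ℝ≥0, 0 < i ∧ (i : ℝ≥0∞) = essInfA ρ ∧ (s : ℝ≥0∞) = essSupA ρ ∧
      ∀ᵐ a ∂ρ, i ≤ a ∧ a ≤ s := by
  have h1 : ∀ᵐ a : ℝ≥0 ∂ρ, essInfA ρ ≤ (a : ℝ≥0∞) := ae_essInf_le
  have h2 : ∀ᵐ a : ℝ≥0 ∂ρ, (a : ℝ≥0∞) ≤ essSupA ρ := ae_le_essSup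
  obtain ⟨a, ha⟩ := h1.exists
  have hit : essInfA ρ ≠ ⊤ := ne_top_of_le_ne_top ENNReal.coe_ne_top ha
  obtain ⟨i, hi'⟩ : ∃ i : ℝ≥0, (i : ℝ≥0∞) = essInfA ρ := ⟨_, ENNReal.coe_toNNReal hit⟩
  obtain ⟨s, hs'⟩ : ∃ s : ℝ≥0, (s : ℝ≥0∞) = essSupA ρ := ⟨_, ENNReal.coe_toNNReal hs.ne⟩
  refine ⟨i, s, ?_, hi', hs', ?_⟩
  · rw [← hi'] at hi; exact_mod_cast hi
  · filter_upwards [h1, h2] with a h h'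
    rw [← hi', ENNReal.coe_le_coe] at h
    rw [← hs', ENNReal.coe_le_coe] at h'
    exact ⟨h, h'⟩

/-- Conditioning divides by the probability of D(e) = ∞, positive by the lower bound itself.
Slightly worse exponents absorb this constant and make the inequalities strict. -/
theorem exists_condLaw_bounds {α β : ℝ} (hα1 : α < 1) (hβ0 : 0 < β)
    (hlow : ∀ᶠ n : ℕ in atTop, ENNReal.ofReal (Real.exp (-(n : ℝ) ^ α)) ≤
      annealedLaw q ρ root ({p | returnTime p.2 root = ⊤} ∩
        {p | (n : ℕ∞) < firstRegen p.1 p.2}))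
    (hup : ∀ᶠ n : ℕ in atTop, annealedLaw q ρ root ({p | returnTime p.2 root = ⊤} ∩
        {p | (n : ℕ∞) < firstRegen p.1 p.2}) ≤ ENNReal.ofReal (Real.exp (-(n : ℝ) ^ β))) :
    ∃ α₁ α₂ : ℝ, 0 < α₂ ∧ α₂ < α₁ ∧ α₁ < 1 ∧ ∀ᶠ n : ℕ in atTop,
      Real.exp (-(n : ℝ) ^ α₁) <
        (condLaw q ρ).real {p | (n : ℕ∞) < firstRegen p.1 p.2} ∧
      (condLaw q ρ).real {p | (n : ℕ∞) < firstRegen p.1 p.2} <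
        Real.exp (-(n : ℝ) ^ α₂) := by
  have : IsProbabilityMeasure (annealedLaw q ρ root) := by unfold annealedLaw; infer_instance
  set μ := annealedLaw q ρ root
  set D : Set (Env × (ℕ → Vertex)) := {p | returnTime p.2 root = ⊤}
  have hD : MeasurableSet D := measurable_snd (measurableSet_returnTime root)
  have hcond : ∀ n : ℕ, (condLaw q ρ).real {p | (n : ℕ∞) < firstRegen p.1 p.2} =
      (μ.real D)⁻¹ * μ.real (D ∩ {p | (n : ℕ∞) < firstRegen p.1 p.2}) := by
    intro n
    rw [measureReal_def, condLaw, ProbabilityTheory.cond_apply hD, ENNReal.toReal_mul,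
      ENNReal.toReal_inv]
    rfl
  have hDpos : 0 < μ.real D := by
    obtain ⟨n, hn⟩ := hlow.exists
    refine ENNReal.toReal_pos (ne_of_gt ?_) (measure_ne_top _ _)
    exact ((ENNReal.ofReal_pos.2 (Real.exp_pos _)).trans_le hn).trans_le
      (measure_mono Set.inter_subset_left)
  have hD1 : μ.real D ≤ 1 := measureReal_le_one
  -- The cutoffs 1/2 here and 1/4 below guarantee `α₂ < α₁`.
  set α₁ := max ((1 + α) / 2) (1 / 2) with hα₁
  set α₂ := min (β / 2) (1 / 4) with hα₂
  have hlt1 : α < α₁ := lt_of_lt_of_le (by linarith) (le_max_left _ _)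
  have hlt2 : α₂ < β := (min_le_left _ _).trans_lt (by linarith)
  have h20 : 0 < α₂ := by positivity
  refine ⟨α₁, α₂, h20, ?_, max_lt (by linarith) (by norm_num), ?_⟩
  · exact lt_of_le_of_lt (min_le_right _ _) (lt_of_lt_of_le (by norm_num) (le_max_right _ _))
  filter_upwards [hlow, hup, eventually_mul_rpow_le 2 hlt1, eventually_mul_rpow_le 2 hlt2,
    eventually_mul_rpow_le (2 * (1 - Real.log (μ.real D))) hβ0, eventually_ge_atTop 1]
    with n h1 h2 h3 h4 h5 hn
  have hn' : (0 : ℝ) < n := by exact_mod_cast hn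
  rw [Real.rpow_zero, mul_one] at h5
  rw [hcond]
  set P := μ.real (D ∩ {p | (n : ℕ∞) < firstRegen p.1 p.2}) with hP
  have hP1 : Real.exp (-(n : ℝ) ^ α) ≤ P :=
    (ENNReal.ofReal_le_iff_le_toReal (measure_ne_top _ _)).1 h1
  have hP2 : P ≤ Real.exp (-(n : ℝ) ^ β) := ENNReal.toReal_le_of_le_ofReal (Real.exp_pos _).le h2
  constructor
  · have hpos : 0 < (n : ℝ) ^ α := by positivity
    calc Real.exp (-(n : ℝ) ^ α₁) < Real.exp (-(n : ℝ) ^ α) := Real.exp_lt_exp.2 (by linarith)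
      _ ≤ P := hP1
      _ ≤ (μ.real D)⁻¹ * P := le_mul_of_one_le_left measureReal_nonneg
          ((one_le_inv₀ hDpos).2 hD1)
  · calc (μ.real D)⁻¹ * P ≤ (μ.real D)⁻¹ * Real.exp (-(n : ℝ) ^ β) := by gcongr
      _ = Real.exp (-Real.log (μ.real D) + -(n : ℝ) ^ β) := by
          rw [Real.exp_add, Real.exp_neg (Real.log (μ.real D)), Real.exp_log hDpos]
      _ < _ := Real.exp_lt_exp.2 (by linarith)

end

end RWRE

theorem proposition2p2 (q : PMF ℕ) (ρ : Measure ℝ≥0) [IsProbabilityMeasure ρ]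
    (hν : 1 ≤ RWRE.nuMin q)
    (hm : 1 < RWRE.offspringMean q) (hm' : RWRE.offspringMean q < ⊤)
    (hi : 0 < RWRE.essInfA ρ) (hs : RWRE.essSupA ρ < ⊤)
    (htransient : (RWRE.offspringMean q)⁻¹ < ⨅ t ∈ Set.Icc (0 : ℝ) 1, RWRE.momentA ρ t)
    (hlt : RWRE.essInfA ρ < (RWRE.nuMin q : ℝ≥0∞)⁻¹) :
    (q 1 = 0 → ∃ α₁ α₂ : ℝ, 0 < α₂ ∧ α₂ < α₁ ∧ α₁ < 1 ∧ ∀ᶠ n : ℕ in atTop,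
      Real.exp (-(n : ℝ) ^ α₁) <
        (RWRE.condLaw q ρ).real {p | (n : ℕ∞) < RWRE.firstRegen p.1 p.2} ∧
      (RWRE.condLaw q ρ).real {p | (n : ℕ∞) < RWRE.firstRegen p.1 p.2} <
        Real.exp (-(n : ℝ) ^ α₂)) ∧
    (RWRE.essSupA ρ < 1 → ∃ α₃ α₄ : ℝ, 0 < α₄ ∧ α₄ < α₃ ∧ α₃ < 1 ∧ ∀ᶠ n : ℕ in atTop,
      Real.exp (-(n : ℝ) ^ α₃) <
        (RWRE.condLaw q ρ).real {p | (n : ℕ∞) < RWRE.firstRegen p.1 p.2} ∧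
      (RWRE.condLaw q ρ).real {p | (n : ℕ∞) < RWRE.firstRegen p.1 p.2} <
        Real.exp (-(n : ℝ) ^ α₄)) := by
  obtain ⟨i, s, hi0, hie, hse, hρ⟩ := RWRE.ae_mem_Icc_of_essInfA ρ hi hs
  have hnu : q (RWRE.nuMin q) ≠ 0 := by
    obtain ⟨k, hk⟩ := q.support_nonempty
    exact (Nat.sInf_mem (s := {k | 0 < q k})
      ⟨k, pos_iff_ne_zero.2 ((q.mem_support_iff k).1 hk)⟩).ne'
  have h0 : q 0 = 0 := by
    by_contra h
    have : RWRE.nuMin q ≤ 0 := Nat.sInf_le (pos_iff_ne_zero.2 h)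
    omega
  have h1 : q 1 < 1 := by
    refine lt_of_le_of_ne (q.coe_le_one 1) fun h => ?_
    have hsupp := q.apply_eq_one_iff 1 |>.1 h
    refine hm.ne' ?_
    rw [RWRE.offspringMean, tsum_eq_single 1, h]
    · simp
    · intro k hk
      have : k ∉ q.support := by rw [hsupp]; exact hk
      rw [(q.apply_eq_zero_iff k).2 this, mul_zero]
  have hi1 : i < 1 := by
    have : (i : ℝ≥0∞) < 1 := by
      rw [hie]
      refine hlt.trans_le (ENNReal.inv_le_one.2 ?_)
      exact_mod_cast hν
    exact_mod_cast this
  have hpos := RWRE.lintegral_esc_pos q ρ hi0 hρ htransient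
  have hesc := RWRE.ae_esc_pos q ρ hi0 hρ h0 h1 hpos
  -- The moment condition at t = 1 gives the offspring number of the upper half of the trap; ν_min
  -- serves for the lower half.
  obtain ⟨k, hk, hkA⟩ := RWRE.exists_outward_drift q ρ
    (htransient.trans_le (iInf₂_le 1 (Set.right_mem_Icc.2 zero_le_one)))
  obtain ⟨α, -, hα1, hlow⟩ := RWRE.exists_le_annealedLaw_lt_firstRegen q ρ hi0 hρ h0 hpos.ne' hk hnu
    hkA (RWRE.measure_mul_lt_one_ne_zero ρ hlt)
  constructor
  · intro hq1
    obtain ⟨δ, hδ0, -, hδ⟩ := RWRE.exists_confined_le_of_no_single_child q ρ hi0 hi1 hρ h0 hq1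
      hm.le hm' hesc
    obtain ⟨β, hβ0, hup⟩ := RWRE.exists_annealedLaw_lt_firstRegen_le q ρ hi0 hρ h0 h1 hm' hesc
      hδ0 hδ
    exact RWRE.exists_condLaw_bounds q ρ hα1 hβ0 hlow hup
  · intro hs1
    rw [← hse] at hs1
    have hs1' : s ≤ 1 := by exact_mod_cast hs1.le
    obtain ⟨δ, hδ0, -, hδ⟩ := RWRE.exists_confined_le_of_marks_le_one q ρ hi0 hs1' hρ h0 h1
      hm.le hm' hesc
    obtain ⟨β, hβ0, hup⟩ := RWRE.exists_annealedLaw_lt_firstRegen_le q ρ hi0 hρ h0 h1 hm' hesc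
      hδ0 hδ
    exact RWRE.exists_condLaw_bounds q ρ hα1 hβ0 hlow hup
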